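/- **Setting.** Let $\mathbb K$ be a field. A *graded vector space with one brane* is a $\mathbb Z$-graded vector space $V$ of at most countable dimension with finite-dimensional subspaces $V_0\subset V_1\subset\dots$, $\bigcup_p V_p=V$, a descending filtration $F^0\supset F^1\supset\dots$ by graded subspaces with $V=V_p\oplus F^p$ (so $V/F^p=V_p$), and decompositions $V_p=W_p^+\oplus W_p^-$ into graded subspaces that are compatible with the inclusions $V_p\subset V_{p+1}$ and the projections $V_{p+1}\to V_p$. Put $W^\pm=\bigcup_pW_p^\pm$, $\hat W^-=\varprojlim W^-_p$ and $U=(\hat W^-)^*:=\varinjlim (W^-_p)^*$; thus $\hat W^-=U^*$. (A finite-dimensional $V=W^+\oplus W^-$ is the case $V_p=V$, $F^p=0$.) It is a *symplectic vector space with one Lagrangian brane*, $V^{1\text{-br}}_{symp}$, if it carries a graded skew-symmetric bilinear form $\omega$ of degree $0$ which is non-degenerate on every $V_p$, for which $W_p^\pm$ are isotropic of dimension $\frac12\dim V_p$, and which is compatible with the projections, $\omega(W_p^+,F^p\cap W^-)=0$; then $\omega$ induces an isomorphism $\flat:W^+\to U$, $w\mapsto\omega(w,\cdot)$. **The 2-oriented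 operads.** The generators are four planar corollas with two inputs and one output for the basic direction, every edge carrying an extra direction, which agrees with the basic one ($+$) or is opposite to it ($-$): $$A:(+,+)\to +,\qquad B:(-,-)\to -,\qquad C:(+,-)\to +,\qquad D:(+,-)\to - .$$ Write $g(a,b)$ for the corolla $g$ with inputs $a,b$ from left to right. $\mathcal Ass^{(2)}$ is the quotient of the free 2-oriented operad on $A,B,C,D$ (without symmetry) by $$A(A(1,2),3)=A(1,A(2,3)),\quad C(A(1,2),3)=A(1,C(2,3))+C(1,D(2,3)),\quad C(C(1,2),3)=C(1,B(2,3)),$$ $$B(B(1,2),3)=B(1,B(2,3)),\quad B(D(1,2),3)+D(C(1,2),3)=D(1,B(2,3)),\quad D(A(1,2),3)=D(1,D(2,3)).$$ $\mathcal Lie^{(2)}$ is the quotient of the free 2-oriented operad on $A,B,C,D$ by $A(1,2)=-A(2,1)$, $B(1,2)=-B(2,1)$ and $$A(A(1,2),3)+A(A(3,1),2)+A(A(2,3),1)=0,\qquad B(B(1,2),3)+B(B(3,1),2)+B(B(2,3),1)=0,$$ $$C(A(1,2),3)-A(1,C(2,3))+A(2,C(1,3))-C(1,D(2,3))+C(2,D(1,3))=0,$$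 $$C(C(1,2),3)-C(C(1,3),2)-C(1,B(2,3))=0,\qquad D(A(1,2),3)-D(1,D(2,3))+D(2,D(1,3))=0,$$ $$B(D(1,2),3)-B(D(1,3),2)+D(C(1,2),3)-D(C(1,3),2)-D(1,B(2,3))=0.$$ **Representations.** The component of the endomorphism operad of a space with one brane, for an operation whose inputs and output carry given extra directions, is the space of degree $0$ linear maps read along the extra direction: $\bigotimes W^+\to W^+\otimes\bigotimes U$ if the output edge has extra direction $+$, and $U\otimes\bigotimes W^+\to\bigotimes U$ if it has extra direction $-$, the factors $W^+$ in the source corresponding to the inputs with extra direction $+$ and the factors $U$ in the target to the inputs with extra direction $-$. Such a map can also be read along the basic direction, as a multilinear map in arguments from $W^+$ (on $+$ edges) and $\hat W^-=U^*$ (on $-$ edges); operadic composition is the composition of these, with Koszul signs for permutations of the inputs. A representation $\rho$ is a morphism of 2-oriented operads to this endomorphism operad. In particular it gives $A:W^+\otimes W^+\to W^+$, $B:U\to U\otimes U$, $C:W^+\to W^+\otimes U$ and $D:U\otimes W^+\to U$. A representation in $V^{1\text{-br}}_{symp}$ is *reduced symplectic Lagrangian* if, after the identification $\flat:W^+\cong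 U$, it takes the same value on any two generating corollas that become identical (as planar graphs, the legs being matched in cyclic order) once the basic directions are forgotten, i.e. on $A$ and $D$, and on $B$ and $C$. Read along the basic direction: $D(y,\psi)(\flat x)=\psi(\flat A(x,y))$ and $B(\psi,\chi)(\flat x)=\chi(\flat C(x,\psi))$ for $x,y\in W^+$, $\psi,\chi\in\hat W^-$. An *infinitesimal bialgebra* structure on a graded space $W$ is an associative product and a coassociative coproduct $\Delta:W\to W\otimes W$, both of degree $0$ (no unit or counit is required), with $\Delta(xy)=(x\otimes1)\Delta(y)+\Delta(x)(1\otimes y)$. A *Lie bialgebra* structure on $W$ is a bracket $[\,,]$ and a cobracket $\delta:W\to W\otimes W$ of degree $0$ that are skew-symmetric, satisfy the Jacobi and the co-Jacobi identity, and satisfy the cocycle condition that expresses $\delta[x,y]$ through the adjoint actions of $x$ on $\delta y$ and of $y$ on $\delta x$, all with Koszul signs. **Proposition.** Let $V^{1\text{-br}}_{symp}$ be a (finite- or countably infinite-dimensional) symplectic vector space with one Lagrangian brane $W^+$. (i) There is a one-to-one correspondence between reduced symplectic Lagrangian representations of $\mathcal Ass^{(2)}$ in $V^{1\text{-br}}_{symp}$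 and infinitesimal bialgebra structures on $W^+$. (ii) There is a one-to-one correspondence between reduced symplectic Lagrangian representations of $\mathcal Lie^{(2)}$ in $V^{1\text{-br}}_{symp}$ and Lie bialgebra structures on $W^+$. In both cases a representation corresponds to the structure whose product (bracket) is the value on $A$ and whose coproduct (cobracket) is the value $W^+\to W^+\otimes U\cong W^+\otimes W^+$ on $C$. -/

import Mathlib

open scoped TensorProduct DirectSum

universe u

noncomputable section

namespace TwoOriented

/-! ### Labelled trees: the free 2-oriented operad on the binary generators -/

/-- The extra direction of an edge of a 2-oriented tree, relative to its basic direction (which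
always runs from the leaves to the root): it either agrees with the basic one or is opposite. -/
inductive Dir : Type
  | co
  | contra

/-- The four generating planar binary corollas (with two inputs and one output for the basic
orientation).  A vertex must have at least one input and one output for the extra orientation as
well, and the planar order of the inputs has to agree with the order `co < contra`. -/
inductive Gen : Type
  | A
  | B
  | C
  | D

/-- Extra direction on the left input edge. -/
def Gen.inL : Gen → Dir
  | .A => .co
  | .B => .contra
  | .C => .co
  | .D => .co

/-- Extra direction on the right input edge. -/
def Gen.inR : Gen → Dir
  | .A => .co
  | .B => .contra
  | .C => .contra
  | .D => .contra

/-- Extra direction on the output edge. -/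
def Gen.out : Gen → Dir
  | .A => .co
  | .B => .contra
  | .C => .co
  | .D => .contra

/-- Planar trees built from the corollas, the input edges of which carry labels from `I`; the edge
labelled by `i` has extra direction `s i`, the root edge has the extra direction in the index. -/
inductive Tree {I : Type} (s : I → Dir) : Dir → Type
  | leaf (i : I) : Tree s (s i)
  | node (g : Gen) (l : Tree s g.inL) (r : Tree s g.inR) : Tree s g.out

namespace Tree

variable {I J : Type} {s : I → Dir} {t : J → Dir}

/-- The labels of the inputs, from left to right. -/
def leaves : {c : Dir} → Tree s c → List I
  | _, leaf i => [i]
  | _, node _ l r => l.leaves ++ r.leaves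

/-- Every label is used exactly once. -/
def Linear {c : Dir} (T : Tree s c) : Prop := T.leaves.Nodup ∧ ∀ i, i ∈ T.leaves

/-- Substitution of a tree for every leaf. -/
def bind (f : ∀ i, Tree t (s i)) : {c : Dir} → Tree s c → Tree t c
  | _, leaf i => f i
  | _, node g l r => node g (l.bind f) (r.bind f)

theorem leaves_bind (f : ∀ i, Tree t (s i)) {c : Dir} (T : Tree s c) :
    (T.bind f).leaves = T.leaves.flatMap fun i => (f i).leaves := by
  induction T with
  | leaf i => simp [bind, leaves]
  | node g l r hl hr => simp [bind, leaves, hl, hr]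

/-- Renaming of the labels. -/
def relabel (σ : I ≃ J) {c : Dir} (T : Tree (fun i => t (σ i)) c) : Tree t c :=
  T.bind fun i => leaf (σ i)

/-- The tree that is substituted for the leaf `o` when `T'` is grafted into the leaf `none`. -/
def graftLeaf {s : Option I → Dir} (T' : Tree t (s none)) :
    (o : Option I) → Tree (Sum.elim (fun i => s (some i)) t) (s o)
  | none => Tree.bind (s := t) (t := Sum.elim (fun i => s (some i)) t)
      (fun j => leaf (s := Sum.elim (fun i => s (some i)) t) (Sum.inr j)) T'
  | some i => leaf (Sum.inl i)

/-- Grafting of the root of `T'` into the leaf `none` of `T`. -/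
def graft {s : Option I → Dir} {c : Dir} (T : Tree s c) (T' : Tree t (s none)) :
    Tree (Sum.elim (fun i => s (some i)) t) c :=
  T.bind (graftLeaf T')

theorem leaves_relabel (σ : I ≃ J) {c : Dir} (T : Tree (fun i => t (σ i)) c) :
    (T.relabel σ).leaves = T.leaves.map σ := by
  rw [relabel, leaves_bind, List.map_eq_flatMap]
  rfl

theorem Linear.relabel (σ : I ≃ J) {c : Dir} {T : Tree (fun i => t (σ i)) c} (h : T.Linear) :
    (T.relabel σ).Linear := by
  rw [Linear, leaves_relabel]
  exact ⟨h.1.map σ.injective, fun j => List.mem_map.2 ⟨σ.symm j, h.2 _, by simp⟩⟩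

theorem leaves_graftLeaf_none {s : Option I → Dir} (T' : Tree t (s none)) :
    (graftLeaf T' none).leaves = T'.leaves.map Sum.inr := by
  refine (leaves_bind (s := t) (t := Sum.elim (fun i => s (some i)) t)
    (fun j => leaf (s := Sum.elim (fun i => s (some i)) t) (Sum.inr j)) T').trans ?_
  rw [List.map_eq_flatMap]
  rfl

theorem leaves_graftLeaf_some {s : Option I → Dir} (T' : Tree t (s none)) (i : I) :
    (graftLeaf T' (some i)).leaves = [Sum.inl i] := rfl

theorem Linear.graft {s : Option I → Dir} {c : Dir} {T : Tree s c} {T' : Tree t (s none)}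
    (h : T.Linear) (h' : T'.Linear) : (T.graft T').Linear := by
  rw [Linear, Tree.graft, leaves_bind]
  constructor
  · rw [List.nodup_flatMap]
    constructor
    · rintro (_ | i) _
      · rw [leaves_graftLeaf_none]
        exact h'.1.map Sum.inr_injective
      · simp [leaves_graftLeaf_some]
    · refine h.1.imp ?_
      rintro (_ | i) (_ | j) hij
      · exact absurd rfl hij
      · simp [Function.onFun, leaves_graftLeaf_none, leaves_graftLeaf_some]
      · simp [Function.onFun, leaves_graftLeaf_none, leaves_graftLeaf_some]
      · simpa [Function.onFun, leaves_graftLeaf_some] using fun e => hij (by rw [e])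
  · rintro (i | j)
    · exact List.mem_flatMap.2 ⟨some i, h.2 _, by simp [leaves_graftLeaf_some]⟩
    · exact List.mem_flatMap.2 ⟨none, h.2 _, by simp [leaves_graftLeaf_none, h'.2 j]⟩

end Tree

section FreeOperad

variable (K : Type u) [Field K]

/-- The component of the free 2-oriented operad with inputs labelled by `I`, extra directions `s`
on the inputs and `c` on the output: formal linear combinations of trees. -/
abbrev Fr {I : Type} (s : I → Dir) (c : Dir) : Type u := {T : Tree s c // T.Linear} →₀ K

namespace Fr

variable {I J : Type}

/-- A tree as an element of the free operad. -/
def tree {s : I → Dir} {c : Dir} (T : Tree s c) (h : T.Linear) : Fr K s c :=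
  Finsupp.single ⟨T, h⟩ 1

/-- Renaming of the labels of the inputs (the action of the symmetric groups). -/
def relabel (t : J → Dir) (c : Dir) (σ : I ≃ J) : Fr K (fun i => t (σ i)) c →ₗ[K] Fr K t c :=
  Finsupp.lmapDomain K K fun T => ⟨T.1.relabel σ, T.2.relabel σ⟩

/-- Operadic composition: grafting into the input `none`. -/
def graft (s : Option I → Dir) (t : J → Dir) (c : Dir) :
    Fr K s c →ₗ[K] Fr K t (s none) →ₗ[K] Fr K (Sum.elim (fun i => s (some i)) t) c :=
  Finsupp.linearCombination K fun T =>
    Finsupp.lmapDomain K K fun T' => ⟨T.1.graft T'.1, T.2.graft T'.2⟩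

/-- The operadic unit in the component with one input. -/
def unit (c : Dir) : Fr K (fun _ : Unit => c) c :=
  tree K (Tree.leaf (s := fun _ : Unit => c) ()) ⟨by simp [Tree.leaves], by simp [Tree.leaves]⟩

end Fr

/-- Extra directions of two inputs. -/
abbrev two (a b : Dir) : Fin 2 → Dir
  | 0 => a
  | 1 => b

/-- Extra directions of three inputs. -/
abbrev three (a b c : Dir) : Fin 3 → Dir
  | 0 => a
  | 1 => b
  | 2 => c

/-- The generator `g` with its inputs labelled `0, 1` from left to right. -/
def genTree (g : Gen) : Tree (two g.inL g.inR) g.out :=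
  .node g (.leaf (s := two g.inL g.inR) 0) (.leaf (s := two g.inL g.inR) 1)

theorem genTree_linear (g : Gen) : (genTree g).Linear := by
  cases g <;> exact ⟨by decide, by decide⟩

section Words

variable {n : ℕ} {s : Fin n → Dir} {a b c : Dir}

/-- The tree with root corolla `A`. -/
abbrev nA (l r : Tree s .co) : Tree s .co := .node .A l r

/-- The tree with root corolla `B`. -/
abbrev nB (l r : Tree s .contra) : Tree s .contra := .node .B l r

/-- The tree with root corolla `C`. -/
abbrev nC (l : Tree s .co) (r : Tree s .contra) : Tree s .co := .node .C l r

/-- The tree with root corolla `D`. -/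
abbrev nD (l : Tree s .co) (r : Tree s .contra) : Tree s .contra := .node .D l r

/-- The first of two inputs. -/
abbrev y0 : Tree (two a b) a := .leaf (s := two a b) 0

/-- The second of two inputs. -/
abbrev y1 : Tree (two a b) b := .leaf (s := two a b) 1

/-- The first of three inputs. -/
abbrev x0 : Tree (three a b c) a := .leaf (s := three a b c) 0

/-- The second of three inputs. -/
abbrev x1 : Tree (three a b c) b := .leaf (s := three a b c) 1

/-- The third of three inputs. -/
abbrev x2 : Tree (three a b c) c := .leaf (s := three a b c) 2

end Words

/-- A tree with inputs labelled by `0, …, n - 1` as an element of the free operad. -/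
abbrev mon {n : ℕ} {s : Fin n → Dir} {c : Dir} (T : Tree s c)
    (h : T.leaves.Nodup ∧ ∀ i, i ∈ T.leaves := by decide) : Fr K s c :=
  Fr.tree K T h

/-- The relations of the 2-oriented operad of associative algebras: for each admissible choice of
extra directions on the two sides of the associativity relation, the sum over all admissible
extra directions of the internal edge. -/
inductive AssRel : ∀ (I : Type) (s : I → Dir) (c : Dir), Fr K s c → Prop
  | aaa : AssRel (Fin 3) (three .co .co .co) .co
      (mon K (nA (nA x0 x1) x2)
        - mon K (nA x0 (nA x1 x2)))
  | aab : AssRel (Fin 3) (three .co .co .contra) .co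
      (mon K (nC (nA x0 x1) x2)
        - mon K (nA x0 (nC x1 x2))
        - mon K (nC x0 (nD x1 x2)))
  | abb : AssRel (Fin 3) (three .co .contra .contra) .co
      (mon K (nC (nC x0 x1) x2)
        - mon K (nC x0 (nB x1 x2)))
  | bbb : AssRel (Fin 3) (three .contra .contra .contra) .contra
      (mon K (nB (nB x0 x1) x2)
        - mon K (nB x0 (nB x1 x2)))
  | dbb : AssRel (Fin 3) (three .co .contra .contra) .contra
      (mon K (nB (nD x0 x1) x2)
        + mon K (nD (nC x0 x1) x2)
        - mon K (nD x0 (nB x1 x2)))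
  | ddd : AssRel (Fin 3) (three .co .co .contra) .contra
      (mon K (nD (nA x0 x1) x2)
        - mon K (nD x0 (nD x1 x2)))

/-- The relations of the 2-oriented operad of Lie algebras: skew symmetry of the two corollas whose
inputs can be permuted, and the Jacobi relation for each admissible choice of extra directions on
the inputs and the output, summed over all admissible extra directions of the internal edge. -/
inductive LieRel : ∀ (I : Type) (s : I → Dir) (c : Dir), Fr K s c → Prop
  | skewA : LieRel (Fin 2) (two .co .co) .co
      (mon K (nA y0 y1) + mon K (nA y1 y0))
  | skewB : LieRel (Fin 2) (two .contra .contra) .contra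
      (mon K (nB y0 y1) + mon K (nB y1 y0))
  | aaa : LieRel (Fin 3) (three .co .co .co) .co
      (mon K (nA (nA x0 x1) x2)
        + mon K (nA (nA x2 x0) x1)
        + mon K (nA (nA x1 x2) x0))
  | aab : LieRel (Fin 3) (three .co .co .contra) .co
      (mon K (nC (nA x0 x1) x2)
        - mon K (nA x0 (nC x1 x2))
        + mon K (nA x1 (nC x0 x2))
        - mon K (nC x0 (nD x1 x2))
        + mon K (nC x1 (nD x0 x2)))
  | abb : LieRel (Fin 3) (three .co .contra .contra) .co
      (mon K (nC (nC x0 x1) x2)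
        - mon K (nC (nC x0 x2) x1)
        - mon K (nC x0 (nB x1 x2)))
  | bbb : LieRel (Fin 3) (three .contra .contra .contra) .contra
      (mon K (nB (nB x0 x1) x2)
        + mon K (nB (nB x2 x0) x1)
        + mon K (nB (nB x1 x2) x0))
  | dbb : LieRel (Fin 3) (three .co .contra .contra) .contra
      (mon K (nB (nD x0 x1) x2)
        - mon K (nB (nD x0 x2) x1)
        + mon K (nD (nC x0 x1) x2)
        - mon K (nD (nC x0 x2) x1)
        - mon K (nD x0 (nB x1 x2)))
  | ddd : LieRel (Fin 3) (three .co .co .contra) .contra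
      (mon K (nD (nA x0 x1) x2)
        - mon K (nD x0 (nD x1 x2))
        + mon K (nD x1 (nD x0 x2)))

/-- A family of elements (relations) of the free operad. -/
abbrev Relations : Type (max 1 u) := ∀ (I : Type) (s : I → Dir) (c : Dir), Fr K s c → Prop

/-- Membership in the operadic ideal generated by the relations `R`. -/
inductive InIdeal (R : Relations K) :
    ∀ {I : Type} (s : I → Dir) (c : Dir), Fr K s c → Prop
  | rel {I : Type} {s : I → Dir} {c : Dir} (x : Fr K s c) (h : R I s c x) : InIdeal R s c x
  | zero {I : Type} {s : I → Dir} {c : Dir} : InIdeal R s c 0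
  | add {I : Type} {s : I → Dir} {c : Dir} (x y : Fr K s c) (hx : InIdeal R s c x)
      (hy : InIdeal R s c y) : InIdeal R s c (x + y)
  | smul {I : Type} {s : I → Dir} {c : Dir} (a : K) (x : Fr K s c) (hx : InIdeal R s c x) :
      InIdeal R s c (a • x)
  | relabel {I J : Type} {t : J → Dir} {c : Dir} (σ : I ≃ J) (x : Fr K (fun i => t (σ i)) c)
      (hx : InIdeal R (fun i => t (σ i)) c x) : InIdeal R t c (Fr.relabel K t c σ x)
  | graftLeft {I J : Type} {s : Option I → Dir} {t : J → Dir} {c : Dir} (x : Fr K s c)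
      (y : Fr K t (s none)) (hx : InIdeal R s c x) : InIdeal R _ c (Fr.graft K s t c x y)
  | graftRight {I J : Type} {s : Option I → Dir} {t : J → Dir} {c : Dir} (x : Fr K s c)
      (y : Fr K t (s none)) (hy : InIdeal R t (s none) y) : InIdeal R _ c (Fr.graft K s t c x y)

/-- The operadic ideal generated by the relations `R`. -/
def ideal (R : Relations K) {I : Type} (s : I → Dir) (c : Dir) : Submodule K (Fr K s c) where
  carrier := {x | InIdeal K R s c x}
  zero_mem' := .zero
  add_mem' hx hy := .add _ _ hx hy
  smul_mem' a _ hx := .smul a _ hx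

/-- The 2-oriented operad given by the four generators and the relations `R`. -/
abbrev Op (R : Relations K) {I : Type} (s : I → Dir) (c : Dir) : Type u := Fr K s c ⧸ ideal K R s c

/-- The class in `Op R s c` of an element of the free operad. -/
abbrev Op.mk (R : Relations K) {I : Type} {s : I → Dir} {c : Dir} (x : Fr K s c) : Op K R s c :=
  (ideal K R s c).mkQ x

end FreeOperad

/-! ### Vector spaces with one brane -/

/-- A submodule is homogeneous if it is spanned by its homogeneous elements. -/
def IsHomogeneousSub {K V : Type u} [Field K] [AddCommGroup V] [Module K V]
    (gr : ℤ → Submodule K V) (S : Submodule K V) : Prop :=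
  S ≤ ⨆ i, S ⊓ gr i

/-- A graded vector space of at most countable dimension with one brane: `V` is the union of the
finite-dimensional subspaces `Vp p`; it has a descending filtration `F` such that `V ⧸ F p = Vp p`;
and `Vp p = Wp p ⊕ Wm p` compatibly with the inclusions `Vp p → Vp (p + 1)` and the projections
`Vp (p + 1) → Vp p`. -/
structure BraneSpace (K V : Type u) [Field K] [AddCommGroup V] [Module K V] where
  /-- the grading -/
  gr : ℤ → Submodule K V
  gr_internal : DirectSum.IsInternal gr
  /-- the finite-dimensional subspaces -/
  Vp : ℕ → Submodule K V
  Vp_mono : Monotone Vp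
  Vp_finite : ∀ p, FiniteDimensional K (Vp p)
  Vp_exhaust : ⨆ p, Vp p = ⊤
  /-- the descending filtration -/
  F : ℕ → Submodule K V
  F_anti : Antitone F
  F_homog : ∀ p, IsHomogeneousSub gr (F p)
  F_compl : ∀ p, IsCompl (Vp p) (F p)
  /-- the pieces of the brane -/
  Wp : ℕ → Submodule K V
  /-- the pieces of the complement of the brane -/
  Wm : ℕ → Submodule K V
  Wp_mono : Monotone Wp
  Wm_mono : Monotone Wm
  Wp_homog : ∀ p, IsHomogeneousSub gr (Wp p)
  Wm_homog : ∀ p, IsHomogeneousSub gr (Wm p)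
  W_disjoint : ∀ p, Disjoint (Wp p) (Wm p)
  W_sup : ∀ p, Wp p ⊔ Wm p = Vp p
  Wp_proj : ∀ p, Wp (p + 1) ≤ Wp p ⊔ F p
  Wm_proj : ∀ p, Wm (p + 1) ≤ Wm p ⊔ F p

namespace BraneSpace

variable {K V : Type u} [Field K] [AddCommGroup V] [Module K V] (B : BraneSpace K V)

/-- The brane `W⁺`. -/
def Wpos : Submodule K V := ⨆ p, B.Wp p

/-- The complement `W⁻` of the brane. -/
def Wneg : Submodule K V := ⨆ p, B.Wm p

/-- The direct limit of the dual spaces of the `Wm p`: the functionals on `W⁻` that vanish on some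
`F p ∩ W⁻`, that is, that factor through some `W⁻ ⧸ (F p ∩ W⁻) = Wm p`.  It is the continuous dual
of the completion of `W⁻`. -/
def U : Submodule K (Module.Dual K B.Wneg) where
  carrier := {f | ∃ p, ∀ v : B.Wneg, (v : V) ∈ B.F p → f v = 0}
  zero_mem' := ⟨0, fun _ _ => rfl⟩
  add_mem' := by
    rintro f g ⟨p, hp⟩ ⟨q, hq⟩
    refine ⟨max p q, fun v hv => ?_⟩
    rw [LinearMap.add_apply, hp v (B.F_anti (le_max_left p q) hv),
      hq v (B.F_anti (le_max_right p q) hv), add_zero]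
  smul_mem' := by
    rintro a f ⟨p, hp⟩
    exact ⟨p, fun v hv => by rw [LinearMap.smul_apply, hp v hv, smul_zero]⟩

/-- The inverse limit of the `Wm p`, the completion of `W⁻`: it is the full dual space of `U`. -/
abbrev What : Type u := Module.Dual K B.U

/-- The induced grading of `W⁺`. -/
def grPos (i : ℤ) : Submodule K B.Wpos := (B.gr i).comap B.Wpos.subtype

/-- The dual grading of `U`: an element of degree `d` is supported in degree `-d`. -/
def grU (d : ℤ) : Submodule K B.U where
  carrier := {f | ∀ i, i ≠ -d → ∀ v : B.Wneg, (v : V) ∈ B.gr i → (f : Module.Dual K B.Wneg) v = 0}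
  zero_mem' := fun _ _ _ _ => rfl
  add_mem' := by
    intro f g hf hg i hi v hv
    rw [Submodule.coe_add, LinearMap.add_apply, hf i hi v hv, hg i hi v hv, add_zero]
  smul_mem' := by
    intro a f hf i hi v hv
    rw [Submodule.coe_smul, LinearMap.smul_apply, hf i hi v hv, smul_zero]

/-- The homogeneous elements of the completion of `W⁻`: those of degree `d` are supported in
degree `-d` of `U`. -/
def grHat (d : ℤ) : Submodule K B.What where
  carrier := {ψ | ∀ i, i ≠ -d → ∀ u ∈ B.grU i, ψ u = 0}
  zero_mem' := fun _ _ _ _ => rfl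
  add_mem' := by
    intro f g hf hg i hi v hv
    rw [LinearMap.add_apply, hf i hi v hv, hg i hi v hv, add_zero]
  smul_mem' := by
    intro a f hf i hi v hv
    rw [LinearMap.smul_apply, hf i hi v hv, smul_zero]

theorem wpos_homog : IsHomogeneousSub B.gr B.Wpos :=
  iSup_le fun p => (B.Wp_homog p).trans
    (iSup_mono fun _ => inf_le_inf_right _ (le_iSup B.Wp p))

theorem grPos_internal : DirectSum.IsInternal B.grPos := by
  rw [DirectSum.isInternal_submodule_iff_iSupIndep_and_iSup_eq_top]
  have hmap : ∀ i, (B.grPos i).map B.Wpos.subtype = B.Wpos ⊓ B.gr i := fun i => by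
    rw [grPos, Submodule.map_comap_subtype]
  constructor
  · have h := (DirectSum.isInternal_submodule_iff_iSupIndep_and_iSup_eq_top B.gr).1 B.gr_internal
    intro i
    rw [Submodule.disjoint_def]
    intro x hx hx'
    have h1 := (Submodule.disjoint_def.1 (h.1 i)) (x : V) hx
    refine Subtype.ext (h1 ?_)
    have h2 := Submodule.mem_map_of_mem (f := B.Wpos.subtype) hx'
    simp only [Submodule.map_iSup] at h2
    have h3 : (⨆ j, ⨆ (_ : j ≠ i), (B.grPos j).map B.Wpos.subtype) ≤ ⨆ j, ⨆ (_ : j ≠ i), B.gr j :=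
      iSup_mono fun j => iSup_mono fun _ => by
        rw [hmap]
        exact inf_le_right
    exact h3 h2
  · apply Submodule.map_injective_of_injective B.Wpos.injective_subtype
    rw [Submodule.map_iSup, Submodule.map_top, Submodule.range_subtype]
    refine le_antisymm (iSup_le fun i => ?_) ?_
    · rw [hmap]
      exact inf_le_left
    · simp_rw [hmap]
      exact B.wpos_homog

/-! ### The endomorphism operad -/

/-- The space attached to an edge, read along the basic direction: `W⁺` if the extra direction
agrees with the basic one, and the completion of `W⁻` otherwise. -/
def X : Dir → Type u
  | .co => B.Wpos
  | .contra => B.What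

instance instAddCommGroupX : (c : Dir) → AddCommGroup (B.X c)
  | .co => inferInstanceAs (AddCommGroup B.Wpos)
  | .contra => inferInstanceAs (AddCommGroup B.What)

instance instModuleX : (c : Dir) → Module K (B.X c)
  | .co => inferInstanceAs (Module K B.Wpos)
  | .contra => inferInstanceAs (Module K B.What)

/-- The homogeneous elements of the space attached to an edge. -/
def deg : (c : Dir) → ℤ → Submodule K (B.X c)
  | .co, d => B.grPos d
  | .contra, d => B.grHat d

/-- The orderings of a finite set of labels. -/
def Enum (I : Type) : Type := {e : List I // e.Nodup ∧ ∀ i, i ∈ e}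

/-- Families of multilinear maps, one for each ordering of the inputs. -/
abbrev Family {I : Type} (s : I → Dir) (c : Dir) : Type u :=
  Enum I → MultilinearMap K (fun i => B.X (s i)) (B.X c)

/-- The members of the family are related by the Koszul sign rule, so that the family is one linear
map on the unordered tensor product of the graded spaces attached to the inputs. -/
def IsKoszul {I : Type} {s : I → Dir} {c : Dir} (G : B.Family s c) : Prop :=
  ∀ (e e' : Enum I) (l l' : List I) (i j : I), e.1 = l ++ i :: j :: l' → e'.1 = l ++ j :: i :: l' →
    ∀ (x : ∀ k, B.X (s k)) (a b : ℤ), x i ∈ B.deg (s i) a → x j ∈ B.deg (s j) b →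
      G e' x = Int.negOnePow (a * b) • G e x

/-- The maps of the family have degree `0`. -/
def IsDegreeZero {I : Type} {s : I → Dir} {c : Dir} (G : B.Family s c) : Prop :=
  ∀ (e : Enum I) (d : I → ℤ) (x : ∀ k, B.X (s k)), (∀ k, x k ∈ B.deg (s k) (d k)) →
    G e x ∈ B.deg c (e.1.map d).sum

/-- The family of elements that agrees with `x` on the inputs with extra direction `co` and with
`y` on the inputs with extra direction `contra`. -/
def merge : (c : Dir) → B.X c → B.X c → B.X c
  | .co, x, _ => x
  | .contra, _, y => y

/-- The factor of an input in the pairing of elements of the completion of `W⁻` (on the inputs with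
extra direction `contra`) with elements of `U`. -/
def pairFactor : (c : Dir) → B.X c → B.U → K
  | .co, _, _ => 1
  | .contra, (ψ : B.What), u => ψ u

/-- The pairing of the elements `y k` of the completion of `W⁻`, for the inputs `k` with extra
direction `contra`, with the elements `u k` of `U`. -/
def pairing {I : Type} (s : I → Dir) (e : Enum I) (u : I → B.U) (y : ∀ k, B.X (s k)) : K :=
  (e.1.map fun k => B.pairFactor (s k) (y k) (u k)).prod

/-- A multilinear map is the incarnation along the basic direction of a linear map along the extra
direction, where an edge with extra direction `co` stands for `W⁺`, one with extra direction
`contra` stands for `U`, and the inputs and outputs are read along the extra direction: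
`⨂ W⁺ → W⁺ ⊗ ⨂ U` if the output edge has extra direction `co`, and `U ⊗ ⨂ W⁺ → ⨂ U` if it has
extra direction `contra`.  The tensor products of copies of `U` embed into the multilinear forms on
the completion of `W⁻`, so it has to be said that for given inputs along the extra direction the
dependence on the elements of the completion is through the pairing with a tensor. -/
def IsExtra {I : Type} {s : I → Dir} (e : Enum I) :
    (c : Dir) → MultilinearMap K (fun i => B.X (s i)) (B.X c) → Prop
  | .co, G => ∀ x : ∀ k, B.X (s k),
      (fun y : ∀ k, B.X (s k) => (show B.Wpos from G fun k => B.merge (s k) (x k) (y k))) ∈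
        Submodule.span K {h | ∃ (u : I → B.U) (w : B.Wpos), h = fun y => B.pairing s e u y • w}
  | .contra, G => ∀ (x : ∀ k, B.X (s k)) (v : B.U),
      (fun y : ∀ k, B.X (s k) => (show B.What from G fun k => B.merge (s k) (x k) (y k)) v) ∈
        Submodule.span K {h | ∃ u : I → B.U, h = fun y => B.pairing s e u y}

/-- The component of the endomorphism operad of the space with brane with inputs labelled by `I`,
extra directions `s` on the inputs and `c` on the output. -/
def EndOp {I : Type} (s : I → Dir) (c : Dir) : Submodule K (B.Family s c) where
  carrier := {G | B.IsKoszul G ∧ B.IsDegreeZero G ∧ ∀ e, B.IsExtra e c (G e)}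
  zero_mem' := by
    refine ⟨fun e e' l l' i j _ _ x a b _ _ => ?_, fun e d x _ => ?_, fun e => ?_⟩
    · exact (smul_zero _).symm
    · exact Submodule.zero_mem _
    · cases c
      · exact fun x => Submodule.zero_mem _
      · exact fun x v => Submodule.zero_mem _
  add_mem' := by
    rintro G H ⟨hG1, hG2, hG3⟩ ⟨hH1, hH2, hH3⟩
    refine ⟨fun e e' l l' i j he he' x a b ha hb => ?_, fun e d x hx => ?_, fun e => ?_⟩
    · have h1 := hG1 e e' l l' i j he he' x a b ha hb
      have h2 := hH1 e e' l l' i j he he' x a b ha hb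
      change G e' x + H e' x = _ • (G e x + H e x)
      rw [h1, h2, smul_add]
    · exact Submodule.add_mem _ (hG2 e d x hx) (hH2 e d x hx)
    · have h1 := hG3 e
      have h2 := hH3 e
      cases c
      · exact fun x => Submodule.add_mem _ (h1 x) (h2 x)
      · exact fun x v => Submodule.add_mem _ (h1 x v) (h2 x v)
  smul_mem' := by
    rintro r G ⟨hG1, hG2, hG3⟩
    refine ⟨fun e e' l l' i j he he' x a b ha hb => ?_, fun e d x hx => ?_, fun e => ?_⟩
    · have h1 := hG1 e e' l l' i j he he' x a b ha hb
      change r • G e' x = _ • (r • G e x)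
      rw [h1, smul_comm]
    · exact Submodule.smul_mem _ _ (hG2 e d x hx)
    · have h1 := hG3 e
      cases c
      · exact fun x => Submodule.smul_mem _ r (h1 x)
      · exact fun x v => Submodule.smul_mem _ r (h1 x v)

/-- The inputs of the outer map in an operadic composition: `v` in the place of the grafted input
`none`, and the given elements elsewhere. -/
def plug {I J : Type} {s : Option I → Dir} {t : J → Dir}
    (z : ∀ k, B.X (Sum.elim (fun i => s (some i)) t k)) (v : B.X (s none)) : ∀ o, B.X (s o)
  | none => v
  | some i => z (Sum.inl i)

end BraneSpace

open BraneSpace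

/-- A representation of the 2-oriented operad with relations `R` in a vector space with one brane:
a morphism to the endomorphism operad.  The laws are evaluated in orderings of the inputs in which
no Koszul sign occurs. -/
structure Rep (K V : Type u) [Field K] [AddCommGroup V] [Module K V] (B : BraneSpace K V)
    (R : Relations K) where
  /-- the components of the morphism -/
  toEnd : ∀ {I : Type} (s : I → Dir) (c : Dir), Op K R s c →ₗ[K] B.EndOp s c
  map_unit : ∀ (c : Dir) (e : Enum Unit) (x : Unit → B.X c),
    (toEnd (fun _ => c) c (Op.mk K R (Fr.unit K c))).1 e x = x ()
  map_relabel : ∀ {I J : Type} (t : J → Dir) (c : Dir) (σ : I ≃ J) (x : Fr K (fun i => t (σ i)) c)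
    (e : Enum I) (e' : Enum J), e'.1 = e.1.map σ → ∀ y : ∀ j, B.X (t j),
      (toEnd t c (Op.mk K R (Fr.relabel K t c σ x))).1 e' y =
        (toEnd (fun i => t (σ i)) c (Op.mk K R x)).1 e fun i => y (σ i)
  map_graft : ∀ {I J : Type} (s : Option I → Dir) (t : J → Dir) (c : Dir) (x : Fr K s c)
    (y : Fr K t (s none)) (a b : List I) (e : Enum (Option I)) (e' : Enum J) (e'' : Enum (I ⊕ J)),
    e.1 = a.map some ++ none :: b.map some →
    e''.1 = a.map Sum.inl ++ e'.1.map Sum.inr ++ b.map Sum.inl →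
    ∀ z : ∀ k, B.X (Sum.elim (fun i => s (some i)) t k),
      (toEnd _ c (Op.mk K R (Fr.graft K s t c x y))).1 e'' z =
        (toEnd s c (Op.mk K R x)).1 e
          (B.plug z ((toEnd t (s none) (Op.mk K R y)).1 e' fun j => z (Sum.inr j)))

namespace Rep

variable {K V : Type u} [Field K] [AddCommGroup V] [Module K V] {B : BraneSpace K V}
  {R : Relations K} (ρ : Rep K V B R)

/-- The standard ordering of two inputs. -/
def ord : Enum (Fin 2) := ⟨[0, 1], by decide, by decide⟩

/-- The value of the representation on a generator. -/
def gen (g : Gen) : MultilinearMap K (fun i => B.X (two g.inL g.inR i)) (B.X g.out) :=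
  (ρ.toEnd (two g.inL g.inR) g.out (Op.mk K R (Fr.tree K (genTree g) (genTree_linear g)))).1 ord

/-- Two inputs. -/
def pair {a b : Dir} (x : B.X a) (y : B.X b) : ∀ i, B.X (two a b i)
  | 0 => x
  | 1 => y

/-- The value on `A`, a map `W⁺ ⊗ W⁺ → W⁺`. -/
def opA (x y : B.Wpos) : B.Wpos := ρ.gen .A (pair (a := .co) (b := .co) x y)

/-- The value on `B`, along the basic direction. -/
def opB (x y : B.What) : B.What := ρ.gen .B (pair (a := .contra) (b := .contra) x y)

/-- The value on `C`, along the basic direction. -/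
def opC (x : B.Wpos) (y : B.What) : B.Wpos := ρ.gen .C (pair (a := .co) (b := .contra) x y)

/-- The value on `D`, along the basic direction. -/
def opD (x : B.Wpos) (y : B.What) : B.What := ρ.gen .D (pair (a := .co) (b := .contra) x y)

end Rep

/-! ### Lagrangian branes -/

/-- A graded symplectic vector space with one Lagrangian brane. -/
structure LagrangianBraneSpace (K V : Type u) [Field K] [AddCommGroup V] [Module K V] extends
    BraneSpace K V where
  /-- the symplectic form -/
  ω : V →ₗ[K] V →ₗ[K] K
  ω_degree : ∀ i j : ℤ, i + j ≠ 0 → ∀ x ∈ gr i, ∀ y ∈ gr j, ω x y = 0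
  ω_skew : ∀ i j : ℤ, ∀ x ∈ gr i, ∀ y ∈ gr j, ω x y = -(Int.negOnePow (i * j) • ω y x)
  ω_nondeg : ∀ p, ∀ x ∈ Vp p, (∀ y ∈ Vp p, ω x y = 0) → x = 0
  ω_Wp : ∀ p, ∀ x ∈ Wp p, ∀ y ∈ Wp p, ω x y = 0
  ω_Wm : ∀ p, ∀ x ∈ Wm p, ∀ y ∈ Wm p, ω x y = 0
  finrank_Wp : ∀ p, 2 * Module.finrank K (Wp p) = Module.finrank K (Vp p)
  finrank_Wm : ∀ p, 2 * Module.finrank K (Wm p) = Module.finrank K (Vp p)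
  ω_proj : ∀ p, ∀ x ∈ Wp p, ∀ y ∈ F p, y ∈ ⨆ q, Wm q → ω x y = 0

namespace LagrangianBraneSpace

variable {K V : Type u} [Field K] [AddCommGroup V] [Module K V] (L : LagrangianBraneSpace K V)

/-- The map `W⁺ → U` induced by the symplectic form (it is an isomorphism). -/
def flat : L.Wpos →ₗ[K] L.U :=
  LinearMap.codRestrict L.U
    ((LinearMap.lcomp K K L.Wneg.subtype).comp (L.ω.comp L.Wpos.subtype)) (by
      rintro ⟨w, hw⟩
      obtain ⟨p, hp⟩ := (Submodule.mem_iSup_of_directed _ L.Wp_mono.directed_le).1 hw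
      exact ⟨p, fun v hv => L.ω_proj p w hp v hv v.2⟩)

end LagrangianBraneSpace

/-- The representation is reduced: after the identification of `U` with `W⁺`, generating corollas
that become the same planar graph once the basic direction of the edges is forgotten have the same
value.  These are `A` and `D` (two inputs and one output along the extra direction), and `B` and `C`
(one input and two outputs along the extra direction); the legs correspond to each other in their
cyclic order. -/
def Rep.IsReduced {K V : Type u} [Field K] [AddCommGroup V] [Module K V]
    {L : LagrangianBraneSpace K V} {R : Relations K} (ρ : Rep K V L.toBraneSpace R) : Prop :=
  (∀ (x y : L.Wpos) (ψ : L.What), ρ.opD y ψ (L.flat x) = ψ (L.flat (ρ.opA x y))) ∧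
  (∀ (x : L.Wpos) (ψ χ : L.What), ρ.opB ψ χ (L.flat x) = χ (L.flat (ρ.opC x ψ)))

/-! ### Infinitesimal bialgebras and Lie bialgebras -/

section Bialgebras

variable {K W : Type u} [Field K] [AddCommGroup W] [Module K W]

/-- The degree `d` part of `W ⊗ W`. -/
def grTensor (gr : ℤ → Submodule K W) (d : ℤ) : Submodule K (W ⊗[K] W) :=
  ⨆ i, Submodule.map₂ (TensorProduct.mk K W W) (gr i) (gr (d - i))

/-- A graded vector space as the external direct sum of its homogeneous parts. -/
def decompEquiv {gr : ℤ → Submodule K W} (h : DirectSum.IsInternal gr) : (⨁ i, gr i) ≃ₗ[K] W :=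
  LinearEquiv.ofBijective (DirectSum.coeLinearMap gr)
    (show Function.Bijective (DirectSum.coeLinearMap gr) from h)

/-- The Koszul flip `x ⊗ y ↦ (-1)^{ij} y ⊗ x` (for `x` of degree `i` and `y` of degree `j`). -/
def koszulSwap {gr : ℤ → Submodule K W} (h : DirectSum.IsInternal gr) :
    W ⊗[K] W ≃ₗ[K] W ⊗[K] W :=
  (TensorProduct.congr (decompEquiv h) (decompEquiv h)).symm ≪≫ₗ
    TensorProduct.gradedComm K (fun i => gr i) (fun i => gr i) ≪≫ₗ
    TensorProduct.congr (decompEquiv h) (decompEquiv h)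

theorem koszulSwap_tmul {gr : ℤ → Submodule K W} (h : DirectSum.IsInternal gr) {i j : ℤ}
    {x y : W} (hx : x ∈ gr i) (hy : y ∈ gr j) :
    koszulSwap h (x ⊗ₜ y) = Int.negOnePow (i * j) • (y ⊗ₜ[K] x) := by
  have e : ∀ (k : ℤ) (z : W) (hz : z ∈ gr k),
      decompEquiv h (DirectSum.lof K ℤ (fun i => gr i) k ⟨z, hz⟩) = z := fun k z hz =>
    DirectSum.coeLinearMap_lof gr k ⟨z, hz⟩
  have e' : ∀ (k : ℤ) (z : W) (hz : z ∈ gr k),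
      (decompEquiv h).symm z = DirectSum.lof K ℤ (fun i => gr i) k ⟨z, hz⟩ := fun k z hz => by
    rw [LinearEquiv.symm_apply_eq, e]
  rw [koszulSwap, LinearEquiv.trans_apply, LinearEquiv.trans_apply, TensorProduct.congr_symm_tmul,
    e' i x hx, e' j y hy, TensorProduct.gradedComm_of_tmul_of, Units.smul_def,
    map_zsmul, TensorProduct.congr_tmul, e, e, ← Units.smul_def, mul_comm]
  rfl

/-- The Koszul cyclic permutation `x ⊗ y ⊗ z ↦ ± z ⊗ x ⊗ y`. -/
def koszulCyc {gr : ℤ → Submodule K W} (h : DirectSum.IsInternal gr) :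
    (W ⊗[K] W) ⊗[K] W →ₗ[K] (W ⊗[K] W) ⊗[K] W :=
  (koszulSwap h).toLinearMap.rTensor W ∘ₗ (TensorProduct.assoc K W W W).symm.toLinearMap ∘ₗ
    (koszulSwap h).toLinearMap.lTensor W ∘ₗ (TensorProduct.assoc K W W W).toLinearMap

/-- Infinitesimal bialgebra structures on a graded vector space: an associative product and a
coassociative coproduct that is a derivation with values in the bimodule `W ⊗ W`. -/
structure InfBialgebra (gr : ℤ → Submodule K W) where
  /-- the product -/
  mul : W →ₗ[K] W →ₗ[K] W
  /-- the coproduct -/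
  comul : W →ₗ[K] W ⊗[K] W
  mul_degree : ∀ i j, ∀ x ∈ gr i, ∀ y ∈ gr j, mul x y ∈ gr (i + j)
  comul_degree : ∀ i, ∀ x ∈ gr i, comul x ∈ grTensor gr i
  mul_assoc : ∀ x y z, mul (mul x y) z = mul x (mul y z)
  comul_coassoc : ∀ x,
    TensorProduct.assoc K W W W (comul.rTensor W (comul x)) = comul.lTensor W (comul x)
  comul_mul : ∀ x y,
    comul (mul x y) = (mul x).rTensor W (comul y) + (mul.flip y).lTensor W (comul x)

/-- The terms `[x, y'] ⊗ y'' + x' ⊗ [x'', y]` of the cocycle condition, where `y' ⊗ y''` and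
`x' ⊗ x''` are the cobrackets of `y` and `x`. -/
def cocycleTerm (br : W →ₗ[K] W →ₗ[K] W) (co : W →ₗ[K] W ⊗[K] W) (x y : W) : W ⊗[K] W :=
  (br x).rTensor W (co y) + (br.flip y).lTensor W (co x)

/-- Lie bialgebra structures on a graded vector space. -/
structure LieBialgebra {gr : ℤ → Submodule K W} (h : DirectSum.IsInternal gr) where
  /-- the bracket -/
  bracket : W →ₗ[K] W →ₗ[K] W
  /-- the cobracket -/
  cobracket : W →ₗ[K] W ⊗[K] W
  bracket_degree : ∀ i j, ∀ x ∈ gr i, ∀ y ∈ gr j, bracket x y ∈ gr (i + j)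
  cobracket_degree : ∀ i, ∀ x ∈ gr i, cobracket x ∈ grTensor gr i
  bracket_skew : ∀ i j, ∀ x ∈ gr i, ∀ y ∈ gr j,
    bracket x y = -(Int.negOnePow (i * j) • bracket y x)
  jacobi : ∀ i j, ∀ x ∈ gr i, ∀ y ∈ gr j, ∀ z,
    bracket x (bracket y z) =
      bracket (bracket x y) z + Int.negOnePow (i * j) • bracket y (bracket x z)
  cobracket_skew : ∀ x, koszulSwap h (cobracket x) = -cobracket x
  cojacobi : ∀ x, cobracket.rTensor W (cobracket x) +
    koszulCyc h (cobracket.rTensor W (cobracket x)) +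
    koszulCyc h (koszulCyc h (cobracket.rTensor W (cobracket x))) = 0
  cocycle : ∀ i j, ∀ x ∈ gr i, ∀ y ∈ gr j,
    cobracket (bracket x y) =
      cocycleTerm bracket cobracket x y - Int.negOnePow (i * j) • cocycleTerm bracket cobracket y x

end Bialgebras

/-! ### The correspondence -/

section Correspondence

variable {K V : Type u} [Field K] [AddCommGroup V] [Module K V] {L : LagrangianBraneSpace K V}
  {R : Relations K}

/-- The product `mul` and the coproduct `comul` on `W⁺` are the values of the representation on the
generators `A` and `C`, where `C` is read along the extra direction as a map `W⁺ → W⁺ ⊗ U`, and `U`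
is identified with `W⁺` by the symplectic form. -/
def Rep.Induces (ρ : Rep K V L.toBraneSpace R) (mul : L.Wpos →ₗ[K] L.Wpos →ₗ[K] L.Wpos)
    (comul : L.Wpos →ₗ[K] L.Wpos ⊗[K] L.Wpos) : Prop :=
  (∀ x y, mul x y = ρ.opA x y) ∧
  (∀ (x : L.Wpos) (ψ : L.What),
    TensorProduct.rid K L.Wpos ((ψ ∘ₗ L.flat).lTensor L.Wpos (comul x)) = ρ.opC x ψ)

end Correspondence

end TwoOriented

end

open TwoOriented

noncomputable section

namespace TwoOriented

open BraneSpace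

/-! ### Koszul signs -/

section Signs

variable (K : Type u) [Field K]

/-! The symplectic form identifies `W⁺` with `U`: injectivity of `flat` is non-degeneracy on each
`V_p` combined with isotropy of `W_p⁺`, and surjectivity is a dimension count at a finite level
(`flat_injective`, `flat_surjective`). Dually, the completion of `W⁻` becomes the full dual of `W⁺`
(`dualE`). Every value on a generator then turns into linear algebra on `W⁺` alone. Being reduced
says exactly that `D` is the transpose of the product `A` and `B` is the transpose of `C`. Moreover
`C`, which depends on its functional through a tensor, is contraction with a genuine coproduct `W⁺ →
W⁺ ⊗ W⁺` (`Rep.exists_comul`).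

It remains to see that a product and a coproduct of degree `0` are the same as a reduced morphism
from the free operad. A morphism is determined by the four generators because every tree arises from
corollas by grafting and relabelling (`FreeMor.eq_of_gen`). Conversely, evaluating trees gives a
morphism `FreeMor.ofOps`: a tree evaluated in the order of its leaves carries no sign, and any other
ordering of the inputs contributes the Koszul sign counted by `inv`. Compatibility with composition
is the multiplicativity of that sign, `inv_graft`.

One point of care is that an element of the completion may have infinitely many homogeneous
components. It still splits into an even and an odd part, which is all that signs need
(`sum_ppart`). An operation of the endomorphism operad is nevertheless determined by homogeneous
inputs, since each value involves only finitely many functionals from `U`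
(`eq_zero_of_homogeneous`).

Finally the relations are read off. The associative relations `aaa`, `aab`, `abb` say that the
product is associative, that the coproduct is a derivation and that it is coassociative; `ddd`,
`dbb`, `bbb` are their transposes and follow. In the Lie case `skewA`, `skewB`, `aaa`, `aab`, `abb`
are the five axioms of a Lie bialgebra, and the other three relations follow by transposing and
using both skew symmetries; the signs are checked on homogeneous elements. -/

/-- The sign `(-1)^a` for a parity `a`. -/
def ksgn (a : ZMod 2) : K := if a = 0 then 1 else -1

@[simp] theorem ksgn_zero : ksgn K 0 = 1 := if_pos rfl

@[simp] theorem ksgn_one : ksgn K 1 = -1 := if_neg (by decide)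

theorem ksgn_add (a b : ZMod 2) : ksgn K (a + b) = ksgn K a * ksgn K b := by
  have h : ∀ a : ZMod 2, a = 0 ∨ a = 1 := by decide
  have h2 : (1 + 1 : ZMod 2) = 0 := by decide
  rcases h a with rfl | rfl <;> rcases h b with rfl | rfl <;> simp [h2]

theorem ksgn_mul_self (a : ZMod 2) : ksgn K a * ksgn K a = 1 := by
  rw [← ksgn_add, CharTwo.add_self_eq_zero, ksgn_zero]

/-- Signs only depend on parities; with exponents in `ZMod 2`, comparing two signs becomes a finite
check. -/
theorem negOnePow_smul {M : Type*} [AddCommGroup M] [Module K M] (n : ℤ) (v : M) :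
    Int.negOnePow n • v = ksgn K (n : ZMod 2) • v := by
  rcases Int.even_or_odd n with hn | hn
  · rw [Int.negOnePow_even n hn, one_smul, (ZMod.intCast_zmod_eq_zero_iff_dvd n 2).2
      (by exact_mod_cast hn.two_dvd), ksgn_zero, one_smul]
  · have : (n : ZMod 2) = 1 := by
      obtain ⟨k, rfl⟩ := hn
      have h2 : (2 : ZMod 2) = 0 := by decide
      push_cast
      rw [h2, zero_mul, zero_add]
    rw [Int.negOnePow_odd n hn, this, ksgn_one, neg_smul, one_smul, Units.smul_def]
    simp

end Signs

/-! ### Inversions between two orderings -/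

section Orderings

variable {I J : Type}

/-- `i` occurs before `j` in the list. -/
def Before : List I → I → I → Prop
  | [], _, _ => False
  | k :: l, i, j => (i = k ∧ j ∈ l) ∨ Before l i j

theorem Before.mem {l : List I} {i j : I} (h : Before l i j) : i ∈ l ∧ j ∈ l := by
  induction l with
  | nil => exact h.elim
  | cons k l ih =>
    rcases h with ⟨rfl, h⟩ | h
    · simp [h]
    · simp [ih h]

theorem before_append (l l' : List I) (i j : I) :
    Before (l ++ l') i j ↔ Before l i j ∨ (i ∈ l ∧ j ∈ l') ∨ Before l' i j := by
  induction l with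
  | nil => simp [Before]
  | cons k l ih =>
    simp only [List.cons_append, Before, ih, List.mem_append, List.mem_cons]
    tauto

theorem before_map {f : I → J} (hf : Function.Injective f) (l : List I) (i j : I) :
    Before (l.map f) (f i) (f j) ↔ Before l i j := by
  induction l with
  | nil => simp [Before]
  | cons k l ih => simp [Before, ih, hf.eq_iff]

theorem Before.asymm {l : List I} (hl : l.Nodup) {i j : I} (h : Before l i j) :
    ¬ Before l j i := by
  induction l with
  | nil => exact h.elim
  | cons k l ih =>
    rw [List.nodup_cons] at hl
    rintro (⟨rfl, h'⟩ | h')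
    · rcases h with ⟨rfl, h⟩ | h
      · exact hl.1 h
      · exact hl.1 h.mem.2
    · rcases h with ⟨rfl, h⟩ | h
      · exact hl.1 h'.mem.2
      · exact ih hl.2 h h'

theorem before_or {l : List I} {i j : I} (hi : i ∈ l) (hj : j ∈ l) (hij : i ≠ j) :
    Before l i j ∨ Before l j i := by
  induction l with
  | nil => simp at hi
  | cons k l ih =>
    simp only [Before]
    simp only [List.mem_cons] at hi hj
    rcases hi with rfl | hi <;> rcases hj with rfl | hj
    · exact absurd rfl hij
    · simp [hj]
    · simp [hi]
    · rcases ih hi hj with h | h <;> simp [h]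

open scoped Classical in
/-- The exponent of the Koszul sign that compares the orderings `e` and `l` of elements with the
parities `p`. -/
def inv (e l : List I) (p : I → ZMod 2) : ZMod 2 :=
  -- `finsum` spares a `Fintype I` argument; an ordering of `I` makes `I` finite anyway.
  ∑ᶠ i, ∑ᶠ j, if Before e i j ∧ Before l j i then p i * p j else 0

open scoped Classical in
theorem inv_eq_sum [Fintype I] (e l : List I) (p : I → ZMod 2) :
    inv e l p = ∑ i, ∑ j, if Before e i j ∧ Before l j i then p i * p j else 0 := by
  simp only [inv, finsum_eq_sum_of_fintype]

theorem inv_self {l : List I} (hl : l.Nodup) (p : I → ZMod 2) : inv l l p = 0 := by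
  rw [inv]
  simp only [if_neg fun h : Before l _ _ ∧ Before l _ _ => h.1.asymm hl h.2, finsum_zero]

theorem inv_map (σ : I ≃ J) (e l : List I) (p : J → ZMod 2) :
    inv (e.map σ) (l.map σ) p = inv e l (fun i => p (σ i)) := by
  refine (finsum_comp_equiv σ).symm.trans (finsum_congr fun i => ?_)
  refine (finsum_comp_equiv σ).symm.trans (finsum_congr fun j => ?_)
  rw [before_map σ.injective, before_map σ.injective]

/-- Exchanging neighbours changes the relative position of this one pair only. Its contribution is
switched on or off, and modulo 2 both amount to adding it. -/
theorem inv_swap [Finite I] {l l' m : List I} {i j : I} (he : (l ++ i :: j :: l').Nodup)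
    (hm : m.Nodup) (hi : i ∈ m) (hj : j ∈ m) (p : I → ZMod 2) :
    inv (l ++ j :: i :: l') m p = p i * p j + inv (l ++ i :: j :: l') m p := by
  classical
  cases nonempty_fintype I
  have hij : i ≠ j := by
    rintro rfl
    simp [List.nodup_append] at he
  -- The correction terms sit at `(i, j)` and at `(j, i)`: the first cancels an inversion that
  -- disappears, the second adds one that appears.
  have key : ∀ a b, (if Before (l ++ j :: i :: l') a b ∧ Before m b a then p a * p b else 0) =
      (if Before (l ++ i :: j :: l') a b ∧ Before m b a then p a * p b else 0) +
      ((if a = i then (if b = j then (if Before m j i then p i * p j else 0) else 0) else 0) +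
       (if a = j then (if b = i then (if Before m i j then p i * p j else 0) else 0) else 0)) := by
    intro a b
    have h1 : Before (l ++ i :: j :: l') i j := by simp [before_append, Before]
    have h2 : Before (l ++ j :: i :: l') j i := by simp [before_append, Before]
    have he' : (l ++ j :: i :: l').Nodup :=
      (List.Perm.append_left l (List.Perm.swap j i l')).nodup_iff.1 he
    by_cases hab : a = i ∧ b = j
    · obtain ⟨rfl, rfl⟩ := hab
      simp [h1, h2.asymm he', hij, CharTwo.add_self_eq_zero]
    by_cases hab' : a = j ∧ b = i
    · obtain ⟨rfl, rfl⟩ := hab'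
      simp [h2, h1.asymm he, hij.symm, mul_comm]
    have h3 : Before (l ++ j :: i :: l') a b ↔ Before (l ++ i :: j :: l') a b := by
      simp only [before_append, Before, List.mem_cons]
      tauto
    rw [h3]
    have h4 : (if a = i then (if b = j then (if Before m j i then p i * p j else 0) else 0)
      else 0) = 0 := by
      split_ifs <;> simp_all
    have h5 : (if a = j then (if b = i then (if Before m i j then p i * p j else 0) else 0)
      else 0) = 0 := by
      split_ifs <;> simp_all
    rw [h4, h5, add_zero, add_zero]
  rw [inv_eq_sum, inv_eq_sum]
  simp only [key, Finset.sum_add_distrib, add_comm (p i * p j)]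
  congr 1
  have e1 : ∀ a : I, (∑ b : I, if a = i then (if b = j then (if Before m j i then p i * p j else 0)
      else 0) else 0) = if a = i then (if Before m j i then p i * p j else 0) else 0 := by
    intro a
    split_ifs <;> simp
  have e2 : ∀ a : I, (∑ b : I, if a = j then (if b = i then (if Before m i j then p i * p j else 0)
      else 0) else 0) = if a = j then (if Before m i j then p i * p j else 0) else 0 := by
    intro a
    split_ifs <;> simp
  simp only [e1, e2, Finset.sum_ite_eq', Finset.mem_univ, if_true]
  -- The order in `m` decides which one of the two corrections is present.
  rcases before_or hi hj hij with h | h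
  · simp [h, h.asymm hm]
  · simp [h, h.asymm hm]

/-- The inserted labels form a block in both orderings. Two outer labels compare as before, two
inner ones as in the inner orderings, and an outer label compares with the whole block as it does
with `none`. Summing over the block gives the total parity assigned to `none`. -/
theorem inv_graft [Fintype I] [Fintype J] (a b a' b' : List I) (e l : List J)
    (he : ∀ j, j ∈ e) (hl : ∀ j, j ∈ l) (p : I ⊕ J → ZMod 2) (q : Option I → ZMod 2)
    (hq : ∀ i, q (some i) = p (Sum.inl i)) (hq' : q none = ∑ j, p (Sum.inr j)) :
    inv (a.map Sum.inl ++ e.map Sum.inr ++ b.map Sum.inl)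
        (a'.map Sum.inl ++ l.map Sum.inr ++ b'.map Sum.inl) p =
      inv (a.map some ++ none :: b.map some) (a'.map some ++ none :: b'.map some) q +
        inv e l (fun j => p (Sum.inr j)) := by
  classical
  have key : ∀ (a b : List I) (e : List J), (∀ j, j ∈ e) →
      (∀ i i' : I, Before (a.map Sum.inl ++ e.map Sum.inr ++ b.map Sum.inl) (Sum.inl i)
        (Sum.inl i' : I ⊕ J) ↔ Before (a.map some ++ none :: b.map some) (some i) (some i')) ∧
      (∀ (i : I) (j : J), Before (a.map Sum.inl ++ e.map Sum.inr ++ b.map Sum.inl) (Sum.inl i)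
        (Sum.inr j) ↔ Before (a.map some ++ none :: b.map some) (some i) none) ∧
      (∀ (i : I) (j : J), Before (a.map Sum.inl ++ e.map Sum.inr ++ b.map Sum.inl) (Sum.inr j)
        (Sum.inl i) ↔ Before (a.map some ++ none :: b.map some) none (some i)) ∧
      (∀ j j' : J, Before (a.map Sum.inl ++ e.map Sum.inr ++ b.map Sum.inl) (Sum.inr j)
        (Sum.inr j' : I ⊕ J) ↔ Before e j j') := by
    intro a b e he
    have n1 : ∀ (l : List I) (i : I) (j : J), ¬ Before (l.map Sum.inl) (Sum.inl i) (Sum.inr j) :=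
      fun l i j h => by simpa using h.mem.2
    have n2 : ∀ (l : List I) (i : I ⊕ J) (j : J), ¬ Before (l.map Sum.inl) (Sum.inr j) i :=
      fun l i j h => by simpa using h.mem.1
    have n3 : ∀ (l : List J) (i : I) (j : I ⊕ J), ¬ Before (l.map Sum.inr) (Sum.inl i) j :=
      fun l i j h => by simpa using h.mem.1
    have n4 : ∀ (l : List J) (i : I) (j : J), ¬ Before (l.map Sum.inr) (Sum.inr j) (Sum.inl i) :=
      fun l i j h => by simpa using h.mem.2
    have n5 : ∀ (l : List I) (o : Option I), ¬ Before (l.map some) none o :=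
      fun l o h => by simpa using h.mem.1
    have n6 : ∀ (l : List I) (o : Option I), ¬ Before (l.map some) o none :=
      fun l o h => by simpa using h.mem.2
    refine ⟨fun i i' => ?_, fun i j => ?_, fun i j => ?_, fun j j' => ?_⟩ <;>
      simp [before_append, Before, before_map Sum.inl_injective, before_map Sum.inr_injective,
        before_map (Option.some_injective I), n1, n2, n3, n4, n5, n6, he]
  obtain ⟨h1, h2, h3, h4⟩ := key a b e he
  obtain ⟨h1', h2', h3', h4'⟩ := key a' b' l hl
  have hnn : ∀ a b : List I, ¬ Before (a.map some ++ none :: b.map some) none none := by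
    intro a b
    have n5 : ∀ (l : List I) (o : Option I), ¬ Before (l.map some) none o :=
      fun l o h => by simpa using h.mem.1
    simp [before_append, Before, n5]
  rw [inv_eq_sum, inv_eq_sum, inv_eq_sum]
  simp only [Fintype.sum_sum_type, Fintype.sum_option, h1, h2, h3, h4, h1', h2', h3', h4', hnn, hq,
    hq', Finset.sum_add_distrib, false_and, if_false, zero_add, Finset.mul_sum, Finset.sum_mul]
  have e1 : ∀ (c : I → Prop) [DecidablePred c], (∑ j : J, ∑ i : I,
      if c i then p (Sum.inr j) * p (Sum.inl i) else 0) =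
      ∑ i : I, if c i then ∑ j : J, p (Sum.inr j) * p (Sum.inl i) else 0 := by
    intro c _
    rw [Finset.sum_comm]
    refine Finset.sum_congr rfl fun i _ => ?_
    split_ifs <;> simp
  have e2 : ∀ (c : I → Prop) [DecidablePred c], (∑ i : I, ∑ j : J,
      if c i then p (Sum.inl i) * p (Sum.inr j) else 0) =
      ∑ i : I, if c i then ∑ j : J, p (Sum.inl i) * p (Sum.inr j) else 0 := by
    intro c _
    refine Finset.sum_congr rfl fun i _ => ?_
    split_ifs <;> simp
  rw [e1, e2]
  abel

/-- A property that is stable under transpositions of neighbours is stable under permutations. -/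
theorem perm_induction {P : List I → Prop}
    (h : ∀ l i j l', P (l ++ i :: j :: l') → P (l ++ j :: i :: l')) {e e' : List I}
    (hp : e.Perm e') (he : P e) : P e' := by
  -- The prefix absorbs the common head in the `cons` case, so that transpositions deeper in the
  -- list are covered.
  suffices ∀ pre, P (pre ++ e) → P (pre ++ e') from this [] he
  clear he
  induction hp with
  | nil => exact fun _ h => h
  | cons x _ ih => exact fun pre hx => by simpa using ih (pre ++ [x]) (by simpa using hx)
  | swap x y l => exact fun pre hx => h _ _ _ _ hx
  | trans _ _ ih1 ih2 => exact fun pre hx => ih2 pre (ih1 pre hx)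

theorem enum_perm (e e' : Enum I) : e.1.Perm e'.1 :=
  (List.perm_ext_iff_of_nodup e.2.1 e'.2.1).2 fun i => by simp [e.2.2, e'.2.2]

theorem enum_finite (e : Enum I) : Finite I :=
  Set.finite_univ_iff.1 ((List.finite_toSet e.1).subset fun i _ => e.2.2 i)

end Orderings

/-! ### Truncations of graded vector spaces -/

section Graded

variable {K W : Type u} [Field K] [AddCommGroup W] [Module K W] {gr : ℤ → Submodule K W}

/-- Used throughout to test maps on homogeneous vectors, the only ones for which the signs are
defined. -/
theorem gr_linearMap_ext (h : DirectSum.IsInternal gr) {M : Type*} [AddCommGroup M] [Module K M]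
    {f g : W →ₗ[K] M} (hfg : ∀ i, ∀ w ∈ gr i, f w = g w) : f = g := by
  have htop := h.submodule_iSup_eq_top
  have : (⊤ : Submodule K W) ≤ LinearMap.eqLocus f g := by
    rw [← htop]
    exact iSup_le fun i w hw => hfg i w hw
  exact LinearMap.ext fun w => this Submodule.mem_top

open scoped Classical in
/-- The projection to the sum of the homogeneous parts whose degree satisfies `P`. -/
def gproj (h : DirectSum.IsInternal gr) (P : ℤ → Prop) : W →ₗ[K] W :=
  DirectSum.toModule K ℤ W (fun i => if P i then (gr i).subtype else 0) ∘ₗ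
    (decompEquiv h).symm.toLinearMap

theorem decompEquiv_symm_of_mem (h : DirectSum.IsInternal gr) {i : ℤ} {w : W} (hw : w ∈ gr i) :
    (decompEquiv h).symm w = DirectSum.lof K ℤ (fun i => gr i) i ⟨w, hw⟩ := by
  rw [LinearEquiv.symm_apply_eq]
  exact (DirectSum.coeLinearMap_lof gr i ⟨w, hw⟩).symm

theorem gproj_of_pos (h : DirectSum.IsInternal gr) {P : ℤ → Prop} {i : ℤ} (hi : P i) {w : W}
    (hw : w ∈ gr i) : gproj h P w = w := by
  rw [gproj, LinearMap.comp_apply, LinearEquiv.coe_coe, decompEquiv_symm_of_mem h hw,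
    DirectSum.toModule_lof, if_pos hi]
  rfl

theorem gproj_of_neg (h : DirectSum.IsInternal gr) {P : ℤ → Prop} {i : ℤ} (hi : ¬ P i) {w : W}
    (hw : w ∈ gr i) : gproj h P w = 0 := by
  rw [gproj, LinearMap.comp_apply, LinearEquiv.coe_coe, decompEquiv_symm_of_mem h hw,
    DirectSum.toModule_lof, if_neg hi]
  rfl

theorem gproj_mem (h : DirectSum.IsInternal gr) (P : ℤ → Prop) (S : Submodule K W)
    (hS : ∀ i, P i → gr i ≤ S) (w : W) : gproj h P w ∈ S := by
  have : (⊤ : Submodule K W) ≤ S.comap (gproj h P) := by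
    rw [← h.submodule_iSup_eq_top]
    refine iSup_le fun i w hw => ?_
    by_cases hi : P i
    · rw [Submodule.mem_comap, gproj_of_pos h hi hw]
      exact hS i hi hw
    · rw [Submodule.mem_comap, gproj_of_neg h hi hw]
      exact zero_mem _
  exact this Submodule.mem_top

theorem gproj_finset (h : DirectSum.IsInternal gr) (D : Finset ℤ) :
    gproj h (· ∈ D) = ∑ d ∈ D, gproj h (· = d) := by
  refine gr_linearMap_ext h fun i w hw => ?_
  rw [LinearMap.sum_apply]
  by_cases hi : i ∈ D
  · rw [gproj_of_pos h (P := (· ∈ D)) hi hw, Finset.sum_eq_single i,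
      gproj_of_pos h (P := (· = i)) rfl hw]
    · exact fun d _ hd => gproj_of_neg h (P := (· = d)) hd.symm hw
    · exact fun hi' => absurd hi hi'
  · rw [gproj_of_neg h (P := (· ∈ D)) hi hw, Finset.sum_eq_zero]
    exact fun d hd => gproj_of_neg h (P := (· = d)) (by rintro rfl; exact hi hd) hw

/-- A vector has finitely many homogeneous components. All larger sets are allowed so that the sets
found for several vectors can be united. -/
theorem exists_gproj_eq (h : DirectSum.IsInternal gr) (w : W) :
    ∃ D : Finset ℤ, ∀ D' : Finset ℤ, D ⊆ D' → gproj h (· ∈ D') w = w := by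
  classical
  have hw : w ∈ ⨆ i, gr i := by
    rw [h.submodule_iSup_eq_top]
    exact Submodule.mem_top
  induction hw using Submodule.iSup_induction' with
  | mem i x hx =>
    exact ⟨{i}, fun D' hD => gproj_of_pos h (P := (· ∈ D')) (hD (Finset.mem_singleton_self i)) hx⟩
  | zero => exact ⟨∅, fun D' _ => map_zero _⟩
  | add x y _ _ hx hy =>
    obtain ⟨D, hD⟩ := hx
    obtain ⟨E, hE⟩ := hy
    exact ⟨D ∪ E, fun D' h' => by
      rw [map_add, hD D' (Finset.union_subset_left h'), hE D' (Finset.union_subset_right h')]⟩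

end Graded

/-! ### Contraction of tensors with functionals -/

section Contraction

variable {K M N : Type*} [Field K] [AddCommGroup M] [Module K M] [AddCommGroup N] [Module K N]

/-- Contraction of the second tensor factor with a functional. -/
def contr : Module.Dual K N →ₗ[K] M ⊗[K] N →ₗ[K] M :=
  LinearMap.mk₂ K (fun α t => TensorProduct.rid K M (α.lTensor M t))
    (fun α β t => by rw [LinearMap.lTensor_add, LinearMap.add_apply, map_add])
    (fun r α t => by rw [LinearMap.lTensor_smul, LinearMap.smul_apply, map_smul])
    (fun α s t => by rw [map_add, map_add]) (fun r α t => by rw [map_smul, map_smul])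

theorem contr_apply (α : Module.Dual K N) (t : M ⊗[K] N) :
    contr α t = TensorProduct.rid K M (α.lTensor M t) := rfl

@[simp] theorem contr_tmul (α : Module.Dual K N) (x : M) (y : N) :
    contr α (x ⊗ₜ[K] y) = α y • x := by
  rw [contr_apply, LinearMap.lTensor_tmul, TensorProduct.rid_tmul]

theorem contr_rTensor {M' : Type*} [AddCommGroup M'] [Module K M'] (α : Module.Dual K N)
    (f : M →ₗ[K] M') (t : M ⊗[K] N) : contr α (f.rTensor N t) = f (contr α t) := by
  induction t with
  | zero => simp only [map_zero]
  | tmul x y => simp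
  | add s t hs ht => simp only [map_add, hs, ht]

theorem contr_lTensor {N' : Type*} [AddCommGroup N'] [Module K N'] (α : Module.Dual K N')
    (f : N →ₗ[K] N') (t : M ⊗[K] N) : contr α (f.lTensor M t) = contr (α ∘ₗ f) t := by
  induction t with
  | zero => simp only [map_zero]
  | tmul x y => simp
  | add s t hs ht => simp only [map_add, hs, ht]

/-- In a basis of `N`, the coefficients in `M` of a tensor are its contractions with the coordinate
functionals. -/
theorem eq_zero_of_contr {t : M ⊗[K] N} (h : ∀ α : Module.Dual K N, contr α t = 0) : t = 0 := by
  classical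
  let b := Module.Basis.ofVectorSpace K N
  have key : ∀ t : M ⊗[K] N, ∀ i, TensorProduct.equivFinsuppOfBasisRight b t i =
      contr (b.coord i) t := by
    intro t i
    induction t with
    | zero => simp only [map_zero, Finsupp.coe_zero, Pi.zero_apply]
    | tmul x y => simp
    | add s t hs ht => simp only [map_add, Finsupp.add_apply, hs, ht]
  apply (TensorProduct.equivFinsuppOfBasisRight (M := M) b).injective
  ext i
  rw [key, h, map_zero, Finsupp.zero_apply]

/-- With `f` a coproduct, the functional on the right is a product of functionals; this is how the
generator `B` enters contractions. -/
theorem contr_contr_assoc_symm {P : Type*} [AddCommGroup P] [Module K P]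
    (α : Module.Dual K P) (β : Module.Dual K N) {N' : Type*} [AddCommGroup N'] [Module K N']
    (f : N' →ₗ[K] N ⊗[K] P) (t : M ⊗[K] N') :
    contr β (contr α ((TensorProduct.assoc K M N P).symm (f.lTensor M t))) =
      contr (β ∘ₗ contr α ∘ₗ f) t := by
  induction t with
  | zero => simp only [map_zero]
  | add s t hs ht => simp only [map_add, hs, ht]
  | tmul x y =>
    have : ∀ s : N ⊗[K] P, contr β (contr α ((TensorProduct.assoc K M N P).symm (x ⊗ₜ[K] s))) =
        β (contr α s) • x := by
      intro s
      induction s with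
      | zero => simp
      | tmul y z => simp [smul_smul]
      | add s t hs ht => simp only [TensorProduct.tmul_add, map_add, hs, ht, add_smul]
    rw [LinearMap.lTensor_tmul, this, contr_tmul]
    rfl

end Contraction

/-! ### The isomorphism of the brane with the dual of its complement -/

namespace LagrangianBraneSpace

variable {K V : Type u} [Field K] [AddCommGroup V] [Module K V] (L : LagrangianBraneSpace K V)

theorem mem_Wpos {w : V} : w ∈ L.Wpos ↔ ∃ p, w ∈ L.Wp p :=
  Submodule.mem_iSup_of_directed _ L.Wp_mono.directed_le

theorem mem_Wneg {w : V} : w ∈ L.Wneg ↔ ∃ p, w ∈ L.Wm p :=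
  Submodule.mem_iSup_of_directed _ L.Wm_mono.directed_le

theorem Wp_le (p : ℕ) : L.Wp p ≤ L.Vp p := by
  rw [← L.W_sup p]
  exact le_sup_left

theorem Wm_le (p : ℕ) : L.Wm p ≤ L.Vp p := by
  rw [← L.W_sup p]
  exact le_sup_right

/-- Isotropy takes care of the `W_p⁺` component of a test vector, so non-degeneracy on `V_p`
applies. -/
theorem eq_zero_of_ω_Wm {p : ℕ} {w : V} (hw : w ∈ L.Wp p) (h : ∀ v ∈ L.Wm p, L.ω w v = 0) :
    w = 0 := by
  refine L.ω_nondeg p w (L.Wp_le p hw) fun y hy => ?_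
  rw [← L.W_sup p] at hy
  obtain ⟨a, ha, b, hb, rfl⟩ := Submodule.mem_sup.1 hy
  rw [map_add, L.ω_Wp p w hw a ha, h b hb, add_zero]

@[simp] theorem flat_apply (w : L.Wpos) (v : L.Wneg) :
    (L.flat w : Module.Dual K L.Wneg) v = L.ω w v := rfl

theorem flat_injective : Function.Injective L.flat := by
  rw [injective_iff_map_eq_zero]
  rintro ⟨w, hw⟩ h
  obtain ⟨p, hp⟩ := L.mem_Wpos.1 hw
  refine Subtype.ext (L.eq_zero_of_ω_Wm hp fun v hv => ?_)
  rw [← L.flat_apply ⟨w, hw⟩ ⟨v, L.mem_Wneg.2 ⟨p, hv⟩⟩, h]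
  rfl

/-- The compatibility of the projections, iterated over the steps from `q` down to `p`. -/
theorem Wm_le_sup (p q : ℕ) : L.Wm q ≤ L.Wm p ⊔ L.F p := by
  rcases le_total q p with h | h
  · exact (L.Wm_mono h).trans le_sup_left
  · induction q, h using Nat.le_induction with
    | base => exact le_sup_left
    | succ q hq ih =>
      exact (L.Wm_proj q).trans (sup_le ih ((L.F_anti hq).trans le_sup_right))

/-- An element of `U` is determined by its restriction to some `W_p⁻`. At that level the form embeds
`W_p⁺` into the dual of `W_p⁻`, and the two have equal dimension because both pieces have half the
dimension of `V_p`. -/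
theorem flat_surjective : Function.Surjective L.flat := by
  rintro ⟨f, p, hp⟩
  have := L.Vp_finite p
  have : FiniteDimensional K (L.Wp p) := Submodule.finiteDimensional_of_le (L.Wp_le p)
  have : FiniteDimensional K (L.Wm p) := Submodule.finiteDimensional_of_le (L.Wm_le p)
  let φ : L.Wp p →ₗ[K] Module.Dual K (L.Wm p) :=
    (LinearMap.lcomp K K (L.Wm p).subtype).comp (L.ω.comp (L.Wp p).subtype)
  have hφ : Function.Injective φ := by
    rw [injective_iff_map_eq_zero]
    intro w h
    exact Subtype.ext (L.eq_zero_of_ω_Wm w.2 fun v hv => LinearMap.congr_fun h ⟨v, hv⟩)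
  have hdim : Module.finrank K (L.Wp p) = Module.finrank K (Module.Dual K (L.Wm p)) := by
    rw [Subspace.dual_finrank_eq]
    have h1 := L.finrank_Wp p
    have h2 := L.finrank_Wm p
    omega
  have hsurj := (LinearMap.injective_iff_surjective_of_finrank_eq_finrank hdim).1 hφ
  have hle : L.Wm p ≤ L.Wneg := le_iSup L.Wm p
  obtain ⟨w, hw⟩ := hsurj (f ∘ₗ Submodule.inclusion hle)
  refine ⟨⟨w, L.mem_Wpos.2 ⟨p, w.2⟩⟩, Subtype.ext (LinearMap.ext fun v => ?_)⟩
  -- So far the functionals agree on `W_p⁻` only. A general vector of `W⁻` differs from one there by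
  -- an element `b` of `F p ∩ W⁻`, which both functionals kill.
  obtain ⟨q, hq⟩ := L.mem_Wneg.1 v.2
  obtain ⟨a, ha, b, hb, hab⟩ := Submodule.mem_sup.1 (L.Wm_le_sup p q hq)
  have hb' : b ∈ L.Wneg := by
    have : b = (v : V) - a := by rw [← hab]; abel
    rw [this]
    exact sub_mem v.2 (hle ha)
  have hv : v = ⟨a, hle ha⟩ + ⟨b, hb'⟩ := Subtype.ext hab.symm
  have h1 : L.ω w a = f ⟨a, hle ha⟩ := LinearMap.congr_fun hw ⟨a, ha⟩
  rw [flat_apply]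
  change L.ω w v = f v
  rw [hv, map_add f, hp ⟨b, hb'⟩ hb, Submodule.coe_add, map_add, L.ω_proj p w w.2 b hb hb', h1]

/-- The isomorphism of the brane with the dual of its complement. -/
def flatE : L.Wpos ≃ₗ[K] L.U := LinearEquiv.ofBijective L.flat ⟨L.flat_injective, L.flat_surjective⟩

@[simp] theorem flat_flatE_symm (v : L.U) : L.flat (L.flatE.symm v) = v :=
  L.flatE.apply_symm_apply v

/-- The completion of the complement of the brane as the dual of the brane. -/
def dualE : L.X .contra ≃ₗ[K] Module.Dual K L.Wpos :=
  (L.flatE.dualMap : L.What ≃ₗ[K] Module.Dual K L.Wpos)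

theorem dual_ext {ψ χ : L.X .contra} (h : ∀ w, L.dualE ψ w = L.dualE χ w) : ψ = χ :=
  L.dualE.injective (LinearMap.ext h)

theorem flat_mem_grU {d : ℤ} {w : L.Wpos} (hw : w ∈ L.grPos d) : L.flat w ∈ L.grU d := by
  intro i hi v hv
  rw [flat_apply]
  exact L.ω_degree d i (fun h => hi (by omega)) _ hw _ hv

theorem Wneg_homog : IsHomogeneousSub L.gr L.Wneg :=
  iSup_le fun p => (L.Wm_homog p).trans
    (iSup_mono fun _ => inf_le_inf_right _ (le_iSup L.Wm p))

theorem Wneg_ext {f g : Module.Dual K L.Wneg}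
    (h : ∀ i, ∀ v : L.Wneg, (v : V) ∈ L.gr i → f v = g v) : f = g := by
  refine LinearMap.ext fun ⟨v, hv⟩ => ?_
  have hv' := L.Wneg_homog hv
  have : (⨆ i, L.Wneg ⊓ L.gr i) ≤ (LinearMap.eqLocus f g).map L.Wneg.subtype :=
    iSup_le fun i w hw => ⟨⟨w, hw.1⟩, h i ⟨w, hw.1⟩ hw.2, rfl⟩
  obtain ⟨w, hw, hwv⟩ := this hv'
  have : w = ⟨v, hv⟩ := Subtype.ext hwv
  rw [← this]
  exact hw

/-- The degree `d` component of the preimage works: since the form has degree `0`, the other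
components pair trivially with the part of `W⁻` on which `f` is supported. -/
theorem exists_of_mem_grU {d : ℤ} {f : L.U} (hf : f ∈ L.grU d) :
    ∃ w ∈ L.grPos d, L.flat w = f := by
  refine ⟨gproj L.grPos_internal (· = d) (L.flatE.symm f),
    gproj_mem _ _ _ (fun i hi => by rw [hi]) _, Subtype.ext (L.Wneg_ext fun i v hv => ?_)⟩
  have key : ∀ w : L.Wpos, (L.flat (gproj L.grPos_internal (· = d) w) : Module.Dual K L.Wneg) v =
      if i = -d then (L.flat w : Module.Dual K L.Wneg) v else 0 := by
    intro w
    have : (LinearMap.applyₗ v ∘ₗ L.U.subtype ∘ₗ L.flat) ∘ₗ gproj L.grPos_internal (· = d) =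
        (if i = -d then (LinearMap.applyₗ v ∘ₗ L.U.subtype ∘ₗ L.flat) else 0) := by
      refine gr_linearMap_ext L.grPos_internal fun j w hw => ?_
      by_cases hj : j = d
      · rw [LinearMap.comp_apply, gproj_of_pos L.grPos_internal (P := (· = d)) hj hw]
        split_ifs with h
        · rfl
        · exact L.flat_mem_grU hw i (by rwa [hj]) v hv
      · rw [LinearMap.comp_apply, gproj_of_neg L.grPos_internal (P := (· = d)) hj hw, map_zero]
        split_ifs with h
        · exact (L.flat_mem_grU hw i (by omega) v hv).symm
        · rfl
    have h2 := LinearMap.congr_fun this w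
    split_ifs at h2 ⊢ <;> exact h2
  rw [key, flat_flatE_symm]
  split_ifs with h
  · rfl
  · exact (hf i h v hv).symm

theorem mem_grHat {d : ℤ} {ψ : L.What} :
    ψ ∈ L.grHat d ↔ ∀ i, i ≠ -d → ∀ w ∈ L.grPos i, L.dualE ψ w = 0 := by
  constructor
  · exact fun h i hi w hw => h i hi _ (L.flat_mem_grU hw)
  · intro h i hi v hv
    obtain ⟨w, hw, rfl⟩ := L.exists_of_mem_grU hv
    exact h i hi w hw

/-! ### Coarsened gradings and truncations of the spaces attached to the edges -/

section Coarse

variable {A : Type} [AddCommGroup A] (f : ℤ →+ A)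

/-- The elements of degree `a` for the grading that is coarsened along `f`. -/
def cgr : (c : Dir) → A → Submodule K (L.X c)
  | .co, a => (⨆ (i : ℤ) (_ : f i = a), L.grPos i : Submodule K L.Wpos)
  -- A condition of vanishing, not a sum of homogeneous parts: elements of the completion can have
  -- infinitely many components of the same class.
  | .contra, a => ⨅ (i : ℤ) (_ : f i ≠ -a) (w : L.grPos i),
      LinearMap.ker (LinearMap.applyₗ (w : L.Wpos) ∘ₗ L.dualE.toLinearMap)

theorem mem_cgr_contra {a : A} {ψ : L.X .contra} :
    ψ ∈ L.cgr f .contra a ↔ ∀ i, f i ≠ -a → ∀ w ∈ L.grPos i, L.dualE ψ w = 0 := by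
  simp [cgr]

theorem cgr_co_le {a : A} {S : Submodule K L.Wpos} (h : ∀ i, f i = a → L.grPos i ≤ S) :
    L.cgr f .co a ≤ S := iSup₂_le h

theorem mem_cgr_co {a : A} {i : ℤ} (hi : f i = a) {w : L.Wpos} (hw : w ∈ L.grPos i) :
    w ∈ L.cgr f .co a :=
  (le_iSup₂ (f := fun (i : ℤ) (_ : f i = a) => L.grPos i) i hi : L.grPos i ≤ _) hw

/-- Taking `f` to be the identity recovers the grading, and `f = parity` the splitting into even and
odd; statements about `cgr` serve both. -/
theorem deg_eq_cgr (c : Dir) (d : ℤ) : L.deg c d = L.cgr (AddMonoidHom.id ℤ) c d := by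
  cases c
  · refine le_antisymm (fun w hw => L.mem_cgr_co (AddMonoidHom.id ℤ) rfl hw) ?_
    exact L.cgr_co_le _ fun i hi => by
      have : i = d := hi
      subst this
      exact le_rfl
  · ext ψ
    rw [mem_cgr_contra]
    exact L.mem_grHat

theorem deg_le_cgr (c : Dir) (d : ℤ) : L.deg c d ≤ L.cgr f c (f d) := by
  cases c
  · exact fun w hw => L.mem_cgr_co f rfl hw
  · intro ψ hψ
    refine (L.mem_cgr_contra f).2 fun i hi w hw => L.mem_grHat.1 hψ i ?_ w hw
    rintro rfl
    exact hi (map_neg f d)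

theorem pairing_eq_zero {a b : A} (hab : a ≠ -b) {w : L.Wpos} (hw : w ∈ L.cgr f .co a)
    {ψ : L.X .contra} (hψ : ψ ∈ L.cgr f .contra b) : L.dualE ψ w = 0 := by
  have : L.cgr f .co a ≤ LinearMap.ker (L.dualE ψ) :=
    L.cgr_co_le f fun i hi w hw => (L.mem_cgr_contra f).1 hψ i (by rwa [hi]) w hw
  exact this hw

end Coarse

/-- The projection to the sum, respectively the product, of the homogeneous parts the degree of
which satisfies `P`. -/
def trunc (P : ℤ → Prop) : (c : Dir) → L.X c →ₗ[K] L.X c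
  | .co => (gproj L.grPos_internal P : L.Wpos →ₗ[K] L.Wpos)
  | .contra => L.dualE.symm.toLinearMap ∘ₗ
      LinearMap.lcomp K K (gproj L.grPos_internal (fun i => P (-i))) ∘ₗ L.dualE.toLinearMap

theorem dualE_trunc (P : ℤ → Prop) (ψ : L.X .contra) (w : L.Wpos) :
    L.dualE (L.trunc P .contra ψ) w =
      L.dualE ψ (gproj L.grPos_internal (fun i => P (-i)) w) := by
  rw [trunc, LinearMap.comp_apply, LinearEquiv.coe_coe, LinearEquiv.apply_symm_apply]
  rfl

theorem trunc_mem_cgr {A : Type} [AddCommGroup A] (f : ℤ →+ A) (a : A) (c : Dir) (x : L.X c) :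
    L.trunc (f · = a) c x ∈ L.cgr f c a := by
  cases c
  · exact gproj_mem _ _ (L.cgr f .co a) (fun i hi w hw => L.mem_cgr_co f hi hw) _
  · refine (L.mem_cgr_contra f).2 fun i hi w hw => ?_
    rw [dualE_trunc, gproj_of_neg _ _ hw, map_zero]
    rw [map_neg]
    rintro rfl
    simp at hi

theorem trunc_mem_deg (d : ℤ) (c : Dir) (x : L.X c) : L.trunc (· = d) c x ∈ L.deg c d := by
  rw [deg_eq_cgr]
  exact L.trunc_mem_cgr (AddMonoidHom.id ℤ) d c x

theorem trunc_eq_self {A : Type} [AddCommGroup A] {f : ℤ →+ A} {a : A} {c : Dir} {x : L.X c}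
    (hx : x ∈ L.cgr f c a) : L.trunc (f · = a) c x = x := by
  cases c
  · have : L.cgr f .co a ≤ LinearMap.eqLocus (gproj L.grPos_internal (f · = a)) LinearMap.id :=
      L.cgr_co_le f fun i hi w hw => gproj_of_pos (P := (f · = a)) _ hi hw
    exact this hx
  · refine L.dual_ext fun w => ?_
    rw [dualE_trunc, ← LinearMap.comp_apply]
    refine LinearMap.congr_fun (gr_linearMap_ext L.grPos_internal fun i w hw => ?_) w
    by_cases hi : f (-i) = a
    · rw [LinearMap.comp_apply, gproj_of_pos (P := fun i => f (-i) = a) _ hi hw]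
    · rw [LinearMap.comp_apply, gproj_of_neg (P := fun i => f (-i) = a) _ hi hw, map_zero]
      refine ((L.mem_cgr_contra f).1 hx i ?_ w hw).symm
      rintro h
      exact hi (by rw [map_neg, h, neg_neg])

theorem trunc_eq_zero {A : Type} [AddCommGroup A] {f : ℤ →+ A} {a b : A} (hab : b ≠ a) {c : Dir}
    {x : L.X c} (hx : x ∈ L.cgr f c a) : L.trunc (f · = b) c x = 0 := by
  cases c
  · have : L.cgr f .co a ≤ LinearMap.ker (gproj L.grPos_internal (f · = b)) :=
      L.cgr_co_le f fun i hi w hw => gproj_of_neg (P := (f · = b)) _ (by rw [hi]; exact hab.symm) hw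
    exact this hx
  · refine L.dual_ext fun w => ?_
    rw [dualE_trunc, ← LinearMap.comp_apply, map_zero]
    refine LinearMap.congr_fun (gr_linearMap_ext L.grPos_internal fun i w hw => ?_) w
    by_cases hi : f (-i) = b
    · rw [LinearMap.comp_apply, gproj_of_pos (P := fun i => f (-i) = b) _ hi hw]
      refine (L.mem_cgr_contra f).1 hx i ?_ w hw
      rintro h
      exact hab (by rw [← hi, map_neg, h, neg_neg])
    · rw [LinearMap.comp_apply, gproj_of_neg (P := fun i => f (-i) = b) _ hi hw, map_zero]
      rfl

theorem trunc_finset (D : Finset ℤ) (c : Dir) (x : L.X c) :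
    L.trunc (· ∈ D) c x = ∑ d ∈ D, L.trunc (· = d) c x := by
  cases c
  · exact (LinearMap.congr_fun (gproj_finset L.grPos_internal D) x).trans
      (LinearMap.sum_apply _ _ _)
  · refine L.dual_ext fun w => ?_
    rw [map_sum, LinearMap.sum_apply]
    simp only [dualE_trunc]
    have : gproj L.grPos_internal (fun i => -i ∈ D) = ∑ d ∈ D, gproj L.grPos_internal (-· = d) := by
      have h := gproj_finset L.grPos_internal (D.image (-·))
      rw [Finset.sum_image (by simp)] at h
      convert h using 3
      · rw [Finset.mem_image]
        exact ⟨fun h => ⟨_, h, neg_neg _⟩, by rintro ⟨a, ha, rfl⟩; rwa [neg_neg]⟩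
      · funext d
        exact propext neg_eq_iff_eq_neg
    rw [this, LinearMap.sum_apply, map_sum]

/-- The parity of a degree. -/
abbrev parity : ℤ →+ ZMod 2 := Int.castAddHom (ZMod 2)

/-- The even part and the odd part. -/
abbrev ppart (p : ZMod 2) (c : Dir) : L.X c →ₗ[K] L.X c := L.trunc (parity · = p) c

/-- Two summands suffice even in the completion, where the decomposition into degrees need not be a
finite sum. Signs are therefore attached to parities and not to degrees. -/
theorem sum_ppart (c : Dir) (x : L.X c) : ∑ p, L.ppart p c x = x := by
  have h : ∀ w, ∑ p, gproj L.grPos_internal (fun i => parity i = p) w = w := by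
    intro w
    rw [← LinearMap.sum_apply]
    refine LinearMap.congr_fun (g := LinearMap.id)
      (gr_linearMap_ext L.grPos_internal fun i w hw => ?_) w
    rw [LinearMap.sum_apply, Finset.sum_eq_single (parity i)]
    · exact gproj_of_pos (P := fun j => parity j = parity i) _ rfl hw
    · exact fun p _ hp => gproj_of_neg (P := fun j => parity j = p) _ (Ne.symm hp) hw
    · simp
  cases c
  · exact h x
  · refine L.dual_ext fun w => ?_
    rw [map_sum, LinearMap.sum_apply]
    simp only [dualE_trunc, ← map_sum]
    congr 1
    refine (Finset.sum_congr rfl fun p _ => ?_).trans (h w)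
    -- The even part of a functional lives on the even vectors: the reversal of degrees under
    -- duality is invisible modulo 2.
    simp only [map_neg, ZMod.neg_eq_self_mod_two]

/-! ### Truncation in finitely many degrees -/

/-- A fixed `w` has finitely many components, so all other components of a functional are irrelevant
to its value there. -/
theorem exists_trunc_eq (w : L.Wpos) :
    ∃ D : Finset ℤ, ∀ D' : Finset ℤ, D ⊆ D' →
      ∀ ψ : L.X .contra, L.dualE (L.trunc (· ∈ D') .contra ψ) w = L.dualE ψ w := by
  obtain ⟨D, hD⟩ := exists_gproj_eq L.grPos_internal w
  refine ⟨D.image (-·), fun D' h ψ => ?_⟩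
  have e : (fun i => -i ∈ D') = (· ∈ D'.image (-·)) := by
    funext i
    rw [Finset.mem_image]
    exact propext ⟨fun h => ⟨_, h, neg_neg _⟩, by rintro ⟨a, ha, rfl⟩; rwa [neg_neg]⟩
  rw [dualE_trunc, e, hD]
  intro d hd
  refine Finset.mem_image.2 ⟨-d, h (Finset.mem_image_of_mem _ hd), neg_neg d⟩

theorem trunc_mem_iSup (D : Finset ℤ) (c : Dir) (x : L.X c) :
    L.trunc (· ∈ D) c x ∈ ⨆ d, L.deg c d := by
  rw [trunc_finset]
  exact sum_mem fun d _ => le_iSup (L.deg c) d (L.trunc_mem_deg d c x)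

theorem iSup_deg_co : ⨆ d, L.deg .co d = ⊤ :=
  L.grPos_internal.submodule_iSup_eq_top

end LagrangianBraneSpace

/-! ### Evaluation of trees -/

namespace Tree

variable {K V : Type u} [Field K] [AddCommGroup V] [Module K V] {B : BraneSpace K V}
  {I J : Type} {s : I → Dir} {t : J → Dir}

/-- The value of a tree for given operations on the vertices and given inputs. -/
def eval (op : ∀ g : Gen, B.X g.inL →ₗ[K] B.X g.inR →ₗ[K] B.X g.out) (x : ∀ i, B.X (s i)) :
    {c : Dir} → Tree s c → B.X c
  | _, leaf i => x i
  | _, node g l r => op g (l.eval op x) (r.eval op x)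

variable (op : ∀ g : Gen, B.X g.inL →ₗ[K] B.X g.inR →ₗ[K] B.X g.out)

theorem eval_congr {x y : ∀ i, B.X (s i)} {c : Dir} (T : Tree s c)
    (h : ∀ i ∈ T.leaves, x i = y i) : T.eval op x = T.eval op y := by
  induction T with
  | leaf i => exact h i (by simp [leaves])
  | node g l r hl hr =>
    rw [eval, eval, hl fun i hi => h i (by simp [leaves, hi]),
      hr fun i hi => h i (by simp [leaves, hi])]

theorem eval_bind (f : ∀ i, Tree t (s i)) (x : ∀ j, B.X (t j)) {c : Dir} (T : Tree s c) :
    (T.bind f).eval op x = T.eval op fun i => (f i).eval op x := by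
  induction T with
  | leaf i => rfl
  | node g l r hl hr => simp only [bind, eval, hl, hr]

theorem eval_relabel (σ : I ≃ J) (x : ∀ j, B.X (t j)) {c : Dir} (T : Tree (fun i => t (σ i)) c) :
    (T.relabel σ).eval op x = T.eval op fun i => x (σ i) := eval_bind op _ x T

/-- The associativity of substitution, in the form demanded by `map_graft` before signs are taken
into account. -/
theorem eval_graft {s : Option I → Dir} {c : Dir} (T : Tree s c) (T' : Tree t (s none))
    (z : ∀ k, B.X (Sum.elim (fun i => s (some i)) t k)) :
    (T.graft T').eval op z = T.eval op (B.plug z (T'.eval op fun j => z (Sum.inr j))) := by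
  refine (eval_bind op _ z T).trans ?_
  congr 1
  funext o
  cases o with
  | none => exact eval_bind (t := Sum.elim (fun i => s (some i)) t) op _ z T'
  | some i => rfl

theorem eval_update_of_notMem [DecidableEq I] (x : ∀ i, B.X (s i)) (i : I) (a : B.X (s i))
    {c : Dir} (T : Tree s c) (hi : i ∉ T.leaves) :
    T.eval op (Function.update x i a) = T.eval op x :=
  eval_congr op T fun j hj => Function.update_of_ne (by rintro rfl; exact hi hj) _ _

/-- Without repeated labels, the varied one occurs in exactly one of the two subtrees, and the other
subtree is constant. -/
theorem eval_update_add [DecidableEq I] (x : ∀ i, B.X (s i)) (i : I) (a b : B.X (s i))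
    {c : Dir} (T : Tree s c) (hT : T.leaves.Nodup) (hi : i ∈ T.leaves) :
    T.eval op (Function.update x i (a + b)) =
      T.eval op (Function.update x i a) + T.eval op (Function.update x i b) := by
  induction T with
  | leaf j =>
    obtain rfl : i = j := by simpa [leaves] using hi
    simp [eval]
  | node g l r hl hr =>
    rw [leaves, List.nodup_append] at hT
    rcases List.mem_append.1 hi with h | h
    · have hn : i ∉ r.leaves := fun h' => hT.2.2 i h i h' rfl
      simp only [eval, eval_update_of_notMem op x i _ r hn, hl hT.1 h, map_add,
        LinearMap.add_apply]
    · have hn : i ∉ l.leaves := fun h' => hT.2.2 i h' i h rfl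
      simp only [eval, eval_update_of_notMem op x i _ l hn, hr hT.2.1 h, map_add]

theorem eval_update_smul [DecidableEq I] (x : ∀ i, B.X (s i)) (i : I) (k : K) (a : B.X (s i))
    {c : Dir} (T : Tree s c) (hT : T.leaves.Nodup) (hi : i ∈ T.leaves) :
    T.eval op (Function.update x i (k • a)) = k • T.eval op (Function.update x i a) := by
  induction T with
  | leaf j =>
    obtain rfl : i = j := by simpa [leaves] using hi
    simp [eval]
  | node g l r hl hr =>
    rw [leaves, List.nodup_append] at hT
    rcases List.mem_append.1 hi with h | h
    · have hn : i ∉ r.leaves := fun h' => hT.2.2 i h i h' rfl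
      simp only [eval, eval_update_of_notMem op x i _ r hn, hl hT.1 h, map_smul,
        LinearMap.smul_apply]
    · have hn : i ∉ l.leaves := fun h' => hT.2.2 i h' i h rfl
      simp only [eval, eval_update_of_notMem op x i _ l hn, hr hT.2.1 h, map_smul]

/-- The evaluation of a tree in which every label occurs once as a multilinear map. -/
def evalM {c : Dir} (T : Tree s c) (h : T.Linear) :
    MultilinearMap K (fun i => B.X (s i)) (B.X c) where
  toFun x := T.eval op x
  map_update_add' x i a b := eval_update_add op x i a b T h.1 (h.2 i)
  map_update_smul' x i k a := eval_update_smul op x i k a T h.1 (h.2 i)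

@[simp] theorem evalM_apply {c : Dir} (T : Tree s c) (h : T.Linear) (x : ∀ i, B.X (s i)) :
    T.evalM op h x = T.eval op x := rfl

end Tree

namespace LagrangianBraneSpace

variable {K V : Type u} [Field K] [AddCommGroup V] [Module K V] (L : LagrangianBraneSpace K V)

/-! ### The operations given by a product and a coproduct -/

section Op

variable (mul : L.Wpos →ₗ[K] L.Wpos →ₗ[K] L.Wpos) (comul : L.Wpos →ₗ[K] L.Wpos ⊗[K] L.Wpos)

/-- The values on the generators, along the basic direction, of the reduced representation in which
`A` is the product and `C` is the coproduct. -/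
def op : ∀ g : Gen, L.X g.inL →ₗ[K] L.X g.inR →ₗ[K] L.X g.out
  | .A => mul
  | .B => (LinearMap.mk₂ K (fun ψ χ : L.X .contra =>
      L.dualE.symm (L.dualE χ ∘ₗ contr (L.dualE ψ) ∘ₗ comul))
      (fun ψ ψ' χ => by
        rw [map_add, map_add, LinearMap.add_comp, LinearMap.comp_add, map_add])
      (fun r ψ χ => by
        rw [map_smul, map_smul, LinearMap.smul_comp, LinearMap.comp_smul, map_smul])
      (fun ψ χ χ' => by rw [map_add, LinearMap.add_comp, map_add])
      (fun r ψ χ => by rw [map_smul, LinearMap.smul_comp, map_smul]) :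
      L.X .contra →ₗ[K] L.X .contra →ₗ[K] L.X .contra)
  | .C => ((contr.flip ∘ₗ comul).compl₂ L.dualE.toLinearMap :
      L.Wpos →ₗ[K] L.X .contra →ₗ[K] L.Wpos)
  | .D => (LinearMap.mk₂ K (fun (y : L.Wpos) (ψ : L.X .contra) =>
      L.dualE.symm (L.dualE ψ ∘ₗ mul.flip y))
      (fun y y' ψ => by rw [map_add, LinearMap.comp_add, map_add])
      (fun r y ψ => by rw [map_smul, LinearMap.comp_smul, map_smul])
      (fun y ψ ψ' => by rw [map_add, LinearMap.add_comp, map_add])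
      (fun r y ψ => by rw [map_smul, LinearMap.smul_comp, map_smul]) :
      L.Wpos →ₗ[K] L.X .contra →ₗ[K] L.X .contra)

theorem dualE_op_B (ψ χ : L.X .contra) (w : L.Wpos) :
    L.dualE (L.op mul comul .B ψ χ) w = L.dualE χ (L.op mul comul .C w ψ) := by
  change L.dualE (L.dualE.symm _) w = _
  rw [LinearEquiv.apply_symm_apply]
  rfl

theorem dualE_op_D (y : L.Wpos) (ψ : L.X .contra) (w : L.Wpos) :
    L.dualE (L.op mul comul .D y ψ) w = L.dualE ψ (mul w y) := by
  change L.dualE (L.dualE.symm _) w = _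
  rw [LinearEquiv.apply_symm_apply]
  rfl

variable {mul comul} (hm : ∀ i j, ∀ x ∈ L.grPos i, ∀ y ∈ L.grPos j, mul x y ∈ L.grPos (i + j))
  (hc : ∀ i, ∀ x ∈ L.grPos i, comul x ∈ grTensor L.grPos i)
  {A : Type} [AddCommGroup A] (f : ℤ →+ A)

include hm in
theorem mul_mem_cgr {a b : A} {x y : L.Wpos} (hx : x ∈ L.cgr f .co a) (hy : y ∈ L.cgr f .co b) :
    mul x y ∈ L.cgr f .co (a + b) := by
  have h1 : L.cgr f .co a ≤ (L.cgr f .co (a + b)).comap (mul.flip y) := by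
    refine L.cgr_co_le f fun i hi x hx => ?_
    have h2 : L.cgr f .co b ≤ (L.cgr f .co (a + b)).comap (mul x) :=
      L.cgr_co_le f fun j hj y hy => L.mem_cgr_co f (by rw [map_add, hi, hj]) (hm i j x hx y hy)
    exact h2 hy
  exact h1 hx

include hc in
-- A functional of degree `b` only sees second tensor factors of degree `-b`; the first factor then
-- has the degree of `x` raised by `b`.
theorem op_C_mem_cgr {a b : A} {x : L.Wpos} {ψ : L.X .contra} (hx : x ∈ L.cgr f .co a)
    (hψ : ψ ∈ L.cgr f .contra b) : L.op mul comul .C x ψ ∈ L.cgr f .co (a + b) := by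
  have h1 : L.cgr f .co a ≤ (L.cgr f .co (a + b)).comap ((contr (L.dualE ψ)) ∘ₗ comul) := by
    refine L.cgr_co_le f fun i hi x hx => ?_
    have h2 : grTensor L.grPos i ≤
        Submodule.comap (contr (L.dualE ψ)) (show Submodule K L.Wpos from L.cgr f .co (a + b)) := by
      refine iSup_le fun j => Submodule.map₂_le.2 fun m hm n hn => ?_
      rw [Submodule.mem_comap, TensorProduct.mk_apply, contr_tmul]
      by_cases h : f (i - j) = -b
      · refine Submodule.smul_mem _ _ (L.mem_cgr_co f ?_ hm)
        rw [map_sub, hi] at h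
        rw [← sub_eq_zero] at h ⊢
        rw [← neg_eq_zero, ← h]
        abel
      · rw [(L.mem_cgr_contra f).1 hψ _ h n hn, zero_smul]
        exact zero_mem _
    exact h2 (hc i x hx)
  exact h1 hx

include hm hc in
-- For `A` and `C` this is the degree condition on product and coproduct. For `B` and `D` the
-- transpose is tested on `w`, where the pairing vanishes outside the complementary degree.
theorem op_mem_cgr {g : Gen} {a b : A} {x : L.X g.inL} {y : L.X g.inR}
    (hx : x ∈ L.cgr f g.inL a) (hy : y ∈ L.cgr f g.inR b) :
    L.op mul comul g x y ∈ L.cgr f g.out (a + b) := by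
  cases g
  · exact L.mul_mem_cgr hm f hx hy
  · refine (L.mem_cgr_contra f).2 fun i hi w hw => ?_
    refine (L.dualE_op_B mul comul x y w).trans ?_
    refine L.pairing_eq_zero f (a := f i + a) (b := b) ?_
      (L.op_C_mem_cgr hc f (L.mem_cgr_co f rfl hw) hx) hy
    intro h
    refine hi ?_
    rw [neg_add, ← h]
    abel
  · exact L.op_C_mem_cgr hc f hx hy
  · refine (L.mem_cgr_contra f).2 fun i hi w hw => ?_
    refine (L.dualE_op_D mul comul x y w).trans ?_
    refine L.pairing_eq_zero f (a := f i + a) (b := b) ?_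
      (L.mul_mem_cgr hm f (L.mem_cgr_co f rfl hw) hx) hy
    intro h
    refine hi ?_
    rw [neg_add, ← h]
    abel

include hm hc in
theorem eval_mem_cgr {I : Type} {s : I → Dir} {c : Dir} (T : Tree s c) (d : I → A)
    {x : ∀ i, L.X (s i)} (hx : ∀ i, x i ∈ L.cgr f (s i) (d i)) :
    T.eval (L.op mul comul) x ∈ L.cgr f c (T.leaves.map d).sum := by
  induction T with
  | leaf i => simpa [Tree.leaves, Tree.eval] using hx i
  | node g l r hl hr =>
    rw [Tree.leaves, List.map_append, List.sum_append]
    exact L.op_mem_cgr hm hc f hl hr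

end Op

/-! ### Dependence on the elements of the completion through finitely many functionals -/

section Extra

variable {I : Type} (s : I → Dir)

/-- The product of the pairings for the labels in the list `l`. -/
def lpair (l : List I) (u : I → L.U) (y : ∀ k, L.X (s k)) : K :=
  (l.map fun k => L.pairFactor (s k) (y k) (u k)).prod

/-- The functions that are pairings with a tensor. -/
def pairs (l : List I) : Submodule K ((∀ k, L.X (s k)) → K) :=
  Submodule.span K {h | ∃ u : I → L.U, h = L.lpair s l u}

/-- The functions that are contractions with a tensor with one more factor in `W⁺`. -/
def pairsW (l : List I) : Submodule K ((∀ k, L.X (s k)) → L.Wpos) :=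
  Submodule.span K {h | ∃ (u : I → L.U) (w : L.Wpos), h = fun y => L.lpair s l u y • w}

/-- The dependence on elements of the completion is through the pairing with a tensor. -/
def ExtraOn (l : List I) : (c : Dir) → ((∀ k, L.X (s k)) → L.X c) → Prop
  | .co, h => h ∈ L.pairsW s l
  | .contra, h => ∀ w : L.Wpos, (fun y => L.dualE (h y) w) ∈ L.pairs s l

variable {s}

/-- Surjectivity of `flat` lets elements of `U` be replaced by elements of `W⁺` as test vectors. -/
theorem isExtra_iff (e : Enum I) (c : Dir) (G : MultilinearMap K (fun i => L.X (s i)) (L.X c)) :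
    L.IsExtra e c G ↔
      ∀ x : ∀ k, L.X (s k), L.ExtraOn s e.1 c fun y => G fun k => L.merge (s k) (x k) (y k) := by
  cases c
  · exact Iff.rfl
  · refine forall_congr' fun x => ⟨fun h w => h (L.flat w), fun h v => ?_⟩
    have e : ∀ ψ : L.X .contra, L.dualE ψ (L.flatE.symm v) = (show L.What from ψ) v := fun ψ =>
      congrArg (show L.What from ψ) (L.flat_flatE_symm v)
    have h1 := h (L.flatE.symm v)
    simp only [e] at h1
    exact h1

variable {l l' : List I}

/-- Since the lists are disjoint, the two families of elements of `U` can be glued into one. -/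
theorem mul_mem_pairs (hl : (l ++ l').Nodup) {p q : (∀ k, L.X (s k)) → K} (hp : p ∈ L.pairs s l)
    (hq : q ∈ L.pairs s l') : p * q ∈ L.pairs s (l ++ l') := by
  classical
  have h := Submodule.mul_mem_mul hp hq
  rw [pairs, pairs, Submodule.span_mul_span] at h
  refine Submodule.span_mono ?_ h
  rintro _ ⟨_, ⟨u, rfl⟩, _, ⟨u', rfl⟩, rfl⟩
  refine ⟨fun k => if k ∈ l then u k else u' k, funext fun y => ?_⟩
  change L.lpair s l u y * L.lpair s l' u' y = _
  rw [lpair, lpair, lpair, List.map_append, List.prod_append]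
  congr 2
  · exact List.map_congr_left fun k hk => by rw [if_pos hk]
  · refine List.map_congr_left fun k hk => ?_
    rw [if_neg fun h => (List.nodup_append.1 hl).2.2 k h k hk rfl]

theorem smul_mem_pairsW {p : (∀ k, L.X (s k)) → K} (hp : p ∈ L.pairs s l) (w : L.Wpos) :
    (fun y => p y • w) ∈ L.pairsW s l := by
  induction hp using Submodule.span_induction with
  | mem p hp =>
    obtain ⟨u, rfl⟩ := hp
    exact Submodule.subset_span ⟨u, w, rfl⟩
  | zero =>
    convert zero_mem (L.pairsW s l) using 1
    exact funext fun y => zero_smul K w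
  | add p q _ _ hp hq =>
    convert add_mem hp hq using 1
    exact funext fun y => add_smul (p y) (q y) w
  | smul r p _ hp =>
    convert Submodule.smul_mem _ r hp using 1
    exact funext fun y => mul_smul r (p y) w

/-- Induction on contractions with tensors. -/
theorem pairsW_induction {P : ((∀ k, L.X (s k)) → L.Wpos) → Prop}
    (hs : ∀ p ∈ L.pairs s l, ∀ w, P fun y => p y • w) (ha : ∀ h h', P h → P h' → P (h + h'))
    {h : (∀ k, L.X (s k)) → L.Wpos} (hh : h ∈ L.pairsW s l) : P h := by
  -- Scalars are carried along and absorbed into `w`, so `P` need not be assumed stable under scalar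
  -- multiplication.
  suffices ∀ r : K, P (r • h) by simpa using this 1
  induction hh using Submodule.span_induction with
  | mem h hh =>
    obtain ⟨u, w, rfl⟩ := hh
    intro r
    convert hs _ (Submodule.subset_span ⟨u, rfl⟩ : L.lpair s l u ∈ L.pairs s l) (r • w) using 1
    exact funext fun y => smul_comm r (L.lpair s l u y) w
  | zero =>
    intro r
    convert hs 0 (zero_mem _) 0 using 1
    exact funext fun y => (smul_zero r).trans (smul_zero _).symm
  | add p q _ _ hp hq =>
    intro r
    rw [smul_add]
    exact ha _ _ (hp r) (hq r)
  | smul r' p _ hp =>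
    intro r
    rw [smul_smul]
    exact hp _

variable (mul : L.Wpos →ₗ[K] L.Wpos →ₗ[K] L.Wpos) (comul : L.Wpos →ₗ[K] L.Wpos ⊗[K] L.Wpos)

theorem contr_mem_pairsW {ψ : (∀ k, L.X (s k)) → L.X .contra} (hψ : L.ExtraOn s l .contra ψ)
    (t : L.Wpos ⊗[K] L.Wpos) : (fun y => contr (L.dualE (ψ y)) t) ∈ L.pairsW s l := by
  induction t with
  | zero =>
    simp only [map_zero]
    exact zero_mem (L.pairsW s l)
  | tmul a b =>
    simp only [contr_tmul]
    exact L.smul_mem_pairsW (hψ b) a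
  | add t t' h h' =>
    simp only [map_add]
    exact add_mem h h'

theorem contr_smul_mem_pairsW (hl : (l ++ l').Nodup) {p : (∀ k, L.X (s k)) → K}
    (hp : p ∈ L.pairs s l) {h : (∀ k, L.X (s k)) → L.Wpos}
    (hh : h ∈ L.pairsW s l') : (fun y => p y • h y) ∈ L.pairsW s (l ++ l') := by
  refine L.pairsW_induction (P := fun h => (fun y => p y • h y) ∈ L.pairsW s (l ++ l'))
    (fun q hq w => ?_) (fun h h' hh hh' => ?_) hh
  · simp only [smul_smul]
    exact L.smul_mem_pairsW (L.mul_mem_pairs hl hp hq) w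
  · simp only [Pi.add_apply, smul_add]
    exact add_mem hh hh'

theorem dualE_mem_pairs (hl : (l ++ l').Nodup) {h : (∀ k, L.X (s k)) → L.Wpos}
    (hh : h ∈ L.pairsW s l) {ψ : (∀ k, L.X (s k)) → L.X .contra}
    (hψ : L.ExtraOn s l' .contra ψ) : (fun y => L.dualE (ψ y) (h y)) ∈ L.pairs s (l ++ l') := by
  refine L.pairsW_induction (P := fun h => (fun y => L.dualE (ψ y) (h y)) ∈ L.pairs s (l ++ l'))
    (fun q hq w => ?_) (fun h h' hh hh' => ?_) hh
  · simp only [map_smul, smul_eq_mul]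
    exact L.mul_mem_pairs hl hq (hψ w)
  · simp only [Pi.add_apply, map_add]
    exact add_mem hh hh'

theorem map_mem_pairsW {h : (∀ k, L.X (s k)) → L.Wpos} (hh : h ∈ L.pairsW s l)
    (φ : L.Wpos →ₗ[K] L.Wpos) : (fun y => φ (h y)) ∈ L.pairsW s l := by
  refine L.pairsW_induction (P := fun h => (fun y => φ (h y)) ∈ L.pairsW s l)
    (fun q hq w => ?_) (fun h h' hh hh' => ?_) hh
  · simp only [map_smul]
    exact L.smul_mem_pairsW hq (φ w)
  · simp only [Pi.add_apply, map_add]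
    exact add_mem hh hh'

/-- Expand an input in `W⁺` into terms with a fixed vector `w`; the coproduct of `w` is a finite sum
of pure tensors. What remains are values of the other inputs at fixed vectors, and the pairings on
the two disjoint lists multiply. For `B` and `D` the same is done after transposing. -/
theorem extraOn_op (hl : (l ++ l').Nodup) (g : Gen) {h : (∀ k, L.X (s k)) → L.X g.inL}
    {h' : (∀ k, L.X (s k)) → L.X g.inR} (hh : L.ExtraOn s l g.inL h)
    (hh' : L.ExtraOn s l' g.inR h') :
    L.ExtraOn s (l ++ l') g.out fun y => L.op mul comul g (h y) (h' y) := by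
  cases g
  · change (fun y => mul (h y) (h' y)) ∈ L.pairsW s (l ++ l')
    refine L.pairsW_induction (P := fun h => (fun y => mul (h y) (h' y)) ∈ L.pairsW s (l ++ l'))
      (fun q hq w => ?_) (fun h h' hh hh' => ?_) hh
    · simp only [map_smul]
      exact L.contr_smul_mem_pairsW hl hq (L.map_mem_pairsW hh' (mul w))
    · simp only [Pi.add_apply, map_add]
      exact add_mem hh hh'
  · intro w
    refine (congrArg (· ∈ L.pairs s (l ++ l'))
      (funext fun y => L.dualE_op_B mul comul (h y) (h' y) w)).mpr ?_
    exact L.dualE_mem_pairs hl (L.contr_mem_pairsW hh (comul w)) hh'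
  · change (fun y => contr (L.dualE (h' y)) (comul (h y))) ∈ L.pairsW s (l ++ l')
    refine L.pairsW_induction
      (P := fun h => (fun y => contr (L.dualE (h' y)) (comul (h y))) ∈ L.pairsW s (l ++ l'))
      (fun q hq w => ?_) (fun h h' hh hh' => ?_) hh
    · simp only [map_smul]
      exact L.contr_smul_mem_pairsW hl hq (L.contr_mem_pairsW hh' (comul w))
    · simp only [Pi.add_apply, map_add]
      exact add_mem hh hh'
  · intro w
    refine (congrArg (· ∈ L.pairs s (l ++ l'))
      (funext fun y => L.dualE_op_D mul comul (h y) (h' y) w)).mpr ?_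
    exact L.dualE_mem_pairs hl (L.map_mem_pairsW hh (mul w)) hh'

/-- The function `f` stands for the evaluation at `i`, with its direction made a variable so that it
can be split into cases. -/
theorem extraOn_leaf (i : I) (c : Dir) (f : (∀ k, L.X (s k)) → L.X c) (a : L.X c)
    (hf : ∀ u y, L.lpair s [i] u y = L.pairFactor c (f y) (u i)) :
    L.ExtraOn s [i] c fun y => L.merge c a (f y) := by
  cases c
  · refine Submodule.subset_span ⟨fun _ => 0, a, funext fun y => ?_⟩
    rw [hf]
    exact (one_smul K (a : L.Wpos)).symm
  · refine fun w => Submodule.subset_span ⟨fun _ => L.flat w, funext fun y => ?_⟩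
    rw [hf]
    rfl

theorem extraOn_eval {c : Dir} (T : Tree s c) (hT : T.leaves.Nodup) (x : ∀ k, L.X (s k)) :
    L.ExtraOn s T.leaves c fun y =>
      T.eval (L.op mul comul) fun k => L.merge (s k) (x k) (y k) := by
  induction T with
  | leaf i => exact L.extraOn_leaf i (s i) (fun y => y i) (x i) fun u y => by simp [lpair]
  | node g l r hl hr =>
    rw [Tree.leaves] at hT ⊢
    exact L.extraOn_op mul comul hT g (hl (List.nodup_append.1 hT).1)
      (hr (List.nodup_append.1 hT).2.1)

theorem lpair_perm (h : l.Perm l') (u : I → L.U) : L.lpair s l u = L.lpair s l' u :=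
  funext fun _ => (h.map _).prod_eq

theorem ExtraOn.perm {L : LagrangianBraneSpace K V} {c : Dir} {h : (∀ k, L.X (s k)) → L.X c}
    (hh : L.ExtraOn s l c h) (hl : l.Perm l') : L.ExtraOn s l' c h := by
  cases c <;> simpa only [ExtraOn, pairsW, pairs, L.lpair_perm hl] using hh

/-- The transpose of the truncation. -/
theorem pairFactor_trunc (P : ℤ → Prop) (c : Dir) (x : L.X c) (v : L.U) :
    L.pairFactor c (L.trunc P c x) v =
      L.pairFactor c x (L.flat (gproj L.grPos_internal (fun i => P (-i)) (L.flatE.symm v))) := by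
  cases c
  · rfl
  · conv_lhs => rw [← L.flat_flatE_symm v]
    exact L.dualE_trunc P x (L.flatE.symm v)

theorem merge_trunc (P : ℤ → Prop) (c : Dir) (x y : L.X c) :
    L.merge c (L.trunc P c x) (L.trunc P c y) = L.trunc P c (L.merge c x y) := by
  cases c <;> rfl

/-- Truncating a functional is the same as truncating the element of `U` it is paired with, so
pairings with tensors are preserved. -/
theorem ExtraOn.comp_trunc {L : LagrangianBraneSpace K V} {c : Dir}
    {h : (∀ k, L.X (s k)) → L.X c} (hh : L.ExtraOn s l c h) (P : I → ℤ → Prop) :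
    L.ExtraOn s l c fun y => h fun k => L.trunc (P k) (s k) (y k) := by
  have key : ∀ u : I → L.U, (fun y : ∀ k, L.X (s k) => L.lpair s l u fun k =>
      L.trunc (P k) (s k) (y k)) = L.lpair s l fun k =>
        L.flat (gproj L.grPos_internal (fun i => P k (-i)) (L.flatE.symm (u k))) := by
    intro u
    funext y
    simp only [lpair, pairFactor_trunc]
  have hp : ∀ p ∈ L.pairs s l, (fun y => p fun k => L.trunc (P k) (s k) (y k)) ∈ L.pairs s l := by
    intro p hp
    induction hp using Submodule.span_induction with
    | mem p hp =>
      obtain ⟨u, rfl⟩ := hp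
      exact Submodule.subset_span ⟨_, key u⟩
    | zero => exact zero_mem (L.pairs s l)
    | add p q _ _ hp hq => exact add_mem hp hq
    | smul r p _ hp => exact Submodule.smul_mem _ r hp
  cases c
  · exact L.pairsW_induction
      (P := fun h => (fun y => h fun k => L.trunc (P k) (s k) (y k)) ∈ L.pairsW s l)
      (fun q hq w => L.smul_mem_pairsW (hp q hq) w) (fun h h' hh hh' => add_mem hh hh') hh
  · exact fun w => hp _ (hh w)

/-- A function that depends on the elements of the completion through the pairing with a tensor
depends on finitely many homogeneous parts only. -/
theorem ExtraOn.exists_trunc {L : LagrangianBraneSpace K V} {c : Dir}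
    {h : (∀ k, L.X (s k)) → L.X c} (hh : L.ExtraOn s l c h) (w : L.Wpos) :
    ∃ D : Finset ℤ, ∀ y, L.pairFactor c (h fun k => L.trunc (· ∈ D) (s k) (y k)) (L.flat w) =
        L.pairFactor c (h y) (L.flat w) ∧
      L.merge c (h fun k => L.trunc (· ∈ D) (s k) (y k)) 0 = L.merge c (h y) 0 := by
  classical
  have hv : ∀ (c : Dir) (v : L.U), ∃ D : Finset ℤ, ∀ D', D ⊆ D' → ∀ x : L.X c,
      L.pairFactor c (L.trunc (· ∈ D') c x) v = L.pairFactor c x v := by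
    rintro (_ | _) v
    · exact ⟨∅, fun _ _ _ => rfl⟩
    · obtain ⟨D, hD⟩ := L.exists_trunc_eq (L.flatE.symm v)
      refine ⟨D, fun D' h x => ?_⟩
      rw [← L.flat_flatE_symm v]
      exact hD D' h x
  have hl : ∀ (l : List I) (u : I → L.U), ∃ D : Finset ℤ, ∀ D', D ⊆ D' → ∀ y : ∀ k, L.X (s k),
      L.lpair s l u (fun k => L.trunc (· ∈ D') (s k) (y k)) = L.lpair s l u y := by
    intro l u
    induction l with
    | nil => exact ⟨∅, fun _ _ _ => rfl⟩
    | cons i l ih =>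
      obtain ⟨D, hD⟩ := ih
      obtain ⟨E, hE⟩ := hv (s i) (u i)
      refine ⟨D ∪ E, fun D' h y => ?_⟩
      have h1 := hD D' (Finset.union_subset_left h) y
      have h2 := hE D' (Finset.union_subset_right h) (y i)
      simp only [lpair, List.map_cons, List.prod_cons] at h1 ⊢
      rw [h1, h2]
  have hp : ∀ p ∈ L.pairs s l, ∃ D : Finset ℤ, ∀ D', D ⊆ D' → ∀ y : ∀ k, L.X (s k),
      p (fun k => L.trunc (· ∈ D') (s k) (y k)) = p y := by
    intro p hp
    induction hp using Submodule.span_induction with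
    | mem p hp =>
      obtain ⟨u, rfl⟩ := hp
      exact hl l u
    | zero => exact ⟨∅, fun _ _ _ => rfl⟩
    | add p q _ _ hp hq =>
      obtain ⟨D, hD⟩ := hp
      obtain ⟨E, hE⟩ := hq
      exact ⟨D ∪ E, fun D' h y => congrArg₂ (· + ·) (hD D' (Finset.union_subset_left h) y)
        (hE D' (Finset.union_subset_right h) y)⟩
    | smul r p _ hp =>
      obtain ⟨D, hD⟩ := hp
      exact ⟨D, fun D' h y => congrArg (r * ·) (hD D' h y)⟩
  cases c
  · have : ∃ D : Finset ℤ, ∀ D', D ⊆ D' → ∀ y : ∀ k, L.X (s k),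
        h (fun k => L.trunc (· ∈ D') (s k) (y k)) = h y := by
      refine L.pairsW_induction (P := fun h => ∃ D : Finset ℤ, ∀ D', D ⊆ D' →
        ∀ y : ∀ k, L.X (s k), h (fun k => L.trunc (· ∈ D') (s k) (y k)) = h y)
        (fun q hq w => ?_) (fun h h' hh hh' => ?_) hh
      · obtain ⟨D, hD⟩ := hp q hq
        exact ⟨D, fun D' h y => congrArg (· • w) (hD D' h y)⟩
      · obtain ⟨D, hD⟩ := hh
        obtain ⟨E, hE⟩ := hh'
        exact ⟨D ∪ E, fun D' h y => congrArg₂ (· + ·) (hD D' (Finset.union_subset_left h) y)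
          (hE D' (Finset.union_subset_right h) y)⟩
    obtain ⟨D, hD⟩ := this
    -- The statement joins two equations of which one is always empty: here the pairing factors are
    -- both `1`, and for `contra` the merged elements are both `0`.
    exact ⟨D, fun y => ⟨rfl, hD D subset_rfl y⟩⟩
  · obtain ⟨D, hD⟩ := hp _ (hh w)
    exact ⟨D, fun y => ⟨hD D subset_rfl y, rfl⟩⟩

end Extra

end LagrangianBraneSpace

/-! ### Functions that are additive in each variable -/

section Additive

/-- The function is additive in each variable. -/
structure AddInEach {I : Type*} {X : I → Type*} {M : Type*} [∀ i, AddCommGroup (X i)]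
    [AddCommGroup M] (f : (∀ i, X i) → M) : Prop where
  map_add : ∀ [DecidableEq I] (x : ∀ i, X i) (i : I) (a b : X i),
    f (Function.update x i (a + b)) = f (Function.update x i a) + f (Function.update x i b)

variable {K I : Type*} [Field K] {X : I → Type*} {M : Type*} [∀ i, AddCommGroup (X i)]
  [∀ i, Module K (X i)] [AddCommGroup M]

theorem MultilinearMap.addInEach [Module K M] (f : MultilinearMap K X M) : AddInEach f :=
  ⟨fun x i a b => f.map_update_add x i a b⟩

/-- One argument at a time is expanded into a sum of elements of the submodules `Q i d`. Additivity
alone suffices, so composites need not be packaged as multilinear maps. -/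
theorem AddInEach.ext [Finite I] {f g : (∀ i, X i) → M} (hf : AddInEach f) (hg : AddInEach g)
    {D : Type*} (Q : ∀ i, D → Submodule K (X i))
    (h : ∀ (d : I → D) (x : ∀ i, X i), (∀ i, x i ∈ Q i (d i)) → f x = g x)
    (x : ∀ i, X i) (hx : ∀ i, x i ∈ ⨆ d, Q i d) : f x = g x := by
  classical
  cases nonempty_fintype I
  have h0 : ∀ {f : (∀ i, X i) → M}, AddInEach f → ∀ x i, f (Function.update x i 0) = 0 := by
    intro f hf x i
    have := hf.map_add x i 0 0
    rw [add_zero] at this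
    exact left_eq_add.1 this
  -- `S` collects the arguments that are still sums; those outside it are already homogeneous.
  have key : ∀ (S : Finset I) (x : ∀ i, X i), (∀ i ∈ S, x i ∈ ⨆ d, Q i d) →
      (∀ i ∉ S, ∃ d, x i ∈ Q i d) → f x = g x := by
    intro S
    induction S using Finset.induction_on with
    | empty =>
      intro x _ hx
      choose d hd using fun i => hx i (by simp)
      exact h d x hd
    | insert i S hi ih =>
      intro x hx hx'
      have h1 : ∀ a ∈ ⨆ d, Q i d, f (Function.update x i a) = g (Function.update x i a) := by
        intro a ha
        induction ha using Submodule.iSup_induction' with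
        | mem d a ha =>
          refine ih _ (fun j hj => ?_) (fun j hj => ?_)
          · rw [Function.update_of_ne (by rintro rfl; exact hi hj)]
            exact hx j (Finset.mem_insert_of_mem hj)
          · by_cases hij : j = i
            · subst hij
              exact ⟨d, by rwa [Function.update_self]⟩
            · rw [Function.update_of_ne hij]
              exact hx' j (by simp [hij, hj])
        | zero => rw [h0 hf, h0 hg]
        | add a b _ _ ha hb =>
          have h2 := hf.map_add x i a b
          have h3 := hg.map_add x i a b
          exact h2.trans ((congrArg₂ (· + ·) ha hb).trans h3.symm)
      have := h1 (x i) (hx i (Finset.mem_insert_self i S))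
      rwa [Function.update_eq_self] at this
  exact key Finset.univ x (fun i _ => hx i) (fun i hi => absurd (Finset.mem_univ i) hi)

end Additive

/-! ### Operations determined by homogeneous inputs -/

namespace LagrangianBraneSpace

variable {K V : Type u} [Field K] [AddCommGroup V] [Module K V] (L : LagrangianBraneSpace K V)
  {I J : Type} {s : I → Dir} {c : Dir}

theorem iSup_parity (c : Dir) : ⨆ p, L.cgr parity c p = ⊤ := by
  refine eq_top_iff.2 fun x _ => ?_
  rw [← L.sum_ppart c x]
  exact sum_mem fun p _ => le_iSup (L.cgr parity c) p (L.trunc_mem_cgr parity p c x)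

theorem parity_ext [Finite I] {M : Type*} [AddCommGroup M]
    {f g : (∀ i, L.X (s i)) → M} (hf : AddInEach f) (hg : AddInEach g)
    (h : ∀ (p : I → ZMod 2) (x : ∀ i, L.X (s i)), (∀ i, x i ∈ L.cgr parity (s i) (p i)) →
      f x = g x) (x : ∀ i, L.X (s i)) : f x = g x :=
  hf.ext hg (fun i p => L.cgr parity (s i) p) h x fun i => by
    rw [iSup_parity]
    exact Submodule.mem_top

/-- A multilinear map of the endomorphism operad is determined by its values on homogeneous
elements. -/
theorem eq_zero_of_homogeneous {e : Enum I} {G : MultilinearMap K (fun i => L.X (s i)) (L.X c)}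
    (hG : L.IsExtra e c G)
    (h : ∀ (d : I → ℤ) (x : ∀ k, L.X (s k)), (∀ k, x k ∈ L.deg (s k) (d k)) → G x = 0) :
    G = 0 := by
  have := enum_finite e
  refine MultilinearMap.ext fun z => ?_
  rw [isExtra_iff] at hG
  -- Inputs from `W⁺` are sums of homogeneous elements as they stand; only those from the completion
  -- have to be truncated.
  have hm : ∀ (c : Dir) (x : L.X c) (D : Finset ℤ),
      L.merge c x (L.trunc (· ∈ D) c x) ∈ ⨆ d, L.deg c d := by
    rintro (_ | _) x D
    · rw [iSup_deg_co]
      exact Submodule.mem_top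
    · exact L.trunc_mem_iSup D .contra x
  have hz : ∀ D : Finset ℤ, (G fun k => L.merge (s k) (z k) (L.trunc (· ∈ D) (s k) (z k))) = 0 :=
    fun D => AddInEach.ext (MultilinearMap.addInEach G)
      (MultilinearMap.addInEach (0 : MultilinearMap K (fun i => L.X (s i)) (L.X c)))
      (fun i d => L.deg (s i) d) h _ fun i => hm _ _ _
  have hzz : (fun k => L.merge (s k) (z k) (z k)) = z := by
    funext k
    have : ∀ (c : Dir) (x : L.X c), L.merge c x x = x := by
      rintro (_ | _) x <;> rfl
    exact this _ _
  have hE := hG z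
  cases c
  · obtain ⟨D, hD⟩ := hE.exists_trunc 0
    have h1 := (hD z).2
    rw [hz, hzz] at h1
    exact h1.symm
  · refine L.dual_ext fun w => ?_
    obtain ⟨D, hD⟩ := hE.exists_trunc w
    have h1 := (hD z).1
    rw [hz, hzz] at h1
    exact h1.symm

/-- On homogeneous inputs the Koszul rule carries vanishing from one ordering to every other, and
homogeneous inputs determine each member of the family. -/
theorem EndOp_eq_zero {G : L.Family s c} (hG : G ∈ L.EndOp s c) (e : Enum I)
    (h : ∀ (d : I → ℤ) (x : ∀ k, L.X (s k)), (∀ k, x k ∈ L.deg (s k) (d k)) → G e x = 0) :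
    G = 0 := by
  have hall : ∀ e' : Enum I,
      ∀ (d : I → ℤ) (x : ∀ k, L.X (s k)), (∀ k, x k ∈ L.deg (s k) (d k)) → G e' x = 0 := by
    intro e'
    have := perm_induction (P := fun l => ∀ hl : l.Nodup ∧ ∀ i, i ∈ l,
      ∀ (d : I → ℤ) (x : ∀ k, L.X (s k)), (∀ k, x k ∈ L.deg (s k) (d k)) → G ⟨l, hl⟩ x = 0)
      (fun l i j l' hP hl d x hx => by
        have hp : (l ++ i :: j :: l').Perm (l ++ j :: i :: l') :=
          List.Perm.append_left l (List.Perm.swap j i l')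
        have hl' : (l ++ i :: j :: l').Nodup ∧ ∀ i', i' ∈ l ++ i :: j :: l' :=
          ⟨hp.nodup_iff.2 hl.1, fun i' => hp.mem_iff.2 (hl.2 i')⟩
        rw [hG.1 ⟨_, hl'⟩ ⟨_, hl⟩ l l' i j rfl rfl x _ _ (hx i) (hx j), hP hl' d x hx, smul_zero])
      (enum_perm e e') (fun _ => h)
    exact this e'.2
  exact funext fun e' => L.eq_zero_of_homogeneous (hG.2.2 e') (hall e')

theorem EndOp_ext {G H : L.EndOp s c} (e : Enum I)
    (h : ∀ (d : I → ℤ) (x : ∀ k, L.X (s k)), (∀ k, x k ∈ L.deg (s k) (d k)) →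
      G.1 e x = H.1 e x) : G = H := by
  rw [← sub_eq_zero]
  refine Subtype.ext (L.EndOp_eq_zero (G - H).2 e fun d x hx => ?_)
  have := h d x hx
  rw [← sub_eq_zero] at this
  exact this

theorem EndOp_ext_of_isEmpty {G H : L.EndOp s c} (h : Enum I → G = H) : G = H := by
  by_cases hI : Nonempty (Enum I)
  · exact h hI.some
  · exact Subtype.ext (funext fun e => absurd ⟨e⟩ hI)

/-! ### The Koszul families of the trees -/

theorem ExtraOn.sum_smul {L : LagrangianBraneSpace K V} {l : List I} {D : Type*} (S : Finset D)
    (r : D → K) (h : D → (∀ k, L.X (s k)) → L.X c) (hh : ∀ d ∈ S, L.ExtraOn s l c (h d)) :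
    L.ExtraOn s l c fun y => ∑ d ∈ S, r d • h d y := by
  cases c
  · have : (fun y => ∑ d ∈ S, r d • h d y) = ∑ d ∈ S, r d • h d := by
      funext y
      rw [Finset.sum_apply]
      rfl
    rw [this]
    exact Submodule.sum_mem (L.pairsW s l) fun d hd => Submodule.smul_mem _ _ (hh d hd)
  · intro w
    have : (fun y => L.dualE (∑ d ∈ S, r d • h d y) w) =
        ∑ d ∈ S, r d • fun y => L.dualE (h d y) w := by
      funext y
      rw [map_sum, LinearMap.sum_apply, Finset.sum_apply]
      refine Finset.sum_congr rfl fun d _ => ?_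
      rw [map_smul]
      rfl
    rw [this]
    exact Submodule.sum_mem _ fun d hd => Submodule.smul_mem _ _ (hh d hd w)

variable (mul : L.Wpos →ₗ[K] L.Wpos →ₗ[K] L.Wpos) (comul : L.Wpos →ₗ[K] L.Wpos ⊗[K] L.Wpos)

/-- The family of multilinear maps given by a tree. -/
def fam (T : Tree s c) (h : T.Linear) : L.Family s c := fun e =>
  -- The sign makes sense for inputs of pure parity only. Each input is split into its even and odd
  -- part, and every choice `p` of parities gets its own sign relative to the order of the leaves.
  ∑ᶠ p : I → ZMod 2, ksgn K (inv e.1 T.leaves p) •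
    (T.evalM (L.op mul comul) h).compLinearMap fun k => L.ppart (p k) (s k)

theorem fam_apply [Fintype (I → ZMod 2)] (T : Tree s c) (h : T.Linear) (e : Enum I)
    (x : ∀ k, L.X (s k)) : L.fam mul comul T h e x = ∑ p : I → ZMod 2,
      ksgn K (inv e.1 T.leaves p) •
        T.eval (L.op mul comul) fun k => L.ppart (p k) (s k) (x k) := by
  rw [fam, finsum_eq_sum_of_fintype, sum_apply]
  rfl

theorem ppart_of_mem {p : ZMod 2} {x : L.X c} (hx : x ∈ L.cgr parity c p) : L.ppart p c x = x :=
  L.trunc_eq_self hx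

theorem ppart_of_mem_of_ne {p q : ZMod 2} {x : L.X c} (hx : x ∈ L.cgr parity c p) (hq : q ≠ p) :
    L.ppart q c x = 0 :=
  L.trunc_eq_zero hq hx

theorem eval_eq_zero (T : Tree s c) (h : T.Linear) {x : ∀ k, L.X (s k)} (k : I) (hx : x k = 0) :
    T.eval (L.op mul comul) x = 0 :=
  (T.evalM (L.op mul comul) h).map_coord_zero k hx

/-- Inputs of pure parity leave one choice of parities in the sum; for any other, some input is
projected to zero. -/
theorem fam_of_mem (T : Tree s c) (h : T.Linear) (e : Enum I) {p : I → ZMod 2}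
    {x : ∀ k, L.X (s k)} (hx : ∀ k, x k ∈ L.cgr parity (s k) (p k)) :
    L.fam mul comul T h e x = ksgn K (inv e.1 T.leaves p) • T.eval (L.op mul comul) x := by
  classical
  have := enum_finite e
  cases nonempty_fintype I
  rw [fam_apply, Finset.sum_eq_single p]
  · congr 2
    exact funext fun k => L.ppart_of_mem (hx k)
  · intro q _ hq
    obtain ⟨k, hk⟩ := Function.ne_iff.1 hq
    rw [L.eval_eq_zero mul comul T h k (L.ppart_of_mem_of_ne (hx k) hk), smul_zero]
  · simp

variable {mul comul} (hm : ∀ i j, ∀ x ∈ L.grPos i, ∀ y ∈ L.grPos j, mul x y ∈ L.grPos (i + j))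
  (hc : ∀ i, ∀ x ∈ L.grPos i, comul x ∈ grTensor L.grPos i)

theorem ppart_mem_deg {d : ℤ} {x : L.X c} (hx : x ∈ L.deg c d) (p : ZMod 2) :
    L.ppart p c x ∈ L.deg c d := by
  have h := L.deg_le_cgr parity c d hx
  by_cases hp : p = parity d
  · subst hp
    rwa [L.ppart_of_mem h]
  · rw [L.ppart_of_mem_of_ne h hp]
    exact zero_mem _

include hm hc in
-- The Koszul rule is `inv_swap`, applied to each choice of parities; degrees add up independently
-- of the ordering; and the dependence through tensors survives the projections by
-- `ExtraOn.comp_trunc`.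
theorem fam_mem_EndOp (T : Tree s c) (h : T.Linear) : L.fam mul comul T h ∈ L.EndOp s c := by
  classical
  refine ⟨fun e e' l l' i j he he' x a b hi hj => ?_, fun e d x hx => ?_, fun e => ?_⟩
  · have := enum_finite e
    cases nonempty_fintype I
    rw [fam_apply, fam_apply, negOnePow_smul (K := K), Finset.smul_sum]
    refine Finset.sum_congr rfl fun p _ => ?_
    have hi' := L.deg_le_cgr parity _ _ hi
    have hj' := L.deg_le_cgr parity _ _ hj
    by_cases hp : p i = parity a
    · by_cases hq : p j = parity b
      · have hn := e.2.1
        rw [he] at hn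
        rw [he', he, inv_swap hn h.1 (h.2 i) (h.2 j), ksgn_add, mul_smul, hp, hq, Int.cast_mul]
        rfl
      · rw [L.eval_eq_zero mul comul T h j (L.ppart_of_mem_of_ne hj' hq), smul_zero, smul_zero,
          smul_zero]
    · rw [L.eval_eq_zero mul comul T h i (L.ppart_of_mem_of_ne hi' hp), smul_zero, smul_zero,
        smul_zero]
  · have := enum_finite e
    cases nonempty_fintype I
    rw [fam_apply]
    refine sum_mem fun p _ => Submodule.smul_mem _ _ ?_
    have hp : (e.1.map d).Perm (T.leaves.map d) :=
      (enum_perm e ⟨T.leaves, h⟩).map d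
    rw [hp.sum_eq, deg_eq_cgr]
    refine L.eval_mem_cgr hm hc (AddMonoidHom.id ℤ) T d fun k => ?_
    rw [← deg_eq_cgr]
    exact L.ppart_mem_deg (hx k) (p k)
  · have := enum_finite e
    cases nonempty_fintype I
    rw [isExtra_iff]
    intro x
    simp only [fam_apply, ← merge_trunc]
    refine ExtraOn.sum_smul _ _ _ fun p _ => ?_
    exact ((L.extraOn_eval mul comul T h.1 fun k => L.ppart (p k) (s k) (x k)).perm
      (enum_perm ⟨T.leaves, h⟩ e)).comp_trunc fun k => (parity · = p k)

theorem fam_relabel {t : J → Dir} (σ : I ≃ J) (T : Tree (fun i => t (σ i)) c) (h : T.Linear)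
    (e : Enum I) (e' : Enum J) (he : e'.1 = e.1.map σ) (y : ∀ j, L.X (t j)) :
    L.fam mul comul (T.relabel σ) (h.relabel σ) e' y =
      L.fam mul comul T h e fun i => y (σ i) := by
  classical
  have := enum_finite e'
  refine L.parity_ext (f := L.fam mul comul (T.relabel σ) (h.relabel σ) e')
    (g := fun y => L.fam mul comul T h e fun i => y (σ i))
    (MultilinearMap.addInEach _) ⟨?_⟩ (fun p x hx => ?_) y
  · intro _ y j a b
    obtain ⟨i, rfl⟩ := σ.surjective j
    have he : ∀ a : L.X (t (σ i)), (fun i' => Function.update y (σ i) a (σ i')) =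
        Function.update (fun i => y (σ i)) i a := fun a =>
      Function.update_comp_eq_of_injective' y σ.injective i a
    have h1 := (L.fam mul comul T h e).map_update_add (fun i => y (σ i)) i a b
    simp only [← he] at h1
    exact h1
  · rw [L.fam_of_mem mul comul _ _ e' hx, L.fam_of_mem mul comul T h e fun i => hx (σ i), he,
      Tree.leaves_relabel, inv_map, Tree.eval_relabel]

theorem exists_map_some {l : List (Option I)} (h : none ∉ l) : ∃ a : List I, l = a.map some := by
  induction l with
  | nil => exact ⟨[], rfl⟩
  | cons o l ih =>
    rw [List.mem_cons, not_or] at h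
    obtain ⟨a, rfl⟩ := ih h.2
    cases o with
    | none => exact absurd rfl h.1
    | some i => exact ⟨i :: a, rfl⟩

theorem exists_split {l : List (Option I)} (hl : l.Nodup) (h : none ∈ l) :
    ∃ a b : List I, l = a.map some ++ none :: b.map some := by
  obtain ⟨l₁, l₂, rfl⟩ := List.append_of_mem h
  rw [List.nodup_append, List.nodup_cons] at hl
  obtain ⟨a, rfl⟩ := exists_map_some (l := l₁) fun h => hl.2.2 none h none (by simp) rfl
  obtain ⟨b, rfl⟩ := exists_map_some hl.2.1.1
  exact ⟨a, b, rfl⟩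

theorem leaves_graft {s : Option I → Dir} {t : J → Dir} (T : Tree s c) (T' : Tree t (s none))
    {a b : List I} (h : T.leaves = a.map some ++ none :: b.map some) :
    (T.graft T').leaves = a.map Sum.inl ++ T'.leaves.map Sum.inr ++ b.map Sum.inl := by
  rw [Tree.graft, Tree.leaves_bind, h]
  simp only [List.flatMap_append, List.flatMap_cons, List.flatMap_map, Tree.leaves_graftLeaf_none,
    Tree.leaves_graftLeaf_some]
  simp only [List.map_eq_flatMap, List.append_assoc]

theorem plug_update_inl [DecidableEq (Option I)] [DecidableEq (I ⊕ J)] {s : Option I → Dir} {t : J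
    → Dir}
    (z : ∀ k, L.X (Sum.elim (fun i => s (some i)) t k)) (v : L.X (s none)) (i : I)
    (a : L.X (s (some i))) :
    L.plug (Function.update z (Sum.inl i) a) v = Function.update (L.plug z v) (some i) a := by
  funext o
  rcases o with _ | i'
  · exact (Function.update_of_ne (by simp) _ _).symm
  · by_cases h : i' = i
    · subst h
      rw [Function.update_self]
      exact Function.update_self (Sum.inl i') a z
    · rw [Function.update_of_ne (by simpa using h)]
      exact Function.update_of_ne (a := Sum.inl i') (a' := Sum.inl i) (by simpa using h) a z

theorem plug_update_inr [DecidableEq (I ⊕ J)] {s : Option I → Dir} {t : J → Dir}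
    (z : ∀ k, L.X (Sum.elim (fun i => s (some i)) t k)) (v : L.X (s none)) (j : J)
    (a : L.X (t j)) :
    L.plug (Function.update z (Sum.inr j) a) v = L.plug z v := by
  funext o
  rcases o with _ | i'
  · rfl
  · exact Function.update_of_ne (a := Sum.inl i') (a' := Sum.inr j) (by simp) a z

/-- Exhibits the grafted input as one slot of the outer map, so that multilinearity applies to it.
-/
theorem plug_eq_update [DecidableEq I] {s : Option I → Dir} {t : J → Dir}
    (z : ∀ k, L.X (Sum.elim (fun i => s (some i)) t k)) (v v' : L.X (s none)) :
    L.plug z v = Function.update (L.plug z v') none v := by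
  funext o
  rcases o with _ | i'
  · rw [Function.update_self]
    rfl
  · rw [Function.update_of_ne (by simp)]
    rfl

theorem addInEach_plug {s : Option I → Dir} {t : J → Dir}
    (F : MultilinearMap K (fun o => L.X (s o)) (L.X c))
    (F' : MultilinearMap K (fun j => L.X (t j)) (L.X (s none))) :
    AddInEach fun z : ∀ k, L.X (Sum.elim (fun i => s (some i)) t k) =>
      F (L.plug z (F' fun j => z (Sum.inr j))) := by
  refine ⟨fun z k a b => ?_⟩
  classical
  rcases k with i | j
  · have hp : ∀ a : L.X (s (some i)), L.plug (Function.update z (Sum.inl i) a)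
        (F' fun j => Function.update z (Sum.inl i) a (Sum.inr j)) =
          Function.update (L.plug z (F' fun j => z (Sum.inr j))) (some i) a := fun a => by
      have h1 : (F' fun j => Function.update z (Sum.inl i) a (Sum.inr j)) =
          F' fun j => z (Sum.inr j) := congrArg F' <| funext fun j =>
        Function.update_of_ne (a := Sum.inr j) (a' := Sum.inl i) (by simp) a z
      rw [h1]
      exact L.plug_update_inl z _ i a
    change F _ = F _ + F _
    refine (congrArg F (hp (a + b))).trans ((F.map_update_add _ _ _ _).trans ?_)
    exact congrArg₂ (fun x y => F x + F y) (hp a).symm (hp b).symm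
  · have hp : ∀ a : L.X (t j), L.plug (Function.update z (Sum.inr j) a)
        (F' fun j' => Function.update z (Sum.inr j) a (Sum.inr j')) =
          L.plug z (F' (Function.update (fun j => z (Sum.inr j)) j a)) := fun a => by
      have h1 : (fun j' => Function.update z (Sum.inr j) a (Sum.inr j')) =
          Function.update (fun j => z (Sum.inr j)) j a :=
        Function.update_comp_eq_of_injective' z Sum.inr_injective j a
      refine Eq.trans ?_ (congrArg (fun w => L.plug z (F' w)) h1)
      exact plug_update_inr L z _ j a
    have h3 : ∀ v v', F (L.plug z (v + v')) = F (L.plug z v) + F (L.plug z v') := by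
      intro v v'
      rw [L.plug_eq_update z _ 0, L.plug_eq_update z v 0, L.plug_eq_update z v' 0]
      exact F.map_update_add _ _ _ _
    change F _ = F _ + F _
    refine (congrArg F (hp (a + b))).trans ?_
    refine (congrArg (fun v => F (L.plug z v)) (F'.map_update_add _ j a b)).trans ?_
    refine (h3 _ _).trans ?_
    exact congrArg₂ (fun x y => F x + F y) (hp a).symm (hp b).symm

include hm hc in
-- Both sides are additive in each input, so parities may be fixed. Then the evaluations agree by
-- `Tree.eval_graft` and the signs by `inv_graft`.
theorem fam_graft {s : Option I → Dir} {t : J → Dir} (T : Tree s c) (h : T.Linear)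
    (T' : Tree t (s none)) (h' : T'.Linear) (a b : List I) (e : Enum (Option I)) (e' : Enum J)
    (e'' : Enum (I ⊕ J)) (he : e.1 = a.map some ++ none :: b.map some)
    (he'' : e''.1 = a.map Sum.inl ++ e'.1.map Sum.inr ++ b.map Sum.inl)
    (z : ∀ k, L.X (Sum.elim (fun i => s (some i)) t k)) :
    L.fam mul comul (T.graft T') (h.graft h') e'' z =
      L.fam mul comul T h e (L.plug z (L.fam mul comul T' h' e' fun j => z (Sum.inr j))) := by
  classical
  have := enum_finite e''
  have : Finite I := Finite.of_injective (Sum.inl : I → I ⊕ J) Sum.inl_injective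
  have : Finite J := Finite.of_injective (Sum.inr : J → I ⊕ J) Sum.inr_injective
  cases nonempty_fintype I
  cases nonempty_fintype J
  refine L.parity_ext (MultilinearMap.addInEach _) (L.addInEach_plug _ _) (fun p x hx => ?_) z
  obtain ⟨a', b', hT⟩ := exists_split h.1 (h.2 none)
  rw [L.fam_of_mem mul comul T' h' e' (p := fun j => p (Sum.inr j)) fun j => hx (Sum.inr j)]
  have hsum : (T'.leaves.map fun j => p (Sum.inr j)).sum = ∑ j, p (Sum.inr j) := by
    rw [← List.sum_toFinset _ h'.1]
    refine Finset.sum_congr (Finset.ext fun j => ?_) fun _ _ => rfl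
    simp [h'.2 j]
  -- The inner value occupies the slot `none`; its parity must be the sum of the inner parities for
  -- `inv_graft` to apply.
  have hv : T'.eval (L.op mul comul) (fun j => x (Sum.inr j)) ∈
      L.cgr parity (s none) (∑ j, p (Sum.inr j)) := by
    rw [← hsum]
    exact L.eval_mem_cgr hm hc parity T' _ fun j => hx (Sum.inr j)
  rw [L.fam_of_mem mul comul (T.graft T') _ e'' hx,
    L.fam_of_mem mul comul T h e (p := fun o => o.elim (∑ j, p (Sum.inr j)) fun i => p (Sum.inl i))]
  · rw [he'', he, leaves_graft T T' hT, hT, inv_graft a b a' b' e'.1 T'.leaves e'.2.2 h'.2 p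
      (fun o => o.elim (∑ j, p (Sum.inr j)) fun i => p (Sum.inl i)) (fun _ => rfl) rfl, ksgn_add,
      mul_smul, Tree.eval_graft]
    congr 1
    have h3 := fun v => L.plug_eq_update x v 0
    rw [h3, h3 (_ • _)]
    exact ((T.evalM (L.op mul comul) h).map_update_smul _ _ _ _).symm
  · rintro (_ | i)
    · exact Submodule.smul_mem _ _ hv
    · exact hx (Sum.inl i)

end LagrangianBraneSpace

/-! ### Trees without extra directions -/

/-- Planar trees of corollas, without conditions on the extra directions. -/
inductive RawTree (I : Type) : Type
  | leaf (i : I) : RawTree I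
  | node (g : Gen) (l r : RawTree I) : RawTree I

namespace RawTree

variable {I J : Type}

/-- Substitution of a tree for every leaf. -/
def bind (f : I → RawTree J) : RawTree I → RawTree J
  | leaf i => f i
  | node g l r => node g (l.bind f) (r.bind f)

/-- Renaming of the labels. -/
abbrev map (f : I → J) (T : RawTree I) : RawTree J := T.bind fun i => leaf (f i)

/-- The labels of the inputs, from left to right. -/
def leaves : RawTree I → List I
  | leaf i => [i]
  | node _ l r => l.leaves ++ r.leaves

/-- The number of vertices. -/
def size : RawTree I → ℕ
  | leaf _ => 0
  | node _ l r => l.size + r.size + 1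

theorem leaves_map (f : I → J) (T : RawTree I) : (T.map f).leaves = T.leaves.map f := by
  induction T with
  | leaf i => rfl
  | node g l r hl hr =>
    change leaves (node g (l.map f) (r.map f)) = _
    rw [leaves, leaves, List.map_append, hl, hr]

theorem size_map (f : I → J) (T : RawTree I) : (T.map f).size = T.size := by
  induction T with
  | leaf i => rfl
  | node g l r hl hr =>
    change size (node g (l.map f) (r.map f)) = _
    rw [size, size, hl, hr]

theorem bind_bind {L : Type} (f : I → RawTree J) (f' : J → RawTree L) (T : RawTree I) :
    (T.bind f).bind f' = T.bind fun i => (f i).bind f' := by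
  induction T with
  | leaf i => rfl
  | node g l r hl hr => simp only [bind, hl, hr]

theorem map_map {L : Type} (f : I → J) (f' : J → L) (T : RawTree I) :
    (T.map f).map f' = T.map (f' ∘ f) := bind_bind _ _ T

end RawTree

namespace Tree

variable {I J : Type} {s : I → Dir} {t : J → Dir} {c : Dir}

/-- The tree without the extra directions. -/
def raw : {c : Dir} → Tree s c → RawTree I
  | _, leaf i => .leaf i
  | _, node g l r => .node g l.raw r.raw

theorem raw_leaves (T : Tree s c) : T.raw.leaves = T.leaves := by
  induction T with
  | leaf i => rfl
  | node g l r hl hr => rw [raw, RawTree.leaves, leaves, hl, hr]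

theorem raw_bind (f : ∀ i, Tree t (s i)) (T : Tree s c) :
    (T.bind f).raw = T.raw.bind fun i => (f i).raw := by
  induction T with
  | leaf i => rfl
  | node g l r hl hr => simp only [bind, raw, RawTree.bind, hl, hr]

/-- The root corolla, or the label of a leaf, already dictates the direction of the root edge, so
the index can be recovered together with the tree. -/
theorem eq_and_heq_of_raw {c c' : Dir} (T : Tree s c) (T' : Tree s c') (h : T.raw = T'.raw) :
    c = c' ∧ HEq T T' := by
  induction T generalizing c' with
  | leaf i =>
    cases T' with
    | leaf j =>
      obtain rfl : i = j := by simpa [raw] using h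
      exact ⟨rfl, HEq.rfl⟩
    | node g l r => simp [raw] at h
  | node g l r hl hr =>
    cases T' with
    | leaf j => simp [raw] at h
    | node g' l' r' =>
      simp only [raw, RawTree.node.injEq] at h
      obtain ⟨rfl, h1, h2⟩ := h
      obtain rfl := eq_of_heq (hl l' h1).2
      obtain rfl := eq_of_heq (hr r' h2).2
      exact ⟨rfl, HEq.rfl⟩

/-- Trees over relabelled or regrouped labels can thus be compared without transporting along
equalities of directions. -/
theorem raw_injective : Function.Injective (raw : Tree s c → RawTree I) :=
  fun T T' h => eq_of_heq (eq_and_heq_of_raw T T' h).2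

theorem raw_relabel (σ : I ≃ J) (T : Tree (fun i => t (σ i)) c) :
    (T.relabel σ).raw = T.raw.map σ := raw_bind _ T

theorem raw_graft {s : Option I → Dir} (T : Tree s c) (T' : Tree t (s none)) :
    (T.graft T').raw =
      T.raw.bind fun o => o.elim (T'.raw.map Sum.inr) fun i => .leaf (Sum.inl i) := by
  refine (raw_bind _ T).trans ?_
  congr 1
  funext o
  cases o with
  | none => exact raw_bind (t := Sum.elim (fun i => s (some i)) t) _ T'
  | some i => rfl

theorem raw_cast {c' : Dir} (h : c = c') (T : Tree s c) : (h ▸ T : Tree s c').raw = T.raw := by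
  subst h
  rfl

/-- Renaming of the labels along a map that respects the extra directions. -/
def mapLeaves (f : I → J) (hs : ∀ i, s i = t (f i)) (T : Tree s c) : Tree t c :=
  T.bind fun i => (hs i).symm ▸ leaf (f i)

theorem raw_mapLeaves (f : I → J) (hs : ∀ i, s i = t (f i)) (T : Tree s c) :
    (T.mapLeaves f hs).raw = T.raw.map f := by
  rw [mapLeaves, raw_bind]
  congr 1
  funext i
  exact raw_cast (hs i).symm (leaf (f i))

theorem Linear.of_raw {T : Tree s c} (h : T.Linear) {c' : Dir} {T' : Tree t c'} (σ : I ≃ J)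
    (hr : T'.raw = T.raw.map σ) : T'.Linear := by
  have e : T'.leaves = T.leaves.map σ := by
    rw [← raw_leaves, hr, RawTree.leaves_map, raw_leaves]
  rw [Linear, e]
  exact ⟨h.1.map σ.injective, fun j => List.mem_map.2 ⟨σ.symm j, h.2 _, by simp⟩⟩

theorem exists_restrict (T : Tree s c) (p : I → Prop) (h : ∀ i ∈ T.leaves, p i) :
    ∃ T' : Tree (fun i : Subtype p => s i) c, T'.raw.map Subtype.val = T.raw := by
  induction T with
  | leaf i => exact ⟨leaf (s := fun i : Subtype p => s i) ⟨i, h i (by simp [leaves])⟩, rfl⟩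
  | node g l r hl hr =>
    obtain ⟨l', hl'⟩ := hl fun i hi => h i (by simp [leaves, hi])
    obtain ⟨r', hr'⟩ := hr fun i hi => h i (by simp [leaves, hi])
    refine ⟨node g l' r', ?_⟩
    exact congrArg₂ (RawTree.node g) hl' hr'

/-- A proper subtree does not use every label, hence is not linear over `I`. Over the set of its own
labels it is, and induction can proceed. -/
theorem exists_linear_restrict (T : Tree s c) (h : T.leaves.Nodup) :
    ∃ T' : Tree (fun i : {i // i ∈ T.leaves} => s i) c,
      T'.Linear ∧ T'.raw.map Subtype.val = T.raw := by
  obtain ⟨T', hT'⟩ := T.exists_restrict (· ∈ T.leaves) fun _ => id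
  have e : T'.leaves.map Subtype.val = T.leaves := by
    rw [← T'.raw_leaves, ← RawTree.leaves_map, hT', raw_leaves]
  refine ⟨T', ⟨?_, fun i => ?_⟩, hT'⟩
  · rw [← e] at h
    exact h.of_map
  · have hi : (i : I) ∈ T.leaves := i.2
    replace hi : (i : I) ∈ T'.leaves.map Subtype.val := by simpa only [e] using hi
    obtain ⟨j, hj, hij⟩ := List.mem_map.1 hi
    rwa [← Subtype.ext hij]

end Tree

/-! ### Morphisms from the free 2-oriented operad -/

section FreeMor

variable {K V : Type u} [Field K] [AddCommGroup V] [Module K V]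

/-- A morphism from the free 2-oriented operad to the endomorphism operad. -/
structure FreeMor (B : BraneSpace K V) where
  /-- the components of the morphism -/
  toFun : ∀ {I : Type} (s : I → Dir) (c : Dir), Fr K s c →ₗ[K] B.EndOp s c
  map_unit : ∀ (c : Dir) (e : Enum Unit) (x : Unit → B.X c),
    (toFun (fun _ => c) c (Fr.unit K c)).1 e x = x ()
  map_relabel : ∀ {I J : Type} (t : J → Dir) (c : Dir) (σ : I ≃ J) (x : Fr K (fun i => t (σ i)) c)
    (e : Enum I) (e' : Enum J), e'.1 = e.1.map σ → ∀ y : ∀ j, B.X (t j),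
      (toFun t c (Fr.relabel K t c σ x)).1 e' y =
        (toFun (fun i => t (σ i)) c x).1 e fun i => y (σ i)
  map_graft : ∀ {I J : Type} (s : Option I → Dir) (t : J → Dir) (c : Dir) (x : Fr K s c)
    (y : Fr K t (s none)) (a b : List I) (e : Enum (Option I)) (e' : Enum J) (e'' : Enum (I ⊕ J)),
    e.1 = a.map some ++ none :: b.map some →
    e''.1 = a.map Sum.inl ++ e'.1.map Sum.inr ++ b.map Sum.inl →
    ∀ z : ∀ k, B.X (Sum.elim (fun i => s (some i)) t k),
      (toFun _ c (Fr.graft K s t c x y)).1 e'' z =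
        (toFun s c x).1 e (B.plug z ((toFun t (s none) y).1 e' fun j => z (Sum.inr j)))

/-- A representation as a morphism from the free operad. -/
def Rep.free {B : BraneSpace K V} {R : Relations K} (ρ : Rep K V B R) : FreeMor B where
  toFun s c := ρ.toEnd s c ∘ₗ (ideal K R s c).mkQ
  map_unit := ρ.map_unit
  map_relabel := ρ.map_relabel
  map_graft := ρ.map_graft

theorem Rep.ext_free {B : BraneSpace K V} {R : Relations K} {ρ ρ' : Rep K V B R}
    (h : ∀ (I : Type) (s : I → Dir) (c : Dir) (x : Fr K s c),
      ρ.free.toFun s c x = ρ'.free.toFun s c x) : ρ = ρ' := by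
  have e : @ρ.toEnd = @ρ'.toEnd := by
    funext I s c
    exact Submodule.linearMap_qext _ (LinearMap.ext (h I s c))
  cases ρ
  cases ρ'
  cases e
  rfl

theorem Fr.graft_tree {I J : Type} {s : Option I → Dir} {t : J → Dir} {c : Dir} (T : Tree s c)
    (h : T.Linear) (T' : Tree t (s none)) (h' : T'.Linear) :
    Fr.graft K s t c (Fr.tree K T h) (Fr.tree K T' h') = Fr.tree K (T.graft T') (h.graft h') := by
  rw [Fr.graft, Fr.tree, Fr.tree, Finsupp.linearCombination_single, one_smul,
    Finsupp.lmapDomain_apply, Finsupp.mapDomain_single]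
  rfl

theorem Fr.relabel_tree {I J : Type} {t : J → Dir} {c : Dir} (σ : I ≃ J)
    (T : Tree (fun i => t (σ i)) c) (h : T.Linear) :
    Fr.relabel K t c σ (Fr.tree K T h) = Fr.tree K (T.relabel σ) (h.relabel σ) := by
  rw [Fr.relabel, Fr.tree, Finsupp.lmapDomain_apply, Finsupp.mapDomain_single]
  rfl

namespace FreeMor

variable {L : LagrangianBraneSpace K V} (φ φ' : FreeMor L.toBraneSpace)

/-- Agreement of two morphisms on a tree. -/
def Agree {I : Type} {s : I → Dir} {c : Dir} (T : Tree s c) : Prop :=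
  ∃ h : T.Linear, φ.toFun s c (Fr.tree K T h) = φ'.toFun s c (Fr.tree K T h)

variable {φ φ'} {I J : Type} {s : I → Dir} {t : J → Dir} {c : Dir}

/-- Two trees with the same underlying tree up to a bijection of labels differ by `relabel`, with
which both morphisms commute. -/
theorem Agree.of_raw {T : Tree s c} (h : Agree φ φ' T) {T' : Tree t c} (σ : I ≃ J)
    (hs : ∀ i, s i = t (σ i)) (hr : T'.raw = T.raw.map σ) : Agree φ φ' T' := by
  obtain rfl : s = fun i => t (σ i) := funext hs
  obtain rfl : T' = T.relabel σ := Tree.raw_injective (by rw [hr, Tree.raw_relabel])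
  obtain ⟨h, hT⟩ := h
  refine ⟨h.relabel σ, ?_⟩
  have e : (T.leaves.map σ).Nodup ∧ ∀ j, j ∈ T.leaves.map σ := by
    rw [← Tree.leaves_relabel]
    exact h.relabel σ
  refine L.EndOp_ext ⟨T.leaves.map σ, e⟩ fun d y _ => ?_
  rw [← Fr.relabel_tree, φ.map_relabel t c σ _ ⟨T.leaves, h⟩ ⟨T.leaves.map σ, e⟩ rfl,
    φ'.map_relabel t c σ _ ⟨T.leaves, h⟩ ⟨T.leaves.map σ, e⟩ rfl, hT]

theorem Agree.graft {s : Option I → Dir} {T : Tree s c} (hT : Agree φ φ' T) {T' : Tree t (s none)}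
    (hT' : Agree φ φ' T') : Agree φ φ' (T.graft T') := by
  obtain ⟨h, hT⟩ := hT
  obtain ⟨h', hT'⟩ := hT'
  refine ⟨h.graft h', ?_⟩
  obtain ⟨a, b, hab⟩ := LagrangianBraneSpace.exists_split h.1 (h.2 none)
  refine L.EndOp_ext ⟨(T.graft T').leaves, h.graft h'⟩ fun d z _ => ?_
  have hl := LagrangianBraneSpace.leaves_graft T T' hab
  rw [← Fr.graft_tree T h T' h']
  refine (φ.map_graft s t c _ _ a b ⟨T.leaves, h⟩ ⟨T'.leaves, h'⟩ _ hab hl z).trans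
    (Eq.trans ?_ (φ'.map_graft s t c _ _ a b ⟨T.leaves, h⟩ ⟨T'.leaves, h'⟩ _ hab hl z).symm)
  rw [hT, hT']

/-- Linearity forces a single label, so the leaf is the operadic unit up to renaming. -/
theorem agree_leaf (i : I) (h : (Tree.leaf (s := s) i).Linear) :
    Agree φ φ' (Tree.leaf (s := s) i) := by
  have hu : Agree φ φ' (Tree.leaf (s := fun _ : Unit => s i) ()) :=
    ⟨⟨by simp [Tree.leaves], by simp [Tree.leaves]⟩,
      L.EndOp_ext ⟨[()], by simp, by simp⟩ fun d x _ =>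
        (φ.map_unit (s i) _ x).trans (φ'.map_unit (s i) _ x).symm⟩
  have hI : ∀ j, j = i := fun j => by simpa [Tree.leaves] using h.2 j
  exact hu.of_raw ⟨fun _ => i, fun _ => (), fun _ => rfl, fun j => (hI j).symm⟩ (fun _ => rfl) rfl

/-- The tree is a corolla with `r` grafted into its right input and then `l` into its left. Grafting
always happens at `none`, so the labels are renamed in between. -/
theorem agree_node (hg : ∀ g : Gen, Agree φ φ' (genTree g)) (g : Gen) {s : I → Dir} {t : J → Dir}
    {l : Tree s g.inL} {r : Tree t g.inR} (hl : Agree φ φ' l) (hr : Agree φ φ' r) :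
    Agree φ φ' (Tree.node g (l.mapLeaves (t := Sum.elim t s) Sum.inr fun _ => rfl)
      (r.mapLeaves (t := Sum.elim t s) Sum.inl fun _ => rfl)) := by
  -- The corolla with its right input named `none`, ready to receive `r`.
  let s₁ : Option Unit → Dir := fun o => o.elim g.inR fun _ => g.inL
  let T₁ : Tree s₁ g.out := .node g (.leaf (s := s₁) (some ())) (.leaf (s := s₁) none)
  have h₁ : Agree φ φ' T₁ := by
    refine (hg g).of_raw ⟨![some (), none], fun o => o.elim 1 fun _ => 0, ?_, ?_⟩ ?_ rfl
    · intro i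
      fin_cases i <;> rfl
    · rintro (_ | _) <;> rfl
    · intro i
      fin_cases i <;> rfl
  -- After `r` is in place the free left input takes over the name `none`.
  let s₃ : Option J → Dir := fun o => o.elim g.inL t
  let T₃ : Tree s₃ g.out :=
    .node g (.leaf (s := s₃) none) (r.mapLeaves (t := s₃) some fun _ => rfl)
  have h₃ : Agree φ φ' T₃ := by
    refine (h₁.graft hr).of_raw ⟨Sum.elim (fun _ => none) some, fun o => o.elim (Sum.inl ())
        Sum.inr,
      ?_, ?_⟩ ?_ ?_
    · rintro (_ | _) <;> rfl
    · rintro (_ | _) <;> rfl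
    · rintro (_ | _) <;> rfl
    · refine Eq.trans ?_ (congrArg (RawTree.map _) (Tree.raw_graft (t := t) T₁ r).symm)
      refine congrArg (RawTree.node g _) ((Tree.raw_mapLeaves _ _ r).trans ?_)
      exact (RawTree.map_map Sum.inr (Sum.elim (fun _ => none) some : Unit ⊕ J → Option J)
        r.raw).symm
  refine (h₃.graft hl).of_raw (Equiv.refl _) (fun k => ?_) ?_
  · rcases k with _ | _ <;> rfl
  · refine Eq.trans ?_ (congrArg (RawTree.map _) (Tree.raw_graft (t := s) T₃ l).symm)
    refine congrArg₂ (RawTree.node g) ((Tree.raw_mapLeaves _ _ l).trans ?_)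
      ((Tree.raw_mapLeaves _ _ r).trans ?_)
    · exact (RawTree.map_map Sum.inr (Equiv.refl (J ⊕ I)) l.raw).symm
    · refine Eq.trans ?_ (congrArg (fun T => (RawTree.bind _ T).map _)
        (Tree.raw_mapLeaves (t := s₃) some (fun _ => rfl) r).symm)
      simp only [RawTree.map, RawTree.bind_bind]
      rfl

/-- The induction is on the number of vertices because the subtrees have to be moved to smaller
label types. -/
theorem agree_of_linear (hg : ∀ g : Gen, Agree φ φ' (genTree g)) (n : ℕ) :
    ∀ {I : Type} {s : I → Dir} {c : Dir} (T : Tree s c), T.Linear → T.raw.size ≤ n →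
      Agree φ φ' T := by
  induction n with
  | zero =>
    intro I s c T h hn
    cases T with
    | leaf i => exact agree_leaf i h
    | node g l r => simp [Tree.raw, RawTree.size] at hn
  | succ n ih =>
    intro I s c T h hn
    cases T with
    | leaf i => exact agree_leaf i h
    | node g l r =>
      have hd := List.nodup_append.1 (show (l.leaves ++ r.leaves).Nodup from h.1)
      obtain ⟨l', hl', el⟩ := l.exists_linear_restrict hd.1
      obtain ⟨r', hr', er⟩ := r.exists_linear_restrict hd.2.1
      have hsz : l.raw.size + r.raw.size + 1 ≤ n + 1 := hn
      have al : Agree φ φ' l' := ih l' hl' (by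
        rw [← RawTree.size_map Subtype.val l'.raw, el]
        omega)
      have ar : Agree φ φ' r' := ih r' hr' (by
        rw [← RawTree.size_map Subtype.val r'.raw, er]
        omega)
      let f : {i // i ∈ r.leaves} ⊕ {i // i ∈ l.leaves} → I := Sum.elim Subtype.val Subtype.val
      have hf : Function.Bijective f := by
        constructor
        · rintro (⟨i, hi⟩ | ⟨i, hi⟩) (⟨j, hj⟩ | ⟨j, hj⟩) (hij : i = j)
          · subst hij
            rfl
          · exact absurd hij.symm (hd.2.2 j hj i hi)
          · exact absurd hij (hd.2.2 i hi j hj)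
          · subst hij
            rfl
        · intro i
          rcases List.mem_append.1 (show i ∈ l.leaves ++ r.leaves from h.2 i) with hi | hi
          · exact ⟨Sum.inr ⟨i, hi⟩, rfl⟩
          · exact ⟨Sum.inl ⟨i, hi⟩, rfl⟩
      refine (agree_node hg g al ar).of_raw (Equiv.ofBijective f hf) ?_ ?_
      · rintro (_ | _) <;> rfl
      · refine congrArg₂ (RawTree.node g) (el.symm.trans ?_) (er.symm.trans ?_)
        · refine Eq.trans ?_ (congrArg (RawTree.map _) (Tree.raw_mapLeaves _ _ l').symm)
          exact (RawTree.map_map Sum.inr f l'.raw).symm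
        · refine Eq.trans ?_ (congrArg (RawTree.map _) (Tree.raw_mapLeaves _ _ r').symm)
          exact (RawTree.map_map Sum.inl f r'.raw).symm

/-- A morphism from the free operad is determined by its values on the generators. -/
theorem eq_of_gen (h : ∀ g, (φ.toFun _ _ (Fr.tree K (genTree g) (genTree_linear g))).1 Rep.ord =
    (φ'.toFun _ _ (Fr.tree K (genTree g) (genTree_linear g))).1 Rep.ord) {I : Type} (s : I → Dir)
    (c : Dir) (x : Fr K s c) : φ.toFun s c x = φ'.toFun s c x := by
  have hg : ∀ g : Gen, Agree φ φ' (genTree g) := fun g =>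
    ⟨genTree_linear g, L.EndOp_ext Rep.ord fun d x _ => by rw [h g]⟩
  refine LinearMap.congr_fun (Finsupp.lhom_ext' fun T => LinearMap.ext_ring ?_) x
  obtain ⟨_, hT⟩ := agree_of_linear hg _ T.1 T.2 le_rfl
  exact hT

/-- Composition is only prescribed for orderings with the inner labels in one block. Here the block
is put last; one such ordering is enough by `EndOp_ext`. -/
theorem exists_graft_enum (e : Enum (I ⊕ J)) :
    ∃ (a : List I) (e₁ : Enum (Option I)) (e₂ : Enum J) (e₃ : Enum (I ⊕ J)),
      e₁.1 = a.map some ++ none :: ([] : List I).map some ∧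
      e₃.1 = a.map Sum.inl ++ e₂.1.map Sum.inr ++ ([] : List I).map Sum.inl := by
  classical
  have := enum_finite e
  have : Finite I := Finite.of_injective (Sum.inl : I → I ⊕ J) Sum.inl_injective
  have : Finite J := Finite.of_injective (Sum.inr : J → I ⊕ J) Sum.inr_injective
  cases nonempty_fintype I
  cases nonempty_fintype J
  have h1 := (Finset.univ : Finset I).nodup_toList
  have h2 := (Finset.univ : Finset J).nodup_toList
  refine ⟨Finset.univ.toList, ⟨Finset.univ.toList.map some ++ [none], ?_, ?_⟩,
    ⟨Finset.univ.toList, h2, by simp⟩,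
    ⟨Finset.univ.toList.map Sum.inl ++ Finset.univ.toList.map Sum.inr, ?_, ?_⟩, by simp, by simp⟩
  · rw [List.nodup_append]
    exact ⟨h1.map (Option.some_injective I), by simp, by simp⟩
  · rintro (_ | _) <;> simp
  · rw [List.nodup_append]
    exact ⟨h1.map Sum.inl_injective, h2.map Sum.inr_injective, by simp⟩
  · rintro (_ | _) <;> simp

/-- The kernel of a morphism is stable under relabelling and under grafting from either side, the
latter because a multilinear map vanishes when one input does. -/
theorem eq_zero_of_inIdeal (φ : FreeMor L.toBraneSpace) {R : Relations K}
    (h : ∀ I s c x, R I s c x → φ.toFun s c x = 0) {I : Type} {s : I → Dir} {c : Dir}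
    {x : Fr K s c} (hx : InIdeal K R s c x) : φ.toFun s c x = 0 := by
  have hz : ∀ {I : Type} {s : I → Dir} {c : Dir} {G : L.EndOp s c} (e : Enum I)
      (y : ∀ i, L.X (s i)), G = 0 → G.1 e y = 0 := by
    rintro I s c _ e y rfl
    rfl
  induction hx with
  | rel x h' => exact h _ _ _ x h'
  | zero => exact map_zero _
  | add x y _ _ hx hy => rw [map_add, hx, hy, add_zero]
  | smul a x _ hx => rw [map_smul, hx, smul_zero]
  | relabel σ x _ hx =>
    refine L.EndOp_ext_of_isEmpty fun e => L.EndOp_ext e fun d y _ => ?_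
    refine (φ.map_relabel _ _ σ x ⟨e.1.map σ.symm, e.2.1.map σ.symm.injective, fun i =>
      List.mem_map.2 ⟨σ i, e.2.2 _, by simp⟩⟩ e (by simp [Function.comp_def]) y).trans (hz _ _ hx)
  | @graftLeft I J s t c x y _ hx =>
    refine L.EndOp_ext_of_isEmpty fun e => ?_
    obtain ⟨a, e₁, e₂, e₃, h₁, h₃⟩ := exists_graft_enum e
    refine L.EndOp_ext e₃ fun d z _ => ?_
    exact (φ.map_graft s t c x y a [] e₁ e₂ e₃ h₁ h₃ z).trans (hz e₁ _ hx)
  | @graftRight I J s t c x y _ hy =>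
    refine L.EndOp_ext_of_isEmpty fun e => ?_
    obtain ⟨a, e₁, e₂, e₃, h₁, h₃⟩ := exists_graft_enum e
    refine L.EndOp_ext e₃ fun d z _ => ?_
    refine (φ.map_graft s t c x y a [] e₁ e₂ e₃ h₁ h₃ z).trans ?_
    exact ((φ.toFun s c x).1 e₁).map_coord_zero none (hz e₂ _ hy)

/-- A morphism that vanishes on the relations as a representation. -/
def toRep (φ : FreeMor L.toBraneSpace) {R : Relations K}
    (h : ∀ I s c x, R I s c x → φ.toFun s c x = 0) : Rep K V L.toBraneSpace R where
  toEnd s c := (ideal K R s c).liftQ (φ.toFun s c) fun _ hx => φ.eq_zero_of_inIdeal h hx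
  map_unit := φ.map_unit
  map_relabel := φ.map_relabel
  map_graft := φ.map_graft

end FreeMor

end FreeMor

/-! ### Koszul permutations and homogeneous functionals -/

section Koszul

variable {K W : Type u} [Field K] [AddCommGroup W] [Module K W] {gr : ℤ → Submodule K W}
  (h : DirectSum.IsInternal gr)

include h in
theorem tensor_linearMap_ext {M : Type*} [AddCommGroup M] [Module K M] {f g : W ⊗[K] W →ₗ[K] M}
    (hfg : ∀ i j, ∀ x ∈ gr i, ∀ y ∈ gr j, f (x ⊗ₜ y) = g (x ⊗ₜ y)) : f = g := by
  refine TensorProduct.ext (gr_linearMap_ext h fun i x hx => gr_linearMap_ext h fun j y hy => ?_)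
  exact hfg i j x hx y hy

include h in
theorem tensor_linearMap_ext₃ {M : Type*} [AddCommGroup M] [Module K M]
    {f g : (W ⊗[K] W) ⊗[K] W →ₗ[K] M}
    (hfg : ∀ i j k, ∀ x ∈ gr i, ∀ y ∈ gr j, ∀ z ∈ gr k,
      f ((x ⊗ₜ y) ⊗ₜ z) = g ((x ⊗ₜ y) ⊗ₜ z)) : f = g := by
  refine TensorProduct.ext (tensor_linearMap_ext h fun i j x hx y hy =>
    gr_linearMap_ext h fun k z hz => ?_)
  exact hfg i j k x hx y hy z hz

theorem koszulSwap_tmul' {i j : ℤ} {x y : W} (hx : x ∈ gr i) (hy : y ∈ gr j) :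
    koszulSwap h (x ⊗ₜ y) = ksgn K ((i : ZMod 2) * j) • (y ⊗ₜ[K] x) := by
  rw [koszulSwap_tmul h hx hy, negOnePow_smul (K := K), Int.cast_mul]

theorem koszulCyc_tmul {i j k : ℤ} {x y z : W} (hx : x ∈ gr i) (hy : y ∈ gr j) (hz : z ∈ gr k) :
    koszulCyc h ((x ⊗ₜ y) ⊗ₜ z) =
      ksgn K ((j : ZMod 2) * k + i * k) • ((z ⊗ₜ[K] x) ⊗ₜ[K] y) := by
  rw [koszulCyc]
  simp only [LinearMap.comp_apply, LinearEquiv.coe_coe, TensorProduct.assoc_tmul,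
    LinearMap.lTensor_tmul, koszulSwap_tmul' h hy hz, TensorProduct.tmul_smul, map_smul,
    TensorProduct.assoc_symm_tmul, LinearMap.rTensor_tmul, koszulSwap_tmul' h hx hz,
    ← TensorProduct.smul_tmul', smul_smul, ksgn_add]

/-- Moving `z` past both factors costs a sign depending only on their total degree. -/
theorem koszulCyc_grTensor {i j : ℤ} {s : W ⊗[K] W} {z : W} (hs : s ∈ grTensor gr i)
    (hz : z ∈ gr j) : koszulCyc h (s ⊗ₜ z) =
      ksgn K ((i : ZMod 2) * j) • (TensorProduct.assoc K W W W).symm (z ⊗ₜ s) := by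
  let f : W ⊗[K] W →ₗ[K] (W ⊗[K] W) ⊗[K] W := koszulCyc h ∘ₗ (TensorProduct.mk K _ W).flip z
  let g : W ⊗[K] W →ₗ[K] (W ⊗[K] W) ⊗[K] W := ksgn K ((i : ZMod 2) * j) •
    (TensorProduct.assoc K W W W).symm.toLinearMap ∘ₗ TensorProduct.mk K W _ z
  have : grTensor gr i ≤ LinearMap.eqLocus f g := by
    refine iSup_le fun k => Submodule.map₂_le.2 fun x hx y hy => ?_
    change koszulCyc h ((x ⊗ₜ y) ⊗ₜ z) = ksgn K ((i : ZMod 2) * j) •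
      (TensorProduct.assoc K W W W).symm (z ⊗ₜ (x ⊗ₜ y))
    rw [koszulCyc_tmul h hx hy hz, TensorProduct.assoc_symm_tmul]
    congr 2
    push_cast
    ring
  exact this hs

/-- A coproduct of degree `0` gives its two factors together the degree of the argument, so rotating
after splitting the first factor equals splitting the second factor after a swap. -/
theorem koszulCyc_rTensor {co : W →ₗ[K] W ⊗[K] W} (hc : ∀ i, ∀ x ∈ gr i, co x ∈ grTensor gr i)
    (t : W ⊗[K] W) : koszulCyc h (co.rTensor W t) =
      (TensorProduct.assoc K W W W).symm (co.lTensor W (koszulSwap h t)) := by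
  refine LinearMap.congr_fun (f := koszulCyc h ∘ₗ co.rTensor W)
    (g := (TensorProduct.assoc K W W W).symm.toLinearMap ∘ₗ co.lTensor W ∘ₗ
      (koszulSwap h).toLinearMap) (tensor_linearMap_ext h fun i j x hx y hy => ?_) t
  simp only [LinearMap.comp_apply, LinearEquiv.coe_coe, LinearMap.rTensor_tmul,
    koszulSwap_tmul' h hx hy, map_smul, LinearMap.lTensor_tmul, koszulCyc_grTensor h (hc i x hx) hy]

variable (gr) in
/-- A functional of degree `a`, supported in degree `-a`. -/
def IsHomFun (a : ℤ) (α : Module.Dual K W) : Prop := ∀ i, i ≠ -a → ∀ w ∈ gr i, α w = 0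

/-- Unless `w` has degree `-a` both sides vanish, and `-a` and `a` have the same parity. Signs in
degrees of vectors thereby become signs in degrees of functionals, which no longer depend on the
tensor. -/
theorem IsHomFun.ksgn_smul {a : ℤ} {α : Module.Dual K W} (hα : IsHomFun gr a α) {i : ℤ} {w : W}
    (hw : w ∈ gr i) (b : ZMod 2) {M : Type*} [AddCommGroup M] [Module K M] (m : M) :
    ksgn K ((i : ZMod 2) * b) • α w • m = ksgn K ((a : ZMod 2) * b) • α w • m := by
  by_cases hi : i = -a
  · subst hi
    rw [Int.cast_neg, ZMod.neg_eq_self_mod_two]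
  · rw [hα i hi w hw, zero_smul, smul_zero, smul_zero]

theorem pairing_koszulSwap {a b : ℤ} {α β : Module.Dual K W} (hα : IsHomFun gr a α)
    (hβ : IsHomFun gr b β) (t : W ⊗[K] W) :
    β (contr α (koszulSwap h t)) = ksgn K ((a : ZMod 2) * b) • α (contr β t) := by
  refine LinearMap.congr_fun (f := β ∘ₗ contr α ∘ₗ (koszulSwap h).toLinearMap)
    (g := ksgn K ((a : ZMod 2) * b) • α ∘ₗ contr β)
    (tensor_linearMap_ext h fun i j x hx y hy => ?_) t
  simp only [LinearMap.comp_apply, LinearEquiv.coe_coe, LinearMap.smul_apply,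
    koszulSwap_tmul' h hx hy, map_smul, contr_tmul]
  rw [hα.ksgn_smul hx, mul_comm, smul_eq_mul (α x), mul_comm (α x), ← smul_eq_mul (β y),
    hβ.ksgn_smul hy, mul_comm]

/-- Swapping the first two factors and rotating twice takes `x ⊗ y ⊗ z` to `x ⊗ z ⊗ y` up to sign,
which exchanges the roles of the two functionals. -/
theorem contr_contr_koszulCyc {a b : ℤ} {α β : Module.Dual K W} (hα : IsHomFun gr a α)
    (hβ : IsHomFun gr b β) (r : (W ⊗[K] W) ⊗[K] W) :
    contr β (contr α (koszulCyc h (koszulCyc h ((koszulSwap h).toLinearMap.rTensor W r)))) =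
      ksgn K ((a : ZMod 2) * b) • contr α (contr β r) := by
  refine LinearMap.congr_fun (f := contr β ∘ₗ contr α ∘ₗ koszulCyc h ∘ₗ koszulCyc h ∘ₗ
      (koszulSwap h).toLinearMap.rTensor W)
    (g := ksgn K ((a : ZMod 2) * b) • contr α ∘ₗ contr β)
    (tensor_linearMap_ext₃ h fun i j k x hx y hy z hz => ?_) r
  simp only [LinearMap.comp_apply, LinearEquiv.coe_coe, LinearMap.smul_apply,
    LinearMap.rTensor_tmul, koszulSwap_tmul' h hx hy, map_smul, contr_tmul,
    ← TensorProduct.smul_tmul', koszulCyc_tmul h hy hx hz, koszulCyc_tmul h hz hy hx]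
  have e : (i : ZMod 2) * j + (i * k + j * k + (j * i + k * i)) = j * k := by
    generalize (i : ZMod 2) = i
    generalize (j : ZMod 2) = j
    generalize (k : ZMod 2) = k
    decide +revert
  rw [smul_smul, smul_smul, ← ksgn_add, ← ksgn_add, add_assoc, e, hα.ksgn_smul hy, mul_comm,
    smul_comm (α y), hβ.ksgn_smul hz, mul_comm]

theorem contr_contr_koszulCyc_of_skew {a b : ℤ} {α β : Module.Dual K W} (hα : IsHomFun gr a α)
    (hβ : IsHomFun gr b β) {r : (W ⊗[K] W) ⊗[K] W}
    (hr : (koszulSwap h).toLinearMap.rTensor W r = -r) :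
    contr β (contr α (koszulCyc h (koszulCyc h r))) =
      -(ksgn K ((a : ZMod 2) * b) • contr α (contr β r)) := by
  rw [← contr_contr_koszulCyc h hα hβ, hr, map_neg, map_neg, map_neg, map_neg, neg_neg]

end Koszul

/-! ### Detection by homogeneous functionals -/

namespace LagrangianBraneSpace

variable {K V : Type u} [Field K] [AddCommGroup V] [Module K V] (L : LagrangianBraneSpace K V)

theorem isHomFun_dualE {d : ℤ} {ψ : L.X .contra} (hψ : ψ ∈ L.deg .contra d) :
    IsHomFun L.grPos d (L.dualE ψ) := L.mem_grHat.1 hψ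

theorem dualE_add_apply (ψ χ : L.X .contra) (w : L.Wpos) :
    L.dualE (ψ + χ) w = L.dualE ψ w + L.dualE χ w := by
  rw [map_add, LinearMap.add_apply]

theorem dualE_sub_apply (ψ χ : L.X .contra) (w : L.Wpos) :
    L.dualE (ψ - χ) w = L.dualE ψ w - L.dualE χ w := by
  rw [map_sub, LinearMap.sub_apply]

theorem dualE_smul_apply (r : K) (ψ : L.X .contra) (w : L.Wpos) :
    L.dualE (r • ψ) w = r * L.dualE ψ w := by
  rw [map_smul, LinearMap.smul_apply, smul_eq_mul]

theorem dualE_zero_apply (w : L.Wpos) : L.dualE 0 w = 0 := by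
  rw [map_zero, LinearMap.zero_apply]

/-- For the given vector any functional may be replaced by a truncation, which is a finite sum of
homogeneous ones. -/
theorem eq_zero_of_dualE {w : L.Wpos} (h : ∀ d, ∀ ψ ∈ L.deg .contra d, L.dualE ψ w = 0) :
    w = 0 := by
  rw [← Module.forall_dual_apply_eq_zero_iff K]
  intro α
  obtain ⟨D, hD⟩ := L.exists_trunc_eq w
  have := hD D subset_rfl (L.dualE.symm α)
  rw [LinearEquiv.apply_symm_apply] at this
  rw [← this, trunc_finset, map_sum, LinearMap.sum_apply]
  exact Finset.sum_eq_zero fun d _ => h d _ (L.trunc_mem_deg d .contra _)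

theorem eq_zero_of_contr_dualE {M : Type*} [AddCommGroup M] [Module K M] {t : M ⊗[K] L.Wpos}
    (h : ∀ d, ∀ ψ ∈ L.deg .contra d, contr (L.dualE ψ) t = 0) : t = 0 := by
  classical
  refine eq_zero_of_contr fun α => ?_
  have hD : ∃ D : Finset ℤ, ∀ D', D ⊆ D' → ∀ ψ : L.X .contra,
      contr (L.dualE (L.trunc (· ∈ D') .contra ψ)) t = contr (L.dualE ψ) t := by
    clear h
    induction t with
    | zero => exact ⟨∅, fun D' _ ψ => by rw [map_zero, map_zero]⟩
    | tmul x y =>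
      obtain ⟨D, hD⟩ := L.exists_trunc_eq y
      exact ⟨D, fun D' h ψ => by rw [contr_tmul, contr_tmul, hD D' h]⟩
    | add s t hs ht =>
      obtain ⟨D, hD⟩ := hs
      obtain ⟨E, hE⟩ := ht
      exact ⟨D ∪ E, fun D' h ψ => by
        rw [map_add, map_add, hD D' (Finset.union_subset_left h),
          hE D' (Finset.union_subset_right h)]⟩
  obtain ⟨D, hD⟩ := hD
  have := hD D subset_rfl (L.dualE.symm α)
  rw [LinearEquiv.apply_symm_apply] at this
  rw [← this, trunc_finset, map_sum, map_sum, LinearMap.sum_apply]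
  exact Finset.sum_eq_zero fun d _ => h d _ (L.trunc_mem_deg d .contra _)

end LagrangianBraneSpace

variable {K V : Type u} [Field K] [AddCommGroup V] [Module K V] {L : LagrangianBraneSpace K V}

/-! ### The morphism given by a product and a coproduct -/

section OfOps

variable {mul : L.Wpos →ₗ[K] L.Wpos →ₗ[K] L.Wpos} {comul : L.Wpos →ₗ[K] L.Wpos ⊗[K] L.Wpos}
  (hm : ∀ i j, ∀ x ∈ L.grPos i, ∀ y ∈ L.grPos j, mul x y ∈ L.grPos (i + j))
  (hc : ∀ i, ∀ x ∈ L.grPos i, comul x ∈ grTensor L.grPos i)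

/-- In the order of the leaves there are no inversions; this evaluates all relations without
permuted inputs. -/
theorem LagrangianBraneSpace.fam_self {I : Type} {s : I → Dir} {c : Dir} (T : Tree s c)
    (h : T.Linear) (e : Enum I) (he : e.1 = T.leaves) (x : ∀ i, L.X (s i)) :
    L.fam mul comul T h e x = T.eval (L.op mul comul) x := by
  have := enum_finite e
  refine L.parity_ext (MultilinearMap.addInEach _)
    (MultilinearMap.addInEach (T.evalM (L.op mul comul) h)) (fun p x hx => ?_) x
  rw [L.fam_of_mem mul comul T h e hx, he, inv_self h.1, ksgn_zero, one_smul, Tree.evalM_apply]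

namespace FreeMor

/-- The components of the morphism given by a product and a coproduct. -/
def ofOpsFun {I : Type} (s : I → Dir) (c : Dir) : Fr K s c →ₗ[K] L.EndOp s c :=
  Finsupp.linearCombination K fun T => ⟨L.fam mul comul T.1 T.2, L.fam_mem_EndOp hm hc T.1 T.2⟩

theorem ofOpsFun_tree {I : Type} {s : I → Dir} {c : Dir} (T : Tree s c) (h : T.Linear) :
    (ofOpsFun hm hc s c (Fr.tree K T h)).1 = L.fam mul comul T h := by
  rw [ofOpsFun, Fr.tree, Finsupp.linearCombination_single, one_smul]

theorem single_eq_smul_tree {I : Type} {s : I → Dir} {c : Dir} (T : {T : Tree s c // T.Linear})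
    (r : K) : (Finsupp.single T r : Fr K s c) = r • Fr.tree K T.1 T.2 := by
  rw [Fr.tree, Finsupp.smul_single, smul_eq_mul, mul_one]

theorem ofOpsFun_relabel {I J : Type} (t : J → Dir) (c : Dir) (σ : I ≃ J)
    (x : Fr K (fun i => t (σ i)) c) (e : Enum I) (e' : Enum J) (he : e'.1 = e.1.map σ)
    (y : ∀ j, L.X (t j)) :
    (ofOpsFun hm hc t c (Fr.relabel K t c σ x)).1 e' y =
      (ofOpsFun hm hc (fun i => t (σ i)) c x).1 e fun i => y (σ i) := by
  induction x using Finsupp.induction_linear with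
  | zero => simp only [map_zero]; rfl
  | add x x' hx hx' =>
    simp only [map_add]
    exact congrArg₂ (· + ·) hx hx'
  | single T r =>
    rw [single_eq_smul_tree, map_smul, map_smul, map_smul, Fr.relabel_tree]
    refine congrArg (fun w : L.X c => r • w) ?_
    rw [ofOpsFun_tree, ofOpsFun_tree]
    exact L.fam_relabel σ T.1 T.2 e e' he y

theorem ofOpsFun_graft {I J : Type} (s : Option I → Dir) (t : J → Dir) (c : Dir) (x : Fr K s c)
    (y : Fr K t (s none)) (a b : List I) (e : Enum (Option I)) (e' : Enum J) (e'' : Enum (I ⊕ J))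
    (he : e.1 = a.map some ++ none :: b.map some)
    (he'' : e''.1 = a.map Sum.inl ++ e'.1.map Sum.inr ++ b.map Sum.inl)
    (z : ∀ k, L.X (Sum.elim (fun i => s (some i)) t k)) :
    (ofOpsFun hm hc _ c (Fr.graft K s t c x y)).1 e'' z =
      (ofOpsFun hm hc s c x).1 e
        (L.plug z ((ofOpsFun hm hc t (s none) y).1 e' fun j => z (Sum.inr j))) := by
  classical
  induction x using Finsupp.induction_linear with
  | zero => simp only [map_zero, LinearMap.zero_apply]; rfl
  | add x x' hx hx' =>
    simp only [map_add, LinearMap.add_apply]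
    exact congrArg₂ (· + ·) hx hx'
  | single T r =>
    rw [single_eq_smul_tree, map_smul, map_smul, LinearMap.smul_apply, map_smul]
    refine congrArg (fun w : L.X c => r • w) ?_
    rw [ofOpsFun_tree]
    induction y using Finsupp.induction_linear with
    | zero =>
      simp only [map_zero]
      exact ((L.fam mul comul T.1 T.2 e).map_coord_zero none rfl).symm
    | add y y' hy hy' =>
      simp only [map_add]
      refine (congrArg₂ (· + ·) hy hy').trans ?_
      change _ = (L.fam mul comul T.1 T.2 e) (L.plug z (_ + _))
      have h3 := fun v => L.plug_eq_update z v 0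
      rw [h3 (_ + _), MultilinearMap.map_update_add, ← h3, ← h3]
    | single T' r' =>
      rw [single_eq_smul_tree, map_smul, map_smul, map_smul, Fr.graft_tree]
      change r' • (ofOpsFun hm hc _ c _).1 e'' z = (L.fam mul comul T.1 T.2 e) (L.plug z (r' • _))
      have h3 := fun v => L.plug_eq_update z v 0
      rw [h3 (r' • _), MultilinearMap.map_update_smul, ← h3, ofOpsFun_tree, ofOpsFun_tree]
      exact congrArg (fun w : L.X c => r' • w) (L.fam_graft hm hc T.1 T.2 T'.1 T'.2 a b e e' e'' he
        he'' z)

/-- The morphism given by a product and a coproduct. -/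
def ofOps : FreeMor L.toBraneSpace where
  toFun s c := ofOpsFun hm hc s c
  map_unit c e x := by
    have he : e.1 = [()] := List.perm_singleton.1 (enum_perm e ⟨[()], by simp, by simp⟩)
    exact (DFunLike.congr_fun (congrFun (ofOpsFun_tree hm hc (Tree.leaf (s := fun _ : Unit => c) ())
      ⟨by simp [Tree.leaves], by simp [Tree.leaves]⟩) e) x).trans
        (L.fam_self (Tree.leaf (s := fun _ : Unit => c) ()) _ e he x)
  map_relabel := ofOpsFun_relabel hm hc
  map_graft := ofOpsFun_graft hm hc

theorem ofOps_tree {I : Type} {s : I → Dir} {c : Dir} (T : Tree s c) (h : T.Linear) :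
    ((ofOps hm hc).toFun s c (Fr.tree K T h)).1 = L.fam mul comul T h := ofOpsFun_tree hm hc T h

theorem ofOps_tree_self {I : Type} {s : I → Dir} {c : Dir} (T : Tree s c) (h : T.Linear)
    (e : Enum I) (he : e.1 = T.leaves) (x : ∀ i, L.X (s i)) :
    ((ofOps hm hc).toFun s c (Fr.tree K T h)).1 e x = T.eval (L.op mul comul) x := by
  rw [ofOps_tree, L.fam_self T h e he x]

theorem ofOps_gen (g : Gen) (x : ∀ i, L.X (two g.inL g.inR i)) :
    ((ofOps hm hc).toFun _ _ (Fr.tree K (genTree g) (genTree_linear g))).1 Rep.ord x =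
      L.op mul comul g (x 0) (x 1) :=
  ofOps_tree_self hm hc _ _ Rep.ord (by cases g <;> rfl) x

end FreeMor

end OfOps

/-! ### The relations of the operad of associative algebras -/

/-- The standard ordering of three inputs. -/
def ord₃ : Enum (Fin 3) := ⟨[0, 1, 2], by decide, by decide⟩

/-- Three inputs. -/
def triple {B : BraneSpace K V} {a b c : Dir} (x : B.X a) (y : B.X b) (z : B.X c) :
    ∀ i, B.X (three a b c i)
  | 0 => x
  | 1 => y
  | 2 => z

theorem LagrangianBraneSpace.EndOp_ext₃ (L : LagrangianBraneSpace K V) {a b c d : Dir}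
    {G H : L.EndOp (three a b c) d}
    (h : ∀ (i j k : ℤ) (x : L.X a) (y : L.X b) (z : L.X c), x ∈ L.deg a i → y ∈ L.deg b j →
      z ∈ L.deg c k → G.1 ord₃ (triple x y z) = H.1 ord₃ (triple x y z)) : G = H := by
  refine L.EndOp_ext ord₃ fun p x hx => ?_
  have hx' : x = triple (B := L.toBraneSpace) (a := a) (b := b) (c := c) (x 0) (x 1) (x 2) := by
    funext i
    fin_cases i <;> rfl
  rw [hx']
  exact h (p 0) (p 1) (p 2) _ _ _ (hx 0) (hx 1) (hx 2)

section Ass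

variable {mul : L.Wpos →ₗ[K] L.Wpos →ₗ[K] L.Wpos} {comul : L.Wpos →ₗ[K] L.Wpos ⊗[K] L.Wpos}
  (hm : ∀ i j, ∀ x ∈ L.grPos i, ∀ y ∈ L.grPos j, mul x y ∈ L.grPos (i + j))
  (hc : ∀ i, ∀ x ∈ L.grPos i, comul x ∈ grTensor L.grPos i)

open FreeMor

/-- The associativity of the product in terms of the relation. -/
theorem ass_aaa_iff : (ofOps hm hc).toFun (three .co .co .co) .co
      (mon K (nA (nA x0 x1) x2) - mon K (nA x0 (nA x1 x2))) = 0 ↔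
    ∀ x y z, mul (mul x y) z = mul x (mul y z) := by
  have key : ∀ x y z : L.Wpos, ((ofOps hm hc).toFun (three .co .co .co) .co
      (mon K (nA (nA x0 x1) x2) - mon K (nA x0 (nA x1 x2)))).1 ord₃
        (triple (a := .co) (b := .co) (c := .co) x y z) =
      (mul (mul x y) z - mul x (mul y z) : L.Wpos) := by
    intro x y z
    rw [map_sub]
    exact congrArg₂ (· - ·)
      (ofOps_tree_self hm hc (s := three .co .co .co) (nA (nA x0 x1) x2) _ ord₃ rfl _)
      (ofOps_tree_self hm hc (s := three .co .co .co) (nA x0 (nA x1 x2)) _ ord₃ rfl _)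
  constructor
  · intro h x y z
    have := key x y z
    rw [h] at this
    exact sub_eq_zero.1 this.symm
  · intro h
    refine L.EndOp_ext₃ fun i j k x y z _ _ _ => (key x y z).trans ?_
    exact sub_eq_zero.2 (h _ _ _)

/-- The derivation property of the coproduct in terms of the relation. -/
theorem ass_aab_iff : (ofOps hm hc).toFun (three .co .co .contra) .co
      (mon K (nC (nA x0 x1) x2) - mon K (nA x0 (nC x1 x2)) - mon K (nC x0 (nD x1 x2))) = 0 ↔
    ∀ x y, comul (mul x y) = (mul x).rTensor L.Wpos (comul y) +
      (mul.flip y).lTensor L.Wpos (comul x) := by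
  have key : ∀ (x y : L.Wpos) (ψ : L.X .contra),
      ((ofOps hm hc).toFun (three .co .co .contra) .co
      (mon K (nC (nA x0 x1) x2) - mon K (nA x0 (nC x1 x2)) - mon K (nC x0 (nD x1 x2)))).1 ord₃
        (triple (a := .co) (b := .co) (c := .contra) x y ψ) =
      contr (L.dualE ψ) (comul (mul x y) - (mul x).rTensor L.Wpos (comul y) -
        (mul.flip y).lTensor L.Wpos (comul x)) := by
    intro x y ψ
    rw [map_sub, map_sub]
    refine (congrArg₂ (· - ·) (congrArg₂ (· - ·)
      (ofOps_tree_self hm hc (s := three .co .co .contra) (nC (nA x0 x1) x2) _ ord₃ rfl _)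
      (ofOps_tree_self hm hc (s := three .co .co .contra) (nA x0 (nC x1 x2)) _ ord₃ rfl _))
      (ofOps_tree_self hm hc (s := three .co .co .contra) (nC x0 (nD x1 x2)) _ ord₃ rfl _)).trans ?_
    rw [map_sub, map_sub, contr_rTensor, contr_lTensor]
    have : L.dualE (L.op mul comul .D y ψ) = L.dualE ψ ∘ₗ mul.flip y :=
      LinearMap.ext fun w => L.dualE_op_D mul comul y ψ w
    rw [← this]
    rfl
  constructor
  · intro h x y
    rw [← sub_eq_zero, ← sub_sub]
    refine eq_zero_of_contr fun α => ?_
    have := key x y (L.dualE.symm α)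
    rw [h, LinearEquiv.apply_symm_apply] at this
    exact this.symm
  · intro h
    refine L.EndOp_ext₃ fun i j k x y z _ _ _ => (key x y z).trans (Eq.trans ?_ (map_zero (contr
        (L.dualE z))))
    refine congrArg _ ?_
    exact (sub_sub _ _ _).trans (sub_eq_zero.2 (h x y))

/-- `B` is convolution of functionals along the coproduct, so contracting with it means applying the
coproduct to the second factor and contracting twice. -/
theorem contr_dualE_op_B (ψ χ : L.X .contra) (t : L.Wpos ⊗[K] L.Wpos) :
    contr (L.dualE (L.op mul comul .B ψ χ)) t = contr (L.dualE χ) (contr (L.dualE ψ)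
      ((TensorProduct.assoc K _ _ _).symm (comul.lTensor L.Wpos t))) := by
  rw [contr_contr_assoc_symm]
  congr 2
  exact LinearMap.ext fun w => L.dualE_op_B mul comul ψ χ w

theorem contr_op_C (ψ χ : L.X .contra) (x : L.Wpos) :
    L.op mul comul .C (L.op mul comul .C x ψ) χ = contr (L.dualE χ) (contr (L.dualE ψ)
      (comul.rTensor L.Wpos (comul x))) := by
  rw [contr_rTensor]
  rfl

/-- The coassociativity of the coproduct in terms of the relation. -/
theorem ass_abb_iff : (ofOps hm hc).toFun (three .co .contra .contra) .co
      (mon K (nC (nC x0 x1) x2) - mon K (nC x0 (nB x1 x2))) = 0 ↔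
    ∀ x, TensorProduct.assoc K _ _ _ (comul.rTensor L.Wpos (comul x)) =
      comul.lTensor L.Wpos (comul x) := by
  have key : ∀ (x : L.Wpos) (ψ χ : L.X .contra),
      ((ofOps hm hc).toFun (three .co .contra .contra) .co
      (mon K (nC (nC x0 x1) x2) - mon K (nC x0 (nB x1 x2)))).1 ord₃
        (triple (a := .co) (b := .contra) (c := .contra) x ψ χ) =
      contr (L.dualE χ) (contr (L.dualE ψ) (comul.rTensor L.Wpos (comul x) -
        (TensorProduct.assoc K _ _ _).symm (comul.lTensor L.Wpos (comul x)))) := by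
    intro x ψ χ
    rw [map_sub]
    refine (congrArg₂ (· - ·)
      (ofOps_tree_self hm hc (s := three .co .contra .contra) (nC (nC x0 x1) x2) _ ord₃ rfl _)
      (ofOps_tree_self hm hc (s := three .co .contra .contra) (nC x0 (nB x1 x2)) _ ord₃ rfl
        _)).trans ?_
    rw [map_sub, map_sub]
    exact congrArg₂ (· - ·) (contr_op_C ψ χ x) (contr_dualE_op_B ψ χ _)
  constructor
  · intro h x
    rw [← LinearEquiv.eq_symm_apply, ← sub_eq_zero]
    refine eq_zero_of_contr fun α => eq_zero_of_contr fun β => ?_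
    have := key x (L.dualE.symm α) (L.dualE.symm β)
    rw [h, LinearEquiv.apply_symm_apply, LinearEquiv.apply_symm_apply] at this
    exact this.symm
  · intro h
    refine L.EndOp_ext₃ fun i j k x y z _ _ _ => (key x y z).trans ?_
    have := (LinearEquiv.eq_symm_apply _).2 (h x)
    refine (congrArg (fun t => contr (L.dualE z) (contr (L.dualE y) t)) (sub_eq_zero.2 this)).trans
        ?_
    rw [map_zero, map_zero]
    rfl

variable (hassoc : ∀ x y z, mul (mul x y) z = mul x (mul y z))
  (hco : ∀ x, TensorProduct.assoc K _ _ _ (comul.rTensor L.Wpos (comul x)) =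
      comul.lTensor L.Wpos (comul x))
  (hder : ∀ x y, comul (mul x y) = (mul x).rTensor L.Wpos (comul y) +
      (mul.flip y).lTensor L.Wpos (comul x))

include hassoc hco hder in
theorem ofOps_ass (I : Type) (s : I → Dir) (c : Dir) (x : Fr K s c) (hx : AssRel K I s c x) :
    (ofOps hm hc).toFun s c x = 0 := by
  -- Coassociativity and the derivation rule, restated for the contracted operations; the last three
  -- relations are transposes of these and of associativity.
  have hC : ∀ (x : L.Wpos) (α β : L.X .contra),
      L.op mul comul .C (L.op mul comul .C x α) β =
        L.op mul comul .C x (L.op mul comul .B α β) := by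
    intro x α β
    rw [contr_op_C]
    refine Eq.trans ?_ (contr_dualE_op_B α β (comul x)).symm
    rw [← hco, LinearEquiv.symm_apply_apply]
  have hD : ∀ (x y : L.Wpos) (α : L.X .contra), contr (L.dualE α) (comul (mul x y)) =
      mul x (contr (L.dualE α) (comul y)) +
        contr (L.dualE (L.op mul comul .D y α)) (comul x) := by
    intro x y α
    rw [hder, map_add, contr_rTensor, contr_lTensor]
    congr 3
    exact (LinearMap.ext fun w => L.dualE_op_D mul comul y α w).symm
  cases hx with
  | aaa => exact (ass_aaa_iff hm hc).2 hassoc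
  | aab => exact (ass_aab_iff hm hc).2 hder
  | abb => exact (ass_abb_iff hm hc).2 hco
  | bbb =>
    refine L.EndOp_ext₃ fun i j k x y z _ _ _ => ?_
    rw [map_sub]
    refine (congrArg₂ (· - ·)
      (ofOps_tree_self hm hc (s := three .contra .contra .contra) (nB (nB x0 x1) x2) _ ord₃ rfl _)
      (ofOps_tree_self hm hc (s := three .contra .contra .contra) (nB x0 (nB x1 x2)) _ ord₃ rfl
        _)).trans
      (sub_eq_zero.2 ?_)
    -- Paired with `w`, the two sides become `z` applied to `C(w, B(x, y))` and to `C(C(w, x), y)`: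
    -- coassociativity.
    refine L.dual_ext fun w => ?_
    refine (L.dualE_op_B mul comul _ z w).trans ?_
    refine Eq.trans ?_ (L.dualE_op_B mul comul x _ w).symm
    refine Eq.trans ?_ (L.dualE_op_B mul comul y z _).symm
    exact congrArg _ (hC w x y).symm
  | dbb =>
    refine L.EndOp_ext₃ fun i j k x y z _ _ _ => ?_
    rw [map_sub, map_add]
    refine (congrArg₂ (· - ·) (congrArg₂ (· + ·)
      (ofOps_tree_self hm hc (s := three .co .contra .contra) (nB (nD x0 x1) x2) _ ord₃ rfl _)
      (ofOps_tree_self hm hc (s := three .co .contra .contra) (nD (nC x0 x1) x2) _ ord₃ rfl _))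
      (ofOps_tree_self hm hc (s := three .co .contra .contra) (nD x0 (nB x1 x2)) _ ord₃ rfl
        _)).trans
      (sub_eq_zero.2 ?_)
    -- Paired with `w`, the right-hand side becomes `z` applied to `C(w x, y)`, and the two terms on
    -- the left are those of the derivation rule.
    refine L.dual_ext fun w => ?_
    refine (congrFun (congrArg DFunLike.coe (map_add L.dualE _ _)) w).trans ?_
    refine (congrArg₂ (· + ·) (L.dualE_op_B mul comul _ z w)
      (L.dualE_op_D mul comul _ z w)).trans ?_
    refine Eq.trans ?_ (L.dualE_op_D mul comul x _ w).symm
    refine Eq.trans ?_ (L.dualE_op_B mul comul y z _).symm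
    refine Eq.trans ?_ (congrArg (L.dualE z) (hD w x y).symm)
    rw [map_add, add_comm]
    rfl
  | ddd =>
    refine L.EndOp_ext₃ fun i j k x y z _ _ _ => ?_
    rw [map_sub]
    refine (congrArg₂ (· - ·)
      (ofOps_tree_self hm hc (s := three .co .co .contra) (nD (nA x0 x1) x2) _ ord₃ rfl _)
      (ofOps_tree_self hm hc (s := three .co .co .contra) (nD x0 (nD x1 x2)) _ ord₃ rfl _)).trans
      (sub_eq_zero.2 ?_)
    -- Paired with `w`, the two sides are `z` applied to `w (x y)` and to `(w x) y`.
    refine L.dual_ext fun w => ?_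
    refine (L.dualE_op_D mul comul _ z w).trans ?_
    refine Eq.trans ?_ (L.dualE_op_D mul comul x _ w).symm
    refine Eq.trans ?_ (L.dualE_op_D mul comul y z _).symm
    exact congrArg _ (hassoc w x y).symm

end Ass

open LagrangianBraneSpace

/-! ### Koszul signs of two and three inputs -/

theorem inv_swap₂ (p q : ZMod 2) : inv [(0 : Fin 2), 1] [1, 0] ![p, q] = p * q := by
  classical
  simp [inv_eq_sum, Fin.sum_univ_succ, Before]

theorem inv_swap_left (p q r : ZMod 2) : inv [(0 : Fin 3), 1, 2] [1, 0, 2] ![p, q, r] = p * q := by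
  classical
  simp [inv_eq_sum, Fin.sum_univ_succ, Before]

theorem inv_swap_right (p q r : ZMod 2) : inv [(0 : Fin 3), 1, 2] [0, 2, 1] ![p, q, r] = q * r := by
  classical
  simp [inv_eq_sum, Fin.sum_univ_succ, Before]

theorem inv_rot (p q r : ZMod 2) :
    inv [(0 : Fin 3), 1, 2] [2, 0, 1] ![p, q, r] = p * r + q * r := by
  classical
  simp [inv_eq_sum, Fin.sum_univ_succ, Before]

theorem inv_rot_rot (p q r : ZMod 2) :
    inv [(0 : Fin 3), 1, 2] [1, 2, 0] ![p, q, r] = p * q + p * r := by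
  classical
  simp [inv_eq_sum, Fin.sum_univ_succ, Before]

theorem ksgn_smul_neg_ksgn_smul {K M : Type*} [Field K] [AddCommGroup M] [Module K M] {a b c : ZMod
    2}
    (h : a + b = c) (m : M) : ksgn K a • -(ksgn K b • m) = -(ksgn K c • m) := by
  rw [smul_neg, smul_smul, ← ksgn_add, h]

theorem ksgn_smul_ksgn_smul {K M : Type*} [Field K] [AddCommGroup M] [Module K M] {a b c : ZMod 2}
    (h : a + b = c) (m : M) : ksgn K a • ksgn K b • m = ksgn K c • m := by
  rw [smul_smul, ← ksgn_add, h]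

/-- The cyclic form of the Jacobi identity. -/
theorem cyclic_eq_leibniz {K M : Type*} [Field K] [AddCommGroup M] [Module K M]
    {gr : ℤ → Submodule K M} {br : M →ₗ[K] M →ₗ[K] M}
    (hdeg : ∀ i j, ∀ x ∈ gr i, ∀ y ∈ gr j, br x y ∈ gr (i + j))
    (hskew : ∀ i j, ∀ x ∈ gr i, ∀ y ∈ gr j, br x y = -(ksgn K ((i : ZMod 2) * j) • br y x))
    {i j k : ℤ} {x y z : M} (hx : x ∈ gr i) (hy : y ∈ gr j) (hz : z ∈ gr k) :
    br (br x y) z + ksgn K ((i : ZMod 2) * k + j * k) • br (br z x) y +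
        ksgn K ((i : ZMod 2) * j + i * k) • br (br y z) x =
      br (br x y) z + ksgn K ((i : ZMod 2) * j) • br y (br x z) - br x (br y z) := by
  -- Skew symmetry of the outer and the inner bracket brings this term to Leibniz form; for the next
  -- one the outer bracket is enough.
  have h1 : br (br z x) y = ksgn K ((j : ZMod 2) * (i + k) + i * k) • br y (br x z) := by
    rw [hskew _ _ _ (hdeg _ _ z hz x hx) y hy, hskew k i z hz x hx, map_neg, map_smul,
      smul_neg, neg_neg, smul_smul, ← ksgn_add]
    congr 2
    push_cast
    ring
  have h2 : br (br y z) x = -(ksgn K ((i : ZMod 2) * j + i * k) • br x (br y z)) := by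
    rw [hskew _ _ _ (hdeg _ _ y hy z hz) x hx]
    congr 3
    push_cast
    ring
  have e : (i : ZMod 2) * k + j * k + (j * (i + k) + i * k) = i * j := by
    generalize (i : ZMod 2) = i
    generalize (j : ZMod 2) = j
    generalize (k : ZMod 2) = k
    decide +revert
  rw [h1, h2, ksgn_smul_ksgn_smul e, ksgn_smul_neg_ksgn_smul (CharTwo.add_self_eq_zero _),
    ksgn_zero, one_smul, sub_eq_add_neg]

theorem deg_le_cgr_parity {c : Dir} {i : ℤ} {x : L.X c} (hx : x ∈ L.deg c i) :
    x ∈ L.cgr parity c (i : ZMod 2) := by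
  have := L.deg_le_cgr parity c i hx
  rwa [Int.coe_castAddHom] at this

theorem triple_mem {a b c : Dir} {i j k : ℤ} {x : L.X a} {y : L.X b} {z : L.X c}
    (hx : x ∈ L.deg a i) (hy : y ∈ L.deg b j) (hz : z ∈ L.deg c k) :
    ∀ n : Fin 3, triple x y z n ∈ L.cgr parity (three a b c n) (![(i : ZMod 2), j, k] n)
  | 0 => deg_le_cgr_parity hx
  | 1 => deg_le_cgr_parity hy
  | 2 => deg_le_cgr_parity hz

theorem pair_mem {a b : Dir} {i j : ℤ} {x : L.X a} {y : L.X b}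
    (hx : x ∈ L.deg a i) (hy : y ∈ L.deg b j) :
    ∀ n : Fin 2, Rep.pair x y n ∈ L.cgr parity (two a b n) (![(i : ZMod 2), j] n)
  | 0 => deg_le_cgr_parity hx
  | 1 => deg_le_cgr_parity hy

theorem LagrangianBraneSpace.EndOp_ext₂ (L : LagrangianBraneSpace K V) {a b d : Dir}
    {G H : L.EndOp (two a b) d}
    (h : ∀ (i j : ℤ) (x : L.X a) (y : L.X b), x ∈ L.deg a i → y ∈ L.deg b j →
      G.1 Rep.ord (Rep.pair x y) = H.1 Rep.ord (Rep.pair x y)) : G = H := by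
  refine L.EndOp_ext Rep.ord fun p x hx => ?_
  have hx' : x = Rep.pair (B := L.toBraneSpace) (a := a) (b := b) (x 0) (x 1) := by
    funext i
    fin_cases i <;> rfl
  rw [hx']
  exact h (p 0) (p 1) _ _ (hx 0) (hx 1)

theorem LagrangianBraneSpace.dual_ext_hom (L : LagrangianBraneSpace K V) {ψ χ : L.X .contra}
    (h : ∀ l, ∀ w ∈ L.grPos l, L.dualE ψ w = L.dualE χ w) : ψ = χ :=
  L.dualE.injective (gr_linearMap_ext L.grPos_internal h)

/-! ### The relations of the operad of Lie algebras and the axioms of a Lie bialgebra -/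

section Lie

variable {mul : L.Wpos →ₗ[K] L.Wpos →ₗ[K] L.Wpos} {comul : L.Wpos →ₗ[K] L.Wpos ⊗[K] L.Wpos}
  (hm : ∀ i j, ∀ x ∈ L.grPos i, ∀ y ∈ L.grPos j, mul x y ∈ L.grPos (i + j))
  (hc : ∀ i, ∀ x ∈ L.grPos i, comul x ∈ grTensor L.grPos i)

open FreeMor

/-- The order `l` of the leaves and the exponent `ε` are free, so that the signs computed above for
concrete permutations can be supplied directly. -/
theorem FreeMor.ofOps_triple {a b c d : Dir} (T : Tree (three a b c) d) (h : T.Linear) {i j k : ℤ}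
    {x : L.X a} {y : L.X b} {z : L.X c} (hx : x ∈ L.deg a i) (hy : y ∈ L.deg b j)
    (hz : z ∈ L.deg c k) {l : List (Fin 3)} (hl : T.leaves = l) {ε : ZMod 2}
    (hε : inv [0, 1, 2] l ![(i : ZMod 2), j, k] = ε) :
    ((ofOps hm hc).toFun _ _ (Fr.tree K T h)).1 ord₃ (triple x y z) =
      ksgn K ε • T.eval (L.op mul comul) (triple x y z) := by
  rw [ofOps_tree, L.fam_of_mem mul comul T h ord₃ (triple_mem hx hy hz), hl, ← hε]
  rfl

theorem FreeMor.ofOps_pair {a b d : Dir} (T : Tree (two a b) d) (h : T.Linear) {i j : ℤ}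
    {x : L.X a} {y : L.X b} (hx : x ∈ L.deg a i) (hy : y ∈ L.deg b j)
    {l : List (Fin 2)} (hl : T.leaves = l) {ε : ZMod 2}
    (hε : inv [0, 1] l ![(i : ZMod 2), j] = ε) :
    ((ofOps hm hc).toFun _ _ (Fr.tree K T h)).1 Rep.ord (Rep.pair x y) =
      ksgn K ε • T.eval (L.op mul comul) (Rep.pair x y) := by
  rw [ofOps_tree, L.fam_of_mem mul comul T h Rep.ord (pair_mem hx hy), hl, ← hε]
  rfl

/-- The skew symmetry of the bracket in terms of the relation. -/
theorem lie_skewA_iff : (ofOps hm hc).toFun (two .co .co) .co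
      (mon K (nA y0 y1) + mon K (nA y1 y0)) = 0 ↔
    ∀ i j, ∀ x ∈ L.grPos i, ∀ y ∈ L.grPos j, mul x y = -(ksgn K ((i : ZMod 2) * j) • mul y x) := by
  have key : ∀ i j, ∀ x ∈ L.grPos i, ∀ y ∈ L.grPos j, ((ofOps hm hc).toFun (two .co .co) .co
      (mon K (nA y0 y1) + mon K (nA y1 y0))).1 Rep.ord
        (Rep.pair (a := .co) (b := .co) x y) =
      (mul x y + ksgn K ((i : ZMod 2) * j) • mul y x : L.Wpos) := by
    intro i j x hx y hy
    rw [map_add]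
    exact congrArg₂ (· + ·)
      (ofOps_tree_self hm hc (s := two .co .co) (nA y0 y1) _ Rep.ord rfl _)
      (ofOps_pair hm hc (a := .co) (b := .co) (nA y1 y0) _ hx hy rfl (inv_swap₂ _ _))
  constructor
  · intro h i j x hx y hy
    have := key i j x hx y hy
    rw [h] at this
    exact eq_neg_of_add_eq_zero_left this.symm
  · intro h
    refine L.EndOp_ext₂ fun i j x y hx hy => (key i j x hx y hy).trans ?_
    exact add_eq_zero_iff_eq_neg.2 (h i j x hx y hy)

/-- The Jacobi identity in terms of the relation. -/
theorem lie_aaa_iff (hskew : ∀ i j, ∀ x ∈ L.grPos i, ∀ y ∈ L.grPos j,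
      mul x y = -(ksgn K ((i : ZMod 2) * j) • mul y x)) :
    (ofOps hm hc).toFun (three .co .co .co) .co
      (mon K (nA (nA x0 x1) x2) + mon K (nA (nA x2 x0) x1) + mon K (nA (nA x1 x2) x0)) = 0 ↔
    ∀ i j, ∀ x ∈ L.grPos i, ∀ y ∈ L.grPos j, ∀ z,
      mul x (mul y z) = mul (mul x y) z + ksgn K ((i : ZMod 2) * j) • mul y (mul x z) := by
  have key : ∀ i j k, ∀ x ∈ L.grPos i, ∀ y ∈ L.grPos j, ∀ z ∈ L.grPos k,
      ((ofOps hm hc).toFun (three .co .co .co) .co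
        (mon K (nA (nA x0 x1) x2) + mon K (nA (nA x2 x0) x1) + mon K (nA (nA x1 x2) x0))).1 ord₃
        (triple (a := .co) (b := .co) (c := .co) x y z) =
      (mul (mul x y) z + ksgn K ((i : ZMod 2) * j) • mul y (mul x z) - mul x (mul y z) : L.Wpos) :=
        by
    intro i j k x hx y hy z hz
    rw [map_add, map_add]
    refine Eq.trans ?_ (cyclic_eq_leibniz hm hskew hx hy hz)
    exact congrArg₂ (· + ·) (congrArg₂ (· + ·)
      (ofOps_tree_self hm hc (s := three .co .co .co) (nA (nA x0 x1) x2) _ ord₃ rfl _)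
      (ofOps_triple hm hc (a := .co) (b := .co) (c := .co) (nA (nA x2 x0) x1) _ hx hy hz rfl
        (inv_rot _ _ _)))
      (ofOps_triple hm hc (a := .co) (b := .co) (c := .co) (nA (nA x1 x2) x0) _ hx hy hz rfl
        (inv_rot_rot _ _ _))
  constructor
  · intro h i j x hx y hy z
    refine LinearMap.congr_fun (f := mul x ∘ₗ mul y)
      (g := mul (mul x y) + ksgn K ((i : ZMod 2) * j) • mul y ∘ₗ mul x)
      (gr_linearMap_ext L.grPos_internal fun k z hz => ?_) z
    have := key i j k x hx y hy z hz
    rw [h] at this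
    exact (sub_eq_zero.1 this.symm).symm
  · intro h
    refine L.EndOp_ext₃ fun i j k x y z hx hy hz => (key i j k x hx y hy z hz).trans ?_
    exact sub_eq_zero.2 (h i j x hx y hy z).symm

/-- The cocycle condition in terms of the relation. -/
theorem lie_aab_iff : (ofOps hm hc).toFun (three .co .co .contra) .co
      (mon K (nC (nA x0 x1) x2) - mon K (nA x0 (nC x1 x2)) + mon K (nA x1 (nC x0 x2))
        - mon K (nC x0 (nD x1 x2)) + mon K (nC x1 (nD x0 x2))) = 0 ↔
    ∀ i j, ∀ x ∈ L.grPos i, ∀ y ∈ L.grPos j, comul (mul x y) =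
      cocycleTerm mul comul x y - ksgn K ((i : ZMod 2) * j) • cocycleTerm mul comul y x := by
  have key : ∀ i j k, ∀ x ∈ L.grPos i, ∀ y ∈ L.grPos j, ∀ ψ ∈ L.deg .contra k,
      ((ofOps hm hc).toFun (three .co .co .contra) .co
      (mon K (nC (nA x0 x1) x2) - mon K (nA x0 (nC x1 x2)) + mon K (nA x1 (nC x0 x2))
        - mon K (nC x0 (nD x1 x2)) + mon K (nC x1 (nD x0 x2)))).1 ord₃
        (triple (a := .co) (b := .co) (c := .contra) x y ψ) =
      contr (L.dualE ψ) (comul (mul x y) - (cocycleTerm mul comul x y -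
        ksgn K ((i : ZMod 2) * j) • cocycleTerm mul comul y x)) := by
    intro i j k x hx y hy ψ hψ
    rw [map_add, map_sub, map_add, map_sub]
    have h1 := ofOps_tree_self hm hc (s := three .co .co .contra) (nC (nA x0 x1) x2) ⟨by decide, by
        decide⟩
      ord₃ rfl (triple (a := .co) (b := .co) (c := .contra) x y ψ)
    have h2 := ofOps_tree_self hm hc (s := three .co .co .contra) (nA x0 (nC x1 x2)) ⟨by decide, by
        decide⟩
      ord₃ rfl (triple (a := .co) (b := .co) (c := .contra) x y ψ)
    have h3 := ofOps_triple hm hc (a := .co) (b := .co) (c := .contra) (nA x1 (nC x0 x2))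
      ⟨by decide, by decide⟩ hx hy hψ rfl (inv_swap_left _ _ _)
    have h4 := ofOps_tree_self hm hc (s := three .co .co .contra) (nC x0 (nD x1 x2)) ⟨by decide, by
        decide⟩
      ord₃ rfl (triple (a := .co) (b := .co) (c := .contra) x y ψ)
    have h5 := ofOps_triple hm hc (a := .co) (b := .co) (c := .contra) (nC x1 (nD x0 x2))
      ⟨by decide, by decide⟩ hx hy hψ rfl (inv_swap_left _ _ _)
    refine (congrArg₂ (· + ·) (congrArg₂ (· - ·) (congrArg₂ (· + ·) (congrArg₂ (· - ·)
      h1 h2) h3) h4) h5).trans ?_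
    have hD : ∀ y : L.Wpos, L.dualE (L.op mul comul .D y ψ) = L.dualE ψ ∘ₗ mul.flip y :=
      fun y => LinearMap.ext fun w => L.dualE_op_D mul comul y ψ w
    rw [map_sub, map_sub, map_smul, cocycleTerm, cocycleTerm, map_add, map_add, contr_rTensor,
      contr_rTensor, contr_lTensor, contr_lTensor, ← hD, ← hD, smul_add]
    change contr (L.dualE ψ) (comul (mul x y)) - mul x (contr (L.dualE ψ) (comul y)) +
      ksgn K ((i : ZMod 2) * j) • mul y (contr (L.dualE ψ) (comul x)) -
      contr (L.dualE (L.op mul comul .D y ψ)) (comul x) + ksgn K ((i : ZMod 2) * j) •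
        contr (L.dualE (L.op mul comul .D x ψ)) (comul y) = _
    abel
  constructor
  · intro h i j x hx y hy
    rw [← sub_eq_zero]
    refine L.eq_zero_of_contr_dualE fun k ψ hψ => ?_
    have := key i j k x hx y hy ψ hψ
    rw [h] at this
    exact this.symm
  · intro h
    refine L.EndOp_ext₃ fun i j k x y z hx hy hz => (key i j k x hx y hy z hz).trans
      (Eq.trans ?_ (map_zero (contr (L.dualE z))))
    exact congrArg _ (sub_eq_zero.2 (h i j x hx y hy))

/-- The skew symmetry of the cobracket in terms of the relation. -/
theorem lie_skewB_iff : (ofOps hm hc).toFun (two .contra .contra) .contra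
      (mon K (nB y0 y1) + mon K (nB y1 y0)) = 0 ↔
    ∀ x, koszulSwap L.grPos_internal (comul x) = -comul x := by
  have key : ∀ a b, ∀ ψ ∈ L.deg .contra a, ∀ χ ∈ L.deg .contra b, ∀ w : L.Wpos,
      L.dualE (((ofOps hm hc).toFun (two .contra .contra) .contra
      (mon K (nB y0 y1) + mon K (nB y1 y0))).1 Rep.ord
        (Rep.pair (a := .contra) (b := .contra) ψ χ)) w =
      L.dualE χ (contr (L.dualE ψ) (comul w + koszulSwap L.grPos_internal (comul w))) := by
    intro a b ψ hψ χ hχ w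
    rw [map_add]
    have h1 := ofOps_tree_self hm hc (s := two .contra .contra) (nB y0 y1) ⟨by decide, by decide⟩
        Rep.ord rfl
      (Rep.pair (a := .contra) (b := .contra) ψ χ)
    have h2 := ofOps_pair hm hc (a := .contra) (b := .contra) (nB y1 y0) ⟨by decide, by decide⟩ hψ
        hχ rfl
      (inv_swap₂ _ _)
    refine (congrArg (fun η => L.dualE η w) (congrArg₂ (· + ·) h1 h2)).trans ?_
    refine (L.dualE_add_apply _ _ w).trans ?_
    rw [map_add (contr (L.dualE ψ)), map_add (L.dualE χ),
      pairing_koszulSwap _ (L.isHomFun_dualE hψ) (L.isHomFun_dualE hχ)]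
    refine congrArg₂ (· + ·) (L.dualE_op_B mul comul ψ χ w) ?_
    exact (L.dualE_smul_apply _ _ w).trans (congrArg _ (L.dualE_op_B mul comul χ ψ w))
  constructor
  · intro h w
    rw [eq_neg_iff_add_eq_zero, add_comm]
    refine L.eq_zero_of_contr_dualE fun a ψ hψ => L.eq_zero_of_dualE fun b χ hχ => ?_
    rw [← key a b ψ hψ χ hχ, h]
    exact L.dualE_zero_apply w
  · intro h
    refine L.EndOp_ext₂ fun i j x y hx hy => L.dual_ext fun w => (key i j x hx y hy w).trans ?_
    rw [h, add_neg_cancel, map_zero, map_zero]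
    exact (L.dualE_zero_apply w).symm

/-- The unrotated term contracts to iterated `C`. Rotating once and using skew symmetry splits the
other tensor factor, which contracts to `B`; rotating twice exchanges `ψ` and `χ`, again by skew
symmetry. -/
theorem contr_contr_cojacobi (hc : ∀ i, ∀ x ∈ L.grPos i, comul x ∈ grTensor L.grPos i)
    (hcoskew : ∀ x, koszulSwap L.grPos_internal (comul x) = -comul x) {a b : ℤ}
    {ψ χ : L.X .contra} (hψ : ψ ∈ L.deg .contra a) (hχ : χ ∈ L.deg .contra b) (x : L.Wpos) :
    contr (L.dualE χ) (contr (L.dualE ψ) (comul.rTensor L.Wpos (comul x) +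
      koszulCyc L.grPos_internal (comul.rTensor L.Wpos (comul x)) +
      koszulCyc L.grPos_internal (koszulCyc L.grPos_internal (comul.rTensor L.Wpos (comul x))))) =
    (L.op mul comul .C (L.op mul comul .C x ψ) χ - ksgn K ((a : ZMod 2) * b) •
      L.op mul comul .C (L.op mul comul .C x χ) ψ -
      L.op mul comul .C x (L.op mul comul .B ψ χ) : L.Wpos) := by
  have h1 : (koszulSwap L.grPos_internal).toLinearMap.rTensor L.Wpos
      (comul.rTensor L.Wpos (comul x)) = -comul.rTensor L.Wpos (comul x) := by
    have : (koszulSwap L.grPos_internal).toLinearMap ∘ₗ comul = -comul := LinearMap.ext hcoskew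
    rw [← LinearMap.comp_apply (LinearMap.rTensor _ _), ← LinearMap.rTensor_comp, this,
      LinearMap.rTensor_neg]
    rfl
  have h2 : contr (L.dualE χ) (contr (L.dualE ψ) (koszulCyc L.grPos_internal
      (koszulCyc L.grPos_internal (comul.rTensor L.Wpos (comul x))))) =
      -(ksgn K ((a : ZMod 2) * b) • L.op mul comul .C (L.op mul comul .C x χ) ψ) :=
    (contr_contr_koszulCyc_of_skew _ (L.isHomFun_dualE hψ) (L.isHomFun_dualE hχ) h1).trans
      (congrArg (fun t : L.Wpos => -(ksgn K ((a : ZMod 2) * b) • t)) (contr_op_C χ ψ x).symm)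
  have h3 : contr (L.dualE χ) (contr (L.dualE ψ) (koszulCyc L.grPos_internal
      (comul.rTensor L.Wpos (comul x)))) = -L.op mul comul .C x (L.op mul comul .B ψ χ) := by
    rw [koszulCyc_rTensor _ hc, hcoskew, map_neg, map_neg, map_neg, map_neg]
    exact congrArg _ (contr_dualE_op_B ψ χ (comul x)).symm
  rw [map_add, map_add, map_add, map_add, h2, h3, ← contr_op_C]
  abel

/-- The co-Jacobi identity in terms of the relation. -/
theorem lie_abb_iff (hcoskew : ∀ x, koszulSwap L.grPos_internal (comul x) = -comul x) :
    (ofOps hm hc).toFun (three .co .contra .contra) .co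
      (mon K (nC (nC x0 x1) x2) - mon K (nC (nC x0 x2) x1) - mon K (nC x0 (nB x1 x2))) = 0 ↔
    ∀ x, comul.rTensor L.Wpos (comul x) +
      koszulCyc L.grPos_internal (comul.rTensor L.Wpos (comul x)) +
      koszulCyc L.grPos_internal (koszulCyc L.grPos_internal
        (comul.rTensor L.Wpos (comul x))) = 0 := by
  have key : ∀ i a b, ∀ x ∈ L.grPos i, ∀ ψ ∈ L.deg .contra a, ∀ χ ∈ L.deg .contra b,
      ((ofOps hm hc).toFun (three .co .contra .contra) .co
      (mon K (nC (nC x0 x1) x2) - mon K (nC (nC x0 x2) x1) - mon K (nC x0 (nB x1 x2)))).1 ord₃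
        (triple (a := .co) (b := .contra) (c := .contra) x ψ χ) =
      contr (L.dualE χ) (contr (L.dualE ψ) (comul.rTensor L.Wpos (comul x) +
        koszulCyc L.grPos_internal (comul.rTensor L.Wpos (comul x)) +
        koszulCyc L.grPos_internal (koszulCyc L.grPos_internal
          (comul.rTensor L.Wpos (comul x))))) := by
    intro i a b x hx ψ hψ χ hχ
    rw [contr_contr_cojacobi (mul := mul) hc hcoskew hψ hχ, map_sub, map_sub]
    exact congrArg₂ (· - ·) (congrArg₂ (· - ·)
      (ofOps_tree_self hm hc (s := three .co .contra .contra) (nC (nC x0 x1) x2) _ ord₃ rfl _)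
      (ofOps_triple hm hc (a := .co) (b := .contra) (c := .contra) (nC (nC x0 x2) x1) _ hx hψ hχ rfl
        (inv_swap_right _ _ _)))
      (ofOps_tree_self hm hc (s := three .co .contra .contra) (nC x0 (nB x1 x2)) _ ord₃ rfl _)
  constructor
  · intro h x
    have htop := L.grPos_internal.submodule_iSup_eq_top
    -- The relation is only evaluated on homogeneous elements; packaging the co-Jacobi sum as a
    -- linear map extends it to all of `W⁺`.
    let f : L.Wpos →ₗ[K] (L.Wpos ⊗[K] L.Wpos) ⊗[K] L.Wpos := comul.rTensor L.Wpos ∘ₗ comul +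
      koszulCyc L.grPos_internal ∘ₗ comul.rTensor L.Wpos ∘ₗ comul +
      koszulCyc L.grPos_internal ∘ₗ koszulCyc L.grPos_internal ∘ₗ comul.rTensor L.Wpos ∘ₗ comul
    suffices h0 : (⊤ : Submodule K L.Wpos) ≤ LinearMap.ker f from h0 (Submodule.mem_top (x := x))
    rw [← htop]
    refine iSup_le fun i x hx => ?_
    refine L.eq_zero_of_contr_dualE fun a ψ hψ => L.eq_zero_of_contr_dualE fun b χ hχ => ?_
    have := key i a b x hx ψ hψ χ hχ
    rw [h] at this
    exact this.symm
  · intro h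
    refine L.EndOp_ext₃ fun i j k x y z hx hy hz => (key i j k x hx y hy z hz).trans ?_
    refine (congrArg (fun t => contr (L.dualE z) (contr (L.dualE y) t)) (h x)).trans ?_
    rw [map_zero, map_zero]
    rfl

end Lie

/-! ### The transposed Lie relations -/

section LieMorphism

variable {mul : L.Wpos →ₗ[K] L.Wpos →ₗ[K] L.Wpos} {comul : L.Wpos →ₗ[K] L.Wpos ⊗[K] L.Wpos}
  (hm : ∀ i j, ∀ x ∈ L.grPos i, ∀ y ∈ L.grPos j, mul x y ∈ L.grPos (i + j))
  (hc : ∀ i, ∀ x ∈ L.grPos i, comul x ∈ grTensor L.grPos i)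

open FreeMor

include hm hc in
theorem LagrangianBraneSpace.op_mem_deg {g : Gen} {a b : ℤ} {x : L.X g.inL} {y : L.X g.inR}
    (hx : x ∈ L.deg g.inL a) (hy : y ∈ L.deg g.inR b) :
    L.op mul comul g x y ∈ L.deg g.out (a + b) := by
  rw [deg_eq_cgr] at hx hy ⊢
  exact L.op_mem_cgr hm hc _ hx hy

variable (L) (mul comul) in
/-- The operation `B`. -/
def LagrangianBraneSpace.opB (ψ χ : L.X .contra) : L.X .contra := L.op mul comul .B ψ χ

variable (L) (mul comul) in
/-- The operation `C`. -/
def LagrangianBraneSpace.opC (x : L.Wpos) (ψ : L.X .contra) : L.Wpos := L.op mul comul .C x ψ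

variable (L) (mul comul) in
/-- The operation `D`. -/
def LagrangianBraneSpace.opD (x : L.Wpos) (ψ : L.X .contra) : L.X .contra := L.op mul comul .D x ψ

theorem LagrangianBraneSpace.dualE_opB (ψ χ : L.X .contra) (w : L.Wpos) :
    L.dualE (L.opB mul comul ψ χ) w = L.dualE χ (L.opC mul comul w ψ) :=
  L.dualE_op_B mul comul ψ χ w

theorem LagrangianBraneSpace.dualE_opD (x : L.Wpos) (ψ : L.X .contra) (w : L.Wpos) :
    L.dualE (L.opD mul comul x ψ) w = L.dualE ψ (mul w x) :=
  L.dualE_op_D mul comul x ψ w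

include hm hc in
theorem LagrangianBraneSpace.opC_mem {a b : ℤ} {x : L.Wpos} {ψ : L.X .contra}
    (hx : x ∈ L.grPos a) (hψ : ψ ∈ L.deg .contra b) : L.opC mul comul x ψ ∈ L.grPos (a + b) :=
  L.op_mem_deg hm hc (g := .C) hx hψ

include hm hc in
theorem LagrangianBraneSpace.opD_mem {a b : ℤ} {x : L.Wpos} {ψ : L.X .contra}
    (hx : x ∈ L.grPos a) (hψ : ψ ∈ L.deg .contra b) :
    L.opD mul comul x ψ ∈ L.deg .contra (a + b) :=
  L.op_mem_deg hm hc (g := .D) hx hψ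

/-- The skew symmetry of the cobracket in terms of the operation `C`. -/
theorem dualE_opC_skew (hcoskew : ∀ x, koszulSwap L.grPos_internal (comul x) = -comul x) {a b : ℤ}
    {ψ χ : L.X .contra} (hψ : ψ ∈ L.deg .contra a) (hχ : χ ∈ L.deg .contra b) (w : L.Wpos) :
    L.dualE χ (L.opC mul comul w ψ) =
      -(ksgn K ((a : ZMod 2) * b) * L.dualE ψ (L.opC mul comul w χ)) := by
  have := pairing_koszulSwap L.grPos_internal (L.isHomFun_dualE hψ) (L.isHomFun_dualE hχ) (comul w)
  rw [hcoskew, map_neg, map_neg] at this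
  exact neg_eq_iff_eq_neg.1 this

/-- The transpose of the skew symmetry of the cobracket; it makes `B` a skew bracket on the dual. -/
theorem opB_skew (hcoskew : ∀ x, koszulSwap L.grPos_internal (comul x) = -comul x) {a b : ℤ}
    {ψ χ : L.X .contra} (hψ : ψ ∈ L.deg .contra a) (hχ : χ ∈ L.deg .contra b) :
    L.opB mul comul ψ χ = -(ksgn K ((a : ZMod 2) * b) • L.opB mul comul χ ψ) := by
  rw [eq_neg_iff_add_eq_zero]
  refine L.dual_ext fun w => ?_
  rw [dualE_add_apply, dualE_smul_apply, dualE_opB, dualE_opB, dualE_zero_apply,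
    dualE_opC_skew hcoskew hψ hχ, neg_add_cancel]

/-- The co-Jacobi identity in terms of the operations `C` and `B`. -/
theorem opC_cojacobi (hc : ∀ i, ∀ x ∈ L.grPos i, comul x ∈ grTensor L.grPos i)
    (hcoskew : ∀ x, koszulSwap L.grPos_internal (comul x) = -comul x)
    (hcojac : ∀ x, comul.rTensor L.Wpos (comul x) +
      koszulCyc L.grPos_internal (comul.rTensor L.Wpos (comul x)) +
      koszulCyc L.grPos_internal (koszulCyc L.grPos_internal
        (comul.rTensor L.Wpos (comul x))) = 0) {a b : ℤ}
    {ψ χ : L.X .contra} (hψ : ψ ∈ L.deg .contra a) (hχ : χ ∈ L.deg .contra b) (x : L.Wpos) :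
    L.opC mul comul (L.opC mul comul x ψ) χ =
      L.opC mul comul x (L.opB mul comul ψ χ) + ksgn K ((a : ZMod 2) * b) •
        L.opC mul comul (L.opC mul comul x χ) ψ := by
  have := contr_contr_cojacobi (mul := mul) hc hcoskew hψ hχ x
  rw [hcojac, map_zero, map_zero] at this
  change 0 = L.opC mul comul (L.opC mul comul x ψ) χ - ksgn K ((a : ZMod 2) * b) •
        L.opC mul comul (L.opC mul comul x χ) ψ - L.opC mul comul x (L.opB mul comul ψ χ) at this
  rw [eq_comm, sub_sub, sub_eq_zero] at this
  exact this.trans (add_comm _ _)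

/-- The cocycle condition in terms of the operations `C` and `D`. -/
theorem opC_cocycle (hcocyc : ∀ i j, ∀ x ∈ L.grPos i, ∀ y ∈ L.grPos j, comul (mul x y) =
      cocycleTerm mul comul x y - ksgn K ((i : ZMod 2) * j) • cocycleTerm mul comul y x) {i j : ℤ}
    {x y : L.Wpos} (hx : x ∈ L.grPos i) (hy : y ∈ L.grPos j) (ψ : L.X .contra) :
    L.opC mul comul (mul x y) ψ =
      mul x (L.opC mul comul y ψ) + L.opC mul comul x (L.opD mul comul y ψ) -
        ksgn K ((i : ZMod 2) * j) •
          (mul y (L.opC mul comul x ψ) + L.opC mul comul y (L.opD mul comul x ψ)) := by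
  have hD : ∀ y : L.Wpos, L.dualE (L.opD mul comul y ψ) = L.dualE ψ ∘ₗ mul.flip y :=
    fun y => LinearMap.ext fun w => L.dualE_op_D mul comul y ψ w
  have := congrArg (contr (L.dualE ψ)) (hcocyc i j x hx y hy)
  rw [map_sub, map_smul, cocycleTerm, cocycleTerm, map_add, map_add, contr_rTensor,
    contr_rTensor, contr_lTensor, contr_lTensor, ← hD, ← hD] at this
  exact this

variable (hskew : ∀ i j, ∀ x ∈ L.grPos i, ∀ y ∈ L.grPos j,
    mul x y = -(ksgn K ((i : ZMod 2) * j) • mul y x))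
  (hjac : ∀ i j, ∀ x ∈ L.grPos i, ∀ y ∈ L.grPos j, ∀ z,
    mul x (mul y z) = mul (mul x y) z + ksgn K ((i : ZMod 2) * j) • mul y (mul x z))
  (hcoskew : ∀ x, koszulSwap L.grPos_internal (comul x) = -comul x)
  (hcojac : ∀ x, comul.rTensor L.Wpos (comul x) +
    koszulCyc L.grPos_internal (comul.rTensor L.Wpos (comul x)) +
    koszulCyc L.grPos_internal (koszulCyc L.grPos_internal
      (comul.rTensor L.Wpos (comul x))) = 0)
  (hcocyc : ∀ i j, ∀ x ∈ L.grPos i, ∀ y ∈ L.grPos j, comul (mul x y) =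
    cocycleTerm mul comul x y - ksgn K ((i : ZMod 2) * j) • cocycleTerm mul comul y x)

include hskew hjac in
-- Transposed, this is the statement that bracketing from the right is an action, which is Jacobi
-- rearranged by skew symmetry.
theorem ofOps_lie_ddd : (ofOps hm hc).toFun (three .co .co .contra) .contra
    (mon K (nD (nA x0 x1) x2) - mon K (nD x0 (nD x1 x2)) + mon K (nD x1 (nD x0 x2))) = 0 := by
  refine L.EndOp_ext₃ fun i j k (x y : L.Wpos) ψ hx hy hψ => ?_
  rw [map_add, map_sub]
  refine (congrArg₂ (· + ·) (congrArg₂ (· - ·)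
    (ofOps_tree_self hm hc (s := three .co .co .contra) (nD (nA x0 x1) x2) _ ord₃ rfl _)
    (ofOps_tree_self hm hc (s := three .co .co .contra) (nD x0 (nD x1 x2)) _ ord₃ rfl _))
    (ofOps_triple hm hc (a := .co) (b := .co) (c := .contra) (nD x1 (nD x0 x2)) _ hx hy hψ rfl
      (inv_swap_left _ _ _))).trans ?_
  change L.opD mul comul (mul x y) ψ - L.opD mul comul x (L.opD mul comul y ψ) +
    ksgn K ((i : ZMod 2) * j) • L.opD mul comul y (L.opD mul comul x ψ) = 0
  refine L.dual_ext_hom fun l w hw => ?_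
  rw [dualE_add_apply, dualE_sub_apply, dualE_smul_apply, dualE_zero_apply, dualE_opD, dualE_opD,
    dualE_opD, dualE_opD, dualE_opD]
  have e : (l : ZMod 2) * i + i * (l + j) = i * j := by
    generalize (i : ZMod 2) = i
    generalize (j : ZMod 2) = j
    generalize (l : ZMod 2) = l
    decide +revert
  have h1 : mul w (mul x y) = mul (mul w x) y - ksgn K ((i : ZMod 2) * j) • mul (mul w y) x := by
    rw [hjac l i w hw x hx, hskew _ _ x hx _ (hm _ _ w hw y hy), Int.cast_add,
      ksgn_smul_neg_ksgn_smul e, sub_eq_add_neg]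
  refine (congrArg (fun t => L.dualE ψ t - L.dualE ψ (mul (mul w x) y) +
    ksgn K ((i : ZMod 2) * j) * L.dualE ψ (mul (mul w y) x)) h1).trans ?_
  simp only [map_sub, map_smul, smul_eq_mul]
  ring

include hcoskew hcojac in
-- `B` is a skew bracket on the dual, so its cyclic Jacobi relation can be put in Leibniz form,
-- whose transpose is the co-Jacobi identity.
theorem ofOps_lie_bbb : (ofOps hm hc).toFun (three .contra .contra .contra) .contra
    (mon K (nB (nB x0 x1) x2) + mon K (nB (nB x2 x0) x1) + mon K (nB (nB x1 x2) x0)) = 0 := by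
  refine L.EndOp_ext₃ fun i j k ψ χ φ hψ hχ hφ => ?_
  rw [map_add, map_add]
  refine (congrArg₂ (· + ·) (congrArg₂ (· + ·)
    (ofOps_tree_self hm hc (s := three .contra .contra .contra) (nB (nB x0 x1) x2) _ ord₃ rfl _)
    (ofOps_triple hm hc (a := .contra) (b := .contra) (c := .contra) (nB (nB x2 x0) x1) _ hψ hχ hφ
      rfl (inv_rot _ _ _)))
    (ofOps_triple hm hc (a := .contra) (b := .contra) (c := .contra) (nB (nB x1 x2) x0) _ hψ hχ hφ
      rfl (inv_rot_rot _ _ _))).trans ?_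
  refine (cyclic_eq_leibniz (gr := L.deg .contra) (br := L.op mul comul .B)
    (fun i j x hx y hy => L.op_mem_deg hm hc (g := .B) hx hy)
    (fun i j x hx y hy => opB_skew hcoskew hx hy) hψ hχ hφ).trans ?_
  change L.opB mul comul (L.opB mul comul ψ χ) φ + ksgn K ((i : ZMod 2) * j) •
    L.opB mul comul χ (L.opB mul comul ψ φ) - L.opB mul comul ψ (L.opB mul comul χ φ) = 0
  refine L.dual_ext fun w => ?_
  rw [dualE_sub_apply, dualE_add_apply, dualE_smul_apply, dualE_zero_apply, dualE_opB, dualE_opB,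
    dualE_opB, dualE_opB, dualE_opB, opC_cojacobi hc hcoskew hcojac hψ hχ, map_add, map_smul,
    smul_eq_mul, sub_self]

include hm hc hskew hcoskew in
-- Skew symmetry of the cobracket exchanges the two functionals, skew symmetry of the bracket
-- exchanges the factors of the product; the two minus signs cancel. This matches the terms of the
-- cocycle condition that do not transpose literally.
theorem dualE_opC_opD {l i a b : ℤ} {w x : L.Wpos} {α β : L.X .contra} (hw : w ∈ L.grPos l)
    (hx : x ∈ L.grPos i) (hα : α ∈ L.deg .contra a) (hβ : β ∈ L.deg .contra b) :
    ksgn K ((l : ZMod 2) * i) * L.dualE β (L.opC mul comul x (L.opD mul comul w α)) =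
      ksgn K ((a : ZMod 2) * b) * L.dualE α (mul w (L.opC mul comul x β)) := by
  have e : (l : ZMod 2) * i + ((l + a) * b + (i + b) * l) = a * b := by
    generalize (i : ZMod 2) = i
    generalize (l : ZMod 2) = l
    generalize (a : ZMod 2) = a
    generalize (b : ZMod 2) = b
    decide +revert
  rw [dualE_opC_skew hcoskew (L.opD_mem hm hc hw hα) hβ, dualE_opD,
    hskew _ _ _ (L.opC_mem hm hc hx hβ) w hw, map_neg, map_smul, smul_eq_mul, mul_neg, mul_neg,
    mul_neg, neg_neg,
    ← mul_assoc, ← mul_assoc, ← ksgn_add, ← ksgn_add, Int.cast_add, Int.cast_add, add_assoc, e]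

include hskew hcoskew hcocyc in
theorem ofOps_lie_dbb : (ofOps hm hc).toFun (three .co .contra .contra) .contra
    (mon K (nB (nD x0 x1) x2) - mon K (nB (nD x0 x2) x1) + mon K (nD (nC x0 x1) x2)
      - mon K (nD (nC x0 x2) x1) - mon K (nD x0 (nB x1 x2))) = 0 := by
  refine L.EndOp_ext₃ fun i a b (x : L.Wpos) α β hx hα hβ => ?_
  rw [map_sub, map_sub, map_add, map_sub]
  refine (congrArg₂ (· - ·) (congrArg₂ (· - ·) (congrArg₂ (· + ·) (congrArg₂ (· - ·)
    (ofOps_tree_self hm hc (s := three .co .contra .contra) (nB (nD x0 x1) x2) _ ord₃ rfl _)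
    (ofOps_triple hm hc (a := .co) (b := .contra) (c := .contra) (nB (nD x0 x2) x1) _ hx hα hβ rfl
      (inv_swap_right _ _ _)))
    (ofOps_tree_self hm hc (s := three .co .contra .contra) (nD (nC x0 x1) x2) _ ord₃ rfl _))
    (ofOps_triple hm hc (a := .co) (b := .contra) (c := .contra) (nD (nC x0 x2) x1) _ hx hα hβ rfl
      (inv_swap_right _ _ _)))
    (ofOps_tree_self hm hc (s := three .co .contra .contra) (nD x0 (nB x1 x2)) _ ord₃ rfl _)).trans
    ?_
  change L.opB mul comul (L.opD mul comul x α) β - ksgn K ((a : ZMod 2) * b) •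
    L.opB mul comul (L.opD mul comul x β) α + L.opD mul comul (L.opC mul comul x α) β -
    ksgn K ((a : ZMod 2) * b) • L.opD mul comul (L.opC mul comul x β) α -
    L.opD mul comul x (L.opB mul comul α β) = 0
  refine L.dual_ext_hom fun l w hw => ?_
  have h1 := dualE_opC_opD hm hc hskew hcoskew hw hx hα hβ
  have h2 := dualE_opC_opD hm hc hskew hcoskew hx hw hβ hα
  have h3 := congrArg (L.dualE β) (opC_cocycle hcocyc hw hx α)
  rw [map_sub, map_smul, map_add, map_add, smul_eq_mul] at h3
  rw [mul_comm (i : ZMod 2), mul_comm (b : ZMod 2)] at h2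
  simp only [dualE_sub_apply, dualE_add_apply, dualE_smul_apply, dualE_zero_apply, dualE_opB,
    dualE_opD]
  have h4 := ksgn_mul_self (K := K) ((a : ZMod 2) * b)
  have h5 := ksgn_mul_self (K := K) ((l : ZMod 2) * i)
  -- The cocycle condition `h3` contains two of the terms as they are. Its other two are turned by
  -- `h1` and `h2` into the terms with `α` outermost; `h4` and `h5` cancel the squared signs.
  linear_combination h1 - ksgn K ((l : ZMod 2) * i) * ksgn K ((a : ZMod 2) * b) * h2 - h3 +
    ksgn K ((a : ZMod 2) * b) * L.dualE α (L.opC mul comul w (L.opD mul comul x β)) * h5 -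
    ksgn K ((l : ZMod 2) * i) * L.dualE β (mul x (L.opC mul comul w α)) * h4

include hskew hjac hcoskew hcojac hcocyc in
theorem ofOps_lie (I : Type) (s : I → Dir) (c : Dir) (x : Fr K s c) (hx : LieRel K I s c x) :
    (ofOps hm hc).toFun s c x = 0 := by
  cases hx with
  | skewA => exact (lie_skewA_iff hm hc).2 hskew
  | skewB => exact (lie_skewB_iff hm hc).2 hcoskew
  | aaa => exact (lie_aaa_iff hm hc hskew).2 hjac
  | aab => exact (lie_aab_iff hm hc).2 hcocyc
  | abb => exact (lie_abb_iff hm hc hcoskew).2 hcojac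
  | bbb => exact ofOps_lie_bbb hm hc hcoskew hcojac
  | dbb => exact ofOps_lie_dbb hm hc hskew hcoskew hcocyc
  | ddd => exact ofOps_lie_ddd hm hc hskew hjac

end LieMorphism

/-! ### The product and the coproduct given by a representation -/

section Projections

variable {K W : Type u} [Field K] [AddCommGroup W] [Module K W] {gr : ℤ → Submodule K W}
  (h : DirectSum.IsInternal gr)

theorem map_gproj_mem_grTensor (i j : ℤ) (t : W ⊗[K] W) :
    TensorProduct.map (gproj h (· = i - j)) (gproj h (· = j)) t ∈ grTensor gr i := by
  induction t with
  | zero => simp only [map_zero, Submodule.zero_mem]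
  | add s t hs ht =>
    rw [map_add]
    exact Submodule.add_mem _ hs ht
  | tmul x y =>
    refine Submodule.mem_iSup_of_mem (i - j) (Submodule.apply_mem_map₂ _ ?_ ?_)
    · exact gproj_mem h _ _ (fun k hk => by rw [hk]) x
    · exact gproj_mem h _ _ (fun k hk => by rw [hk, sub_sub_cancel]) y

theorem exists_lTensor_gproj_eq (t : W ⊗[K] W) :
    ∃ D : Finset ℤ, ∀ D' : Finset ℤ, D ⊆ D' → (gproj h (· ∈ D')).lTensor W t = t := by
  classical
  induction t with
  | zero => exact ⟨∅, fun D' _ => map_zero _⟩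
  | tmul x y =>
    obtain ⟨D, hD⟩ := exists_gproj_eq h y
    exact ⟨D, fun D' hD' => by rw [LinearMap.lTensor_tmul, hD D' hD']⟩
  | add s t hs ht =>
    obtain ⟨D, hD⟩ := hs
    obtain ⟨E, hE⟩ := ht
    exact ⟨D ∪ E, fun D' h => by
      rw [map_add, hD D' (Finset.union_subset_left h), hE D' (Finset.union_subset_right h)]⟩

end Projections

/-- Split the second factor into its finitely many degrees. Contracting with functionals supported
in degree `j` shows that the matching first factors lie in degree `i - j`. -/
theorem LagrangianBraneSpace.mem_grTensor_of_contr {i : ℤ} {t : L.Wpos ⊗[K] L.Wpos}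
    (ht : ∀ j, ∀ ψ ∈ L.deg .contra j, contr (L.dualE ψ) t ∈ L.grPos (i + j)) :
    t ∈ grTensor L.grPos i := by
  have h := L.grPos_internal
  obtain ⟨D, hD⟩ := exists_lTensor_gproj_eq h t
  have h1 := hD D subset_rfl
  have h2 : ∀ j, (gproj h (· = j)).lTensor L.Wpos t =
      TensorProduct.map (gproj h (· = i - j)) (gproj h (· = j)) t := by
    intro j
    rw [← sub_eq_zero, ← LinearMap.rTensor_comp_lTensor, LinearMap.comp_apply]
    refine eq_zero_of_contr fun α => ?_
    rw [map_sub, contr_rTensor, contr_lTensor, sub_eq_zero]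
    -- Precomposition with the projection to degree `j` makes an arbitrary functional homogeneous,
    -- of degree `-j`.
    have hψ : L.dualE.symm (α ∘ₗ gproj h (· = j)) ∈ L.deg .contra (-j) := by
      refine L.mem_grHat.2 fun k hk w hw => ?_
      refine (LinearMap.congr_fun (L.dualE.apply_symm_apply _) w).trans ?_
      rw [LinearMap.comp_apply, gproj_of_neg h (P := (· = j)) (by rwa [neg_neg] at hk) hw, map_zero]
    have := ht _ _ hψ
    rw [LinearEquiv.apply_symm_apply, ← sub_eq_add_neg] at this
    exact (gproj_of_pos h (P := (· = i - j)) rfl this).symm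
  rw [← h1, gproj_finset, ← LinearMap.coe_lTensorHom, map_sum, LinearMap.sum_apply]
  refine Submodule.sum_mem _ fun j _ => ?_
  rw [LinearMap.coe_lTensorHom, h2]
  exact map_gproj_mem_grTensor h i j t

theorem pair_eta {a b : Dir} (x : ∀ i, L.X (two a b i)) :
    Rep.pair (B := L.toBraneSpace) (a := a) (b := b) (x 0) (x 1) = x := by
  funext i
  fin_cases i <;> rfl

theorem pair_update_left {a b : Dir} (x x' : L.X a) (y : L.X b) :
    Function.update (Rep.pair x' y) 0 x = Rep.pair x y := by
  funext i
  fin_cases i <;> rfl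

theorem pair_update_right {a b : Dir} (x : L.X a) (y y' : L.X b) :
    Function.update (Rep.pair x y') 1 y = Rep.pair x y := by
  funext i
  fin_cases i <;> rfl

/-- A multilinear map in two variables as a bilinear map. -/
def bilin {a b c : Dir} (G : MultilinearMap K (fun i => L.X (two a b i)) (L.X c)) :
    L.X a →ₗ[K] L.X b →ₗ[K] L.X c :=
  LinearMap.mk₂ K (fun x y => G (Rep.pair x y))
    (fun x x' y => by
      have := G.map_update_add (Rep.pair x y) 0 x x'
      rwa [pair_update_left, pair_update_left, pair_update_left] at this)
    (fun r x y => by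
      have := G.map_update_smul (Rep.pair x y) 0 r x
      rwa [pair_update_left, pair_update_left] at this)
    (fun x y y' => by
      have := G.map_update_add (Rep.pair x y) 1 y y'
      rwa [pair_update_right, pair_update_right, pair_update_right] at this)
    (fun r x y => by
      have := G.map_update_smul (Rep.pair x y) 1 r y
      rwa [pair_update_right, pair_update_right] at this)

variable {R : Relations K} (ρ : Rep K V L.toBraneSpace R)

theorem Rep.gen_mem_deg (g : Gen) {i j : ℤ} {x : L.X g.inL} {y : L.X g.inR}
    (hx : x ∈ L.deg g.inL i) (hy : y ∈ L.deg g.inR j) :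
    ρ.gen g (Rep.pair x y) ∈ L.deg g.out (i + j) := by
  have := (ρ.toEnd (two g.inL g.inR) g.out
    (Op.mk K R (Fr.tree K (genTree g) (genTree_linear g)))).2.2.1 Rep.ord
      ![i, j] (Rep.pair x y) (fun n => match n with
        | 0 => hx
        | 1 => hy)
  have e : (Rep.ord.1.map ![i, j]).sum = i + j := by simp [Rep.ord]
  rwa [e] at this

/-- This is where the reading along the extra direction is used: the dependence on the functional is
a finite sum of pairings with elements of `U`, which `flat` pulls back to `W⁺`. -/
theorem Rep.exists_contr_eq (x : L.Wpos) :
    ∃ t : L.Wpos ⊗[K] L.Wpos, ∀ ψ : L.X .contra, contr (L.dualE ψ) t = ρ.opC x ψ := by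
  have hE := (ρ.toEnd (two .co .contra) .co
    (Op.mk K R (Fr.tree K (genTree .C) (genTree_linear .C)))).2.2.2 Rep.ord
      (Rep.pair (B := L.toBraneSpace) (a := .co) (b := .contra) x 0)
  have key : ∀ f ∈ Submodule.span K {f : (∀ k, L.X (two .co .contra k)) → L.Wpos |
      ∃ (u : Fin 2 → L.U) (w : L.Wpos), f = fun y => L.pairing (two .co .contra) Rep.ord u y • w},
      ∃ t : L.Wpos ⊗[K] L.Wpos, ∀ (y : ∀ k, L.X (two .co .contra k)),
        contr (L.dualE (y 1)) t = f y := by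
    intro f hf
    induction hf using Submodule.span_induction with
    | mem f hf =>
      obtain ⟨u, w, rfl⟩ := hf
      refine ⟨w ⊗ₜ L.flatE.symm (u 1), fun y => ?_⟩
      rw [contr_tmul]
      refine congrArg (fun r : K => r • w) ?_
      have e : L.pairing (two .co .contra) Rep.ord u y = (show L.What from y 1) (u 1) := by
        change ([L.pairFactor .co (y 0) (u 0), L.pairFactor .contra (y 1) (u 1)] : List K).prod = _
        rw [List.prod_cons, List.prod_singleton]
        exact one_mul _
      rw [e]
      exact congrArg (show L.What from y 1) (L.flat_flatE_symm (u 1))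
    | zero => exact ⟨0, fun y => map_zero _⟩
    | add f g _ _ hf hg =>
      obtain ⟨s, hs⟩ := hf
      obtain ⟨t, ht⟩ := hg
      exact ⟨s + t, fun y => by rw [map_add, hs, ht]; rfl⟩
    | smul r f _ hf =>
      obtain ⟨t, ht⟩ := hf
      exact ⟨r • t, fun y => by rw [map_smul, ht]; rfl⟩
  obtain ⟨t, ht⟩ := key _ hE
  refine ⟨t, fun ψ => (ht (Rep.pair (B := L.toBraneSpace) (a := .co) (b := .contra) x ψ)).trans ?_⟩
  refine congrArg (ρ.gen .C) ?_
  funext k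
  fin_cases k <;> rfl

theorem LagrangianBraneSpace.eq_of_contr_dualE {s t : L.Wpos ⊗[K] L.Wpos}
    (h : ∀ ψ : L.X .contra, contr (L.dualE ψ) s = contr (L.dualE ψ) t) : s = t := by
  rw [← sub_eq_zero]
  refine eq_zero_of_contr fun α => ?_
  have := h (L.dualE.symm α)
  rw [LinearEquiv.apply_symm_apply] at this
  rw [map_sub, this, sub_self]

/-- The value on `C` as a coproduct. -/
theorem Rep.exists_comul : ∃ comul : L.Wpos →ₗ[K] L.Wpos ⊗[K] L.Wpos,
    ∀ (x : L.Wpos) (ψ : L.X .contra), contr (L.dualE ψ) (comul x) = ρ.opC x ψ := by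
  choose f hf using ρ.exists_contr_eq
  let G : L.X .co →ₗ[K] L.X .contra →ₗ[K] L.X .co := bilin (ρ.gen .C)
  -- The chosen tensor is unique, so the choice inherits linearity from `C`.
  refine ⟨⟨⟨f, fun x y => eq_of_contr_dualE fun ψ => ?_⟩, fun r x => eq_of_contr_dualE fun ψ => ?_⟩,
    hf⟩
  · rw [map_add, hf, hf, hf]
    exact LinearMap.map_add₂ G x y ψ
  · change contr (L.dualE ψ) (f (r • x)) = contr (L.dualE ψ) (r • f x)
    rw [map_smul, hf, hf]
    exact LinearMap.map_smul₂ G r x ψ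

theorem Rep.exists_induces : ∃ (mul : L.Wpos →ₗ[K] L.Wpos →ₗ[K] L.Wpos)
    (comul : L.Wpos →ₗ[K] L.Wpos ⊗[K] L.Wpos),
    (∀ i j, ∀ x ∈ L.grPos i, ∀ y ∈ L.grPos j, mul x y ∈ L.grPos (i + j)) ∧
    (∀ i, ∀ x ∈ L.grPos i, comul x ∈ grTensor L.grPos i) ∧ ρ.Induces mul comul := by
  obtain ⟨comul, hcomul⟩ := ρ.exists_comul
  refine ⟨bilin (a := .co) (b := .co) (c := .co) (ρ.gen .A), comul,
    fun i j x hx y hy => ρ.gen_mem_deg .A hx hy, fun i x hx => mem_grTensor_of_contr fun j ψ hψ =>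
        ?_,
    fun _ _ => rfl, hcomul⟩
  rw [hcomul]
  exact ρ.gen_mem_deg .C hx hψ

variable {ρ}

theorem Rep.Induces.unique {mul mul' : L.Wpos →ₗ[K] L.Wpos →ₗ[K] L.Wpos}
    {comul comul' : L.Wpos →ₗ[K] L.Wpos ⊗[K] L.Wpos} (h : ρ.Induces mul comul)
    (h' : ρ.Induces mul' comul') : mul = mul' ∧ comul = comul' :=
  ⟨LinearMap.ext₂ fun x y => (h.1 x y).trans (h'.1 x y).symm,
    LinearMap.ext fun x => eq_of_contr_dualE fun ψ => (h.2 x ψ).trans (h'.2 x ψ).symm⟩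

/-! ### Reduced representations and pairs of operations -/

section

variable {mul : L.Wpos →ₗ[K] L.Wpos →ₗ[K] L.Wpos} {comul : L.Wpos →ₗ[K] L.Wpos ⊗[K] L.Wpos}
  (hm : ∀ i j, ∀ x ∈ L.grPos i, ∀ y ∈ L.grPos j, mul x y ∈ L.grPos (i + j))
  (hc : ∀ i, ∀ x ∈ L.grPos i, comul x ∈ grTensor L.grPos i)

/-- A reduced representation is determined by the product and the coproduct. -/
theorem Rep.IsReduced.free_eq_ofOps (hr : ρ.IsReduced) (hi : ρ.Induces mul comul) {I : Type}
    (s : I → Dir) (c : Dir) (x : Fr K s c) :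
    ρ.free.toFun s c x = (FreeMor.ofOps hm hc).toFun s c x := by
  refine FreeMor.eq_of_gen (fun g => MultilinearMap.ext fun x => ?_) s c x
  refine Eq.trans ?_ (FreeMor.ofOps_gen hm hc g x).symm
  change ρ.gen g x = _
  have hC : ∀ (x : L.Wpos) (ψ : L.X .contra), ρ.opC x ψ = L.op mul comul .C x ψ :=
    fun x ψ => (hi.2 x ψ).symm
  have hA : ∀ x y : L.Wpos, ρ.opA x y = mul x y := fun x y => (hi.1 x y).symm
  refine (congrArg (ρ.gen g) (pair_eta x).symm).trans ?_
  generalize x 0 = y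
  generalize x 1 = z
  cases g
  · exact hA y z
  · refine L.dual_ext fun w => ?_
    refine Eq.trans ?_ (L.dualE_op_B mul comul y z w).symm
    exact (hr.2 w y z).trans (congrArg (L.dualE z) (hC w y))
  · exact hC y z
  · refine L.dual_ext fun w => ?_
    refine Eq.trans ?_ (L.dualE_op_D mul comul y z w).symm
    exact (hr.1 w y z).trans (congrArg (L.dualE z) (hA w y))

variable (h : ∀ I s c x, R I s c x → (FreeMor.ofOps hm hc).toFun s c x = 0)

theorem toRep_gen (g : Gen) (x : L.X g.inL) (y : L.X g.inR) :
    ((FreeMor.ofOps hm hc).toRep h).gen g (Rep.pair x y) = L.op mul comul g x y :=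
  FreeMor.ofOps_gen hm hc g (Rep.pair x y)

theorem toRep_isReduced : ((FreeMor.ofOps hm hc).toRep h).IsReduced := by
  constructor
  · intro x y ψ
    refine (congrArg (fun η : L.X .contra => L.dualE η x) (toRep_gen hm hc h .D y ψ)).trans ?_
    refine (L.dualE_op_D mul comul y ψ x).trans ?_
    exact congrArg (L.dualE ψ) (toRep_gen hm hc h .A x y).symm
  · intro x ψ χ
    refine (congrArg (fun η : L.X .contra => L.dualE η x) (toRep_gen hm hc h .B ψ χ)).trans ?_
    refine (L.dualE_op_B mul comul ψ χ x).trans ?_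
    exact congrArg (L.dualE χ) (toRep_gen hm hc h .C x ψ).symm

theorem toRep_induces : ((FreeMor.ofOps hm hc).toRep h).Induces mul comul :=
  ⟨fun x y => (toRep_gen hm hc h .A x y).symm, fun x ψ => (toRep_gen hm hc h .C x ψ).symm⟩

include hm hc h in
-- Any reduced representation inducing these operations coincides on the free operad with
-- `FreeMor.ofOps`, and the free operad surjects onto the quotient.
theorem existsUnique_rep :
    ∃! ρ : Rep K V L.toBraneSpace R, ρ.IsReduced ∧ ρ.Induces mul comul := by
  refine ⟨(FreeMor.ofOps hm hc).toRep h, ⟨toRep_isReduced hm hc h, toRep_induces hm hc h⟩, ?_⟩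
  rintro ρ ⟨hr, hi⟩
  refine Rep.ext_free fun I s c x => ?_
  rw [hr.free_eq_ofOps hm hc hi, (toRep_isReduced hm hc h).free_eq_ofOps hm hc
    (toRep_induces hm hc h)]

end

/-- Transfers the relations from an abstract representation to tree evaluation, where they have been
identified with the axioms. -/
theorem Rep.IsReduced.ofOps_eq_zero {mul : L.Wpos →ₗ[K] L.Wpos →ₗ[K] L.Wpos}
    {comul : L.Wpos →ₗ[K] L.Wpos ⊗[K] L.Wpos}
    (hm : ∀ i j, ∀ x ∈ L.grPos i, ∀ y ∈ L.grPos j, mul x y ∈ L.grPos (i + j))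
    (hc : ∀ i, ∀ x ∈ L.grPos i, comul x ∈ grTensor L.grPos i) (hr : ρ.IsReduced)
    (hi : ρ.Induces mul comul) {I : Type} {s : I → Dir} {c : Dir} {x : Fr K s c}
    (hx : R I s c x) : (FreeMor.ofOps hm hc).toFun s c x = 0 := by
  rw [← hr.free_eq_ofOps hm hc hi]
  change ρ.toEnd s c (Op.mk K R x) = 0
  rw [show Op.mk K R x = 0 from (Submodule.Quotient.mk_eq_zero _).2 (InIdeal.rel x hx), map_zero]

theorem InfBialgebra.ext_of {W : Type u} [AddCommGroup W] [Module K W] {gr : ℤ → Submodule K W}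
    {S T : InfBialgebra gr} (h : S.mul = T.mul) (h' : S.comul = T.comul) : S = T := by
  cases S
  cases T
  cases h
  cases h'
  rfl

theorem LieBialgebra.ext_of {W : Type u} [AddCommGroup W] [Module K W] {gr : ℤ → Submodule K W}
    {hgr : DirectSum.IsInternal gr} {S T : LieBialgebra hgr} (h : S.bracket = T.bracket)
    (h' : S.cobracket = T.cobracket) : S = T := by
  cases S
  cases T
  cases h
  cases h'
  rfl

/-! ### The two correspondences -/

theorem existsUnique_infBialgebra (ρ : Rep K V L.toBraneSpace (AssRel K)) (hr : ρ.IsReduced) :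
    ∃! S : InfBialgebra L.grPos, ρ.Induces S.mul S.comul := by
  obtain ⟨mul, comul, hm, hc, hi⟩ := ρ.exists_induces
  refine ⟨⟨mul, comul, hm, hc, (ass_aaa_iff hm hc).1 (hr.ofOps_eq_zero hm hc hi .aaa),
    (ass_abb_iff hm hc).1 (hr.ofOps_eq_zero hm hc hi .abb),
    (ass_aab_iff hm hc).1 (hr.ofOps_eq_zero hm hc hi .aab)⟩, hi, fun S hS => ?_⟩
  exact InfBialgebra.ext_of (hS.unique hi).1 (hS.unique hi).2

theorem negOnePow_mul_smul {M : Type*} [AddCommGroup M] [Module K M] (i j : ℤ) (v : M) :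
    Int.negOnePow (i * j) • v = ksgn K ((i : ZMod 2) * j) • v := by
  rw [negOnePow_smul (K := K), Int.cast_mul]

/-- The skew symmetries are extracted first, because the Jacobi and co-Jacobi relations are
equivalent to the axioms only in their presence. -/
theorem existsUnique_lieBialgebra (ρ : Rep K V L.toBraneSpace (LieRel K)) (hr : ρ.IsReduced) :
    ∃! S : LieBialgebra L.grPos_internal, ρ.Induces S.bracket S.cobracket := by
  obtain ⟨mul, comul, hm, hc, hi⟩ := ρ.exists_induces
  have hskew := (lie_skewA_iff hm hc).1 (hr.ofOps_eq_zero hm hc hi .skewA)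
  have hcoskew := (lie_skewB_iff hm hc).1 (hr.ofOps_eq_zero hm hc hi .skewB)
  have hjac := (lie_aaa_iff hm hc hskew).1 (hr.ofOps_eq_zero hm hc hi .aaa)
  have hcojac := (lie_abb_iff hm hc hcoskew).1 (hr.ofOps_eq_zero hm hc hi .abb)
  have hcocyc := (lie_aab_iff hm hc).1 (hr.ofOps_eq_zero hm hc hi .aab)
  refine ⟨⟨mul, comul, hm, hc, fun i j x hx y hy => ?_, fun i j x hx y hy z => ?_, hcoskew, hcojac,
    fun i j x hx y hy => ?_⟩, hi, fun S hS => ?_⟩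
  · rw [negOnePow_mul_smul (K := K), hskew i j x hx y hy]
  · rw [negOnePow_mul_smul (K := K), hjac i j x hx y hy z]
  · rw [negOnePow_mul_smul (K := K), hcocyc i j x hx y hy]
  · exact LieBialgebra.ext_of (hS.unique hi).1 (hS.unique hi).2

theorem InfBialgebra.existsUnique_rep (S : InfBialgebra L.grPos) :
    ∃! ρ : Rep K V L.toBraneSpace (AssRel K), ρ.IsReduced ∧ ρ.Induces S.mul S.comul :=
  TwoOriented.existsUnique_rep S.mul_degree S.comul_degree
    (ofOps_ass S.mul_degree S.comul_degree S.mul_assoc S.comul_coassoc S.comul_mul)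

theorem LieBialgebra.existsUnique_rep (S : LieBialgebra L.grPos_internal) :
    ∃! ρ : Rep K V L.toBraneSpace (LieRel K), ρ.IsReduced ∧ ρ.Induces S.bracket S.cobracket := by
  refine TwoOriented.existsUnique_rep S.bracket_degree S.cobracket_degree
    (ofOps_lie S.bracket_degree S.cobracket_degree (fun i j x hx y hy => ?_)
      (fun i j x hx y hy z => ?_) S.cobracket_skew S.cojacobi fun i j x hx y hy => ?_)
  · rw [← negOnePow_mul_smul (K := K), S.bracket_skew i j x hx y hy]
  · rw [← negOnePow_mul_smul (K := K), S.jacobi i j x hx y hy z]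
  · exact (S.cocycle i j x hx y hy).trans
      (congrArg (cocycleTerm S.bracket S.cobracket x y - ·) (negOnePow_mul_smul i j _))

end TwoOriented

end

theorem proposition4p4p4 (K V : Type u) [Field K] [AddCommGroup V] [Module K V]
    (L : LagrangianBraneSpace K V) :
    ((∀ ρ : Rep K V L.toBraneSpace (AssRel K), ρ.IsReduced →
        ∃! S : InfBialgebra L.grPos, ρ.Induces S.mul S.comul) ∧
      (∀ S : InfBialgebra L.grPos,
        ∃! ρ : Rep K V L.toBraneSpace (AssRel K), ρ.IsReduced ∧ ρ.Induces S.mul S.comul)) ∧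
    ((∀ ρ : Rep K V L.toBraneSpace (LieRel K), ρ.IsReduced →
        ∃! S : LieBialgebra L.grPos_internal, ρ.Induces S.bracket S.cobracket) ∧
      (∀ S : LieBialgebra L.grPos_internal,
        ∃! ρ : Rep K V L.toBraneSpace (LieRel K),
          ρ.IsReduced ∧ ρ.Induces S.bracket S.cobracket)) :=
  ⟨⟨existsUnique_infBialgebra, InfBialgebra.existsUnique_rep⟩,
    existsUnique_lieBialgebra, LieBialgebra.existsUnique_rep⟩
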